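/- \textbf{Setup.} Let $Z=(X_1,A_1,\dots,X_T,A_T,Y)$ with $X_t\in\mathbb{R}^d$, $A_t\in\{0,1\}$, $Y\in\mathbb{R}$, and let $H_t=(X_1,A_1,\dots,X_{t-1},A_{t-1},X_t)$. Fix a target regime $(a_1,\dots,a_T)\in\{0,1\}^T$ and weights $s_t:[0,1]\to[0,1]$ that are twice differentiable with bounded first and second derivatives. For a law $\mathbb{P}$ of $Z$ put $\pi_t=\mathbb{P}(A_t=a_t\mid H_t)$, \[ Q_t(a_t\mid H_t)=\pi_t+s_t(\pi_t)(1-\pi_t),\qquad Q_t(1-a_t\mid H_t)=1-Q_t(a_t\mid H_t),\qquad r_t(b\mid H_t)=\frac{Q_t(b\mid H_t)}{\mathbb{P}(A_t=b\mid H_t)} . \] Let $P_{T+1}=Y$ and, recursively for $t=T,\dots,1$, \[ m_t(b,H_t)=\mathbb{E}(P_{t+1}\mid A_t=b,H_t),\qquad P_t=\sum_{b\in\{0,1\}} m_t(b,H_t)\,Q_t(b\mid H_t), \] and let $m_0=\mathbb{E}(P_1)$. (When $\mathbb{P}(A_t=b\mid H_t)=0$ the value of $m_t(b,H_t)$ is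 immaterial.) The nonparametric model consists of all laws $\mathbb{P}$ of $Z$ such that, for some finite $C$, $\mathrm{Var}(Y)\le C$ and $|r_t(A_t\mid H_t)|\le C$ almost surely for all $t$, and such that either (1) for every $t$, almost surely, $\pi_t=0$ implies $s_t(\pi_t)=0$, or (2) for every $t$, $\pi_t\ne0$ almost surely. A regular submodel through $\mathbb{P}$ is a path $(\mathbb{P}_\varepsilon)$ with $\mathbb{P}_0=\mathbb{P}$ such that, for all $\varepsilon$ near $0$, $\mathbb{P}_\varepsilon$ is dominated by $\mathbb{P}$ and belongs to the model with a common bound $C$, and which is differentiable in quadratic mean at $\varepsilon=0$ with a score $S\in L^2(\mathbb{P})$. The tangent space is the closed linear span in $L^2(\mathbb P)$ of all such scores. The efficient influence function of a functional $\psi$ at $\mathbb{P}$ is the mean-zero $\varphi\in L^2(\mathbb{P})$ that lies in the tangent space and satisfies $\frac{d}{d\varepsilon}\psi(\mathbb{P}_\varepsilon)\big|_{\varepsilon=0}=\mathbb{E}\{\varphi(Z)S(Z)\}$ for every regular submodel. \textbf{Proposition.} Let $\mathbb{P}$ belong to the model. (a) Suppose $Z\sim\mathbb{P}$ is generated by a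 nonparametric structural equation model $X_t=f_{X,t}(A_{t-1},H_{t-1},U_{X,t})$, $A_t=f_{A,t}(H_t,U_{A,t})$, $Y=f_Y(A_T,H_T,U_Y)$ on a standard Borel probability space, with $U_{A,t}$ independent of $\{U_{X,s},U_{A,s}:s>t\}\cup\{U_Y\}$ given $H_t$ for every $t$. Let $V_1,\dots,V_T$ be iid uniform on $[0,1]$ and independent of all the exogenous variables $U$, and let $f_t$ be measurable $[0,1]$-valued functions of the history with $f_t(H_t)=s_t(\pi_t)$ almost surely. Let $Y(\overline D_{\overline f}(\overline a_T))$ be the outcome generated by the model when, at each time $t$ and with the counterfactual history $h$ generated so far, the natural treatment value $n=f_{A,t}(h,U_{A,t})$ is kept if $n=a_t$, and otherwise is replaced by $a_t$ if $V_t\le f_t(h)$ and kept if $V_t>f_t(h)$. Then $Y(\overline D_{\overline f}(\overline a_T))$ is integrable and $\psi:=\mathbb{E}[Y(\overline D_{\overline f}(\overline a_T))]=m_0$. (b) The efficient influence function at $\mathbb{P}$ of this functional $\psi=\psi(\mathbb{P})=m_0$ in the nonparametric model is $\varphi=\varphi_m+\varphi_Q$, where \begin{align*} \varphi_m(Z)&=(P_1-m_0)+\sum_{t=1}^{T}\Big\{\prod_{s=1}^{t}r_s(A_s\mid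 H_s)\Big\}\big\{P_{t+1}-m_t(A_t,H_t)\big\},\\ \varphi_Q(Z)&=\sum_{t=1}^{T}\Big\{\prod_{s=1}^{t-1}r_s(A_s\mid H_s)\Big\}\sum_{b\in\{0,1\}}m_t(b,H_t)\,\phi_t(b;A_t,H_t),\\ \phi_t(b;A_t,H_t)&=\{2\cdot\mathbf 1(b=a_t)-1\}\{\mathbf 1(A_t=a_t)-\pi_t\}\big[1-s_t(\pi_t)+s_t'(\pi_t)(1-\pi_t)\big]. \end{align*} -/

import Mathlib

open MeasureTheory ProbabilityTheory Filter Topology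
open scoped ENNReal

universe u v

noncomputable section

namespace Flip

/-! ### Efficient influence functions -/

section Efficiency

variable {Z : Type*} [MeasurableSpace Z]

/-- `γ` is a regular one-dimensional submodel through `P` with score `S`: probability measures
`γ ε`, dominated by `P`, with `γ 0 = P`, whose root densities are differentiable in quadratic mean
at `ε = 0` with derivative `S / 2`. -/
structure IsRegularSubmodel (P : Measure Z) (γ : ℝ → Measure Z) (S : Z → ℝ) : Prop where
  through : γ 0 = P
  isProb : ∀ᶠ ε in 𝓝 (0 : ℝ), IsProbabilityMeasure (γ ε)
  dominated : ∀ᶠ ε in 𝓝 (0 : ℝ), γ ε ≪ P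
  score_memLp : MemLp S 2 P
  qmd : Tendsto
    (fun ε : ℝ => ∫ z, ((√((γ ε).rnDeriv P z).toReal - 1) / ε - S z / 2) ^ 2 ∂P)
    (𝓝[≠] 0) (𝓝 0)

/-- The tangent space at `P`: the closed linear span in `L²(P)` of the scores of the regular
submodels through `P` that belong to the class `𝒮`. -/
def tangentSpace (𝒮 : Set (ℝ → Measure Z)) (P : Measure Z) : Submodule ℝ (Lp ℝ 2 P) :=
  (Submodule.span ℝ {g : Lp ℝ 2 P | ∃ γ ∈ 𝒮, IsRegularSubmodel P γ g}).topologicalClosure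

/-- `φ` is the efficient influence function (canonical gradient) at `P` of the functional `ψ`
relative to the class `𝒮` of submodels: it is square integrable with mean zero, it represents the
derivative of `ψ` along every regular submodel of the class, and it lies in the tangent space. -/
structure IsEfficientInfluenceFunction (𝒮 : Set (ℝ → Measure Z)) (ψ : Measure Z → ℝ)
    (P : Measure Z) (φ : Z → ℝ) : Prop where
  memLp : MemLp φ 2 P
  mean_zero : ∫ z, φ z ∂P = 0
  gradient : ∀ γ ∈ 𝒮, ∀ S : Z → ℝ, IsRegularSubmodel P γ S →
    HasDerivAt (fun ε => ψ (γ ε)) (∫ z, φ z * S z ∂P) 0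
  mem_tangentSpace : memLp.toLp φ ∈ tangentSpace 𝒮 P

end Efficiency

/-! ### Longitudinal data

There are `T` timepoints, indexed from `0` by `Fin T`; `true` is treatment `1` and `false` is
treatment `0`. -/

/-- Covariates at one timepoint. -/
abbrev Cov (d : ℕ) : Type := Fin d → ℝ

/-- Covariates and treatments strictly before time `t`. -/
abbrev Past (T d : ℕ) (t : Fin T) : Type := Set.Iio t → Cov d × Bool

/-- Values of `H_t`: covariates and treatments strictly before `t`, and covariates at `t`. -/
abbrev Hist (T d : ℕ) (t : Fin T) : Type := Past T d t × Cov d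

/-- Covariates and treatments at all timepoints. -/
abbrev Traj (T d : ℕ) : Type := Fin T → Cov d × Bool

/-- Values of the observation `Z = (X_1, A_1, …, X_T, A_T, Y)`. -/
abbrev Obs (T d : ℕ) : Type := Traj T d × ℝ

/-- The history `H_t` along a trajectory. -/
def histOf {T d : ℕ} (t : Fin T) (x : Traj T d) : Hist T d t := (fun i => x i, (x t).1)

section Functional

variable {T d : ℕ}

/-- The observed history `H_t`. -/
def hist (t : Fin T) (z : Obs T d) : Hist T d t := histOf t z.1

/-- The observed treatment `A_t`. -/
def treat (t : Fin T) (z : Obs T d) : Bool := (z.1 t).2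

/-- The outcome `Y`. -/
def outcome (z : Obs T d) : ℝ := z.2

/-- The σ-algebra generated by `H_t`. -/
@[reducible] def histSigma (T d : ℕ) (t : Fin T) : MeasurableSpace (Obs T d) :=
  MeasurableSpace.comap (hist t) inferInstance

/-- `P(A_t = b ∣ H_t)`. -/
def prop (P : Measure (Obs T d)) (t : Fin T) (b : Bool) : Obs T d → ℝ :=
  P[fun z => if treat t z = b then (1 : ℝ) else 0 | histSigma T d t]

/-- `E(W ∣ A_t = b, H_t)`, as `E(W 1(A_t = b) ∣ H_t) / P(A_t = b ∣ H_t)`. -/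
def condMean (P : Measure (Obs T d)) (t : Fin T) (b : Bool) (W : Obs T d → ℝ) : Obs T d → ℝ :=
  fun z => (P[fun z => if treat t z = b then W z else 0 | histSigma T d t]) z / prop P t b z

/-- The intervention propensity score `Q_t(b ∣ H_t)` of the flip intervention that targets `a`
with weight `s_t{P(A_t = a_t ∣ H_t)}`. -/
def intProp (a : Fin T → Bool) (s : Fin T → ℝ → ℝ) (P : Measure (Obs T d)) (t : Fin T) (b : Bool) :
    Obs T d → ℝ := fun z =>
  let q := prop P t (a t) z + s t (prop P t (a t) z) * (1 - prop P t (a t) z)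
  if b = a t then q else 1 - q

/-- The ratio `r_t(A_t ∣ H_t) = Q_t(A_t ∣ H_t) / P(A_t ∣ H_t)`. -/
def ratio (a : Fin T → Bool) (s : Fin T → ℝ → ℝ) (P : Measure (Obs T d)) (t : Fin T) :
    Obs T d → ℝ := fun z => intProp a s P t (treat t z) z / prop P t (treat t z) z

/-- The pseudo-outcomes: `∑_b m_k(b, H_k) Q_k(b ∣ H_k)` for a timepoint `k < T`, and `Y` after the
last timepoint; here `m_k(b, H_k)` is the mean of the next pseudo-outcome given `A_k = b` and
`H_k`. -/
def pseudo (a : Fin T → Bool) (s : Fin T → ℝ → ℝ) (P : Measure (Obs T d)) (k : ℕ) :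
    Obs T d → ℝ :=
  if hk : k < T then
    fun z => ∑ b : Bool,
      condMean P ⟨k, hk⟩ b (pseudo a s P (k + 1)) z * intProp a s P ⟨k, hk⟩ b z
  else outcome
termination_by T - k

/-- The sequential regression `m_t(b, H_t)`. -/
def seqReg (a : Fin T → Bool) (s : Fin T → ℝ → ℝ) (P : Measure (Obs T d)) (t : Fin T) (b : Bool) :
    Obs T d → ℝ := condMean P t b (pseudo a s P (t + 1))

/-- The identified mean `m_0 = E{∑_b m_1(b, H_1) Q_1(b ∣ H_1)}`. -/
def identifiedMean (a : Fin T → Bool) (s : Fin T → ℝ → ℝ) (P : Measure (Obs T d)) : ℝ :=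
  ∫ z, pseudo a s P 0 z ∂P

/-- The influence function with known `Q_t`; the first summand is the term of the baseline index,
where the product of ratios is `1` and the sequential regression is the identified mean. -/
def phiM (a : Fin T → Bool) (s : Fin T → ℝ → ℝ) (P : Measure (Obs T d)) (z : Obs T d) : ℝ :=
  (pseudo a s P 0 z - identifiedMean a s P) +
    ∑ t : Fin T, (∏ j ∈ Finset.Iic t, ratio a s P j z) *
      (pseudo a s P (t + 1) z - seqReg a s P t (treat t z) z)

/-- `φ_t(b; A_t, H_t)`. -/
def phiProp (a : Fin T → Bool) (s : Fin T → ℝ → ℝ) (P : Measure (Obs T d)) (t : Fin T) (b : Bool)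
    (z : Obs T d) : ℝ :=
  (2 * (if b = a t then (1 : ℝ) else 0) - 1) *
    ((if treat t z = a t then (1 : ℝ) else 0) - prop P t (a t) z) *
    (1 - s t (prop P t (a t) z) +
      derivWithin (s t) (Set.Icc 0 1) (prop P t (a t) z) * (1 - prop P t (a t) z))

/-- The part of the influence function that accounts for estimating `Q_t`. -/
def phiQ (a : Fin T → Bool) (s : Fin T → ℝ → ℝ) (P : Measure (Obs T d)) (z : Obs T d) : ℝ :=
  ∑ t : Fin T, (∏ j ∈ Finset.Iio t, ratio a s P j z) *
    ∑ b : Bool, seqReg a s P t b z * phiProp a s P t b z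

/-- A smooth weight: a map `[0,1] → [0,1]` that is twice differentiable on `[0,1]` with bounded
first and second derivative. -/
structure IsSmoothWeight (s : ℝ → ℝ) : Prop where
  mapsTo : Set.MapsTo s (Set.Icc 0 1) (Set.Icc 0 1)
  differentiableOn : DifferentiableOn ℝ s (Set.Icc 0 1)
  differentiableOn_deriv : DifferentiableOn ℝ (derivWithin s (Set.Icc 0 1)) (Set.Icc 0 1)
  bounded : ∃ K : ℝ, ∀ x ∈ Set.Icc (0 : ℝ) 1, |derivWithin s (Set.Icc 0 1) x| ≤ K ∧
    |derivWithin (derivWithin s (Set.Icc 0 1)) (Set.Icc 0 1) x| ≤ K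

/-- The laws of the observation for which the variance of `Y` and the ratios `r_t(A_t ∣ H_t)` are
bounded by `C`, and which satisfy one of the two identification conditions: the weight vanishes
wherever the propensity score of the target treatment does, or that score is almost surely
nonzero. Nothing else is assumed about the law. -/
structure InModel (a : Fin T → Bool) (s : Fin T → ℝ → ℝ) (C : ℝ) (P : Measure (Obs T d)) :
    Prop where
  isProb : IsProbabilityMeasure P
  memLp : MemLp outcome 2 P
  variance_le : Var[outcome; P] ≤ C
  ratio_le : ∀ t, ∀ᵐ z ∂P, |ratio a s P t z| ≤ C
  identification :
    (∀ t, ∀ᵐ z ∂P, prop P t (a t) z = 0 → s t (prop P t (a t) z) = 0) ∨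
    (∀ t, P {z | prop P t (a t) z = 0} = 0)

/-- The submodels of the nonparametric model: paths of laws that satisfy the model conditions near
`ε = 0` with a common bound. -/
def nonparametricSubmodels (d : ℕ) (a : Fin T → Bool) (s : Fin T → ℝ → ℝ) :
    Set (ℝ → Measure (Obs T d)) :=
  {γ | ∃ C : ℝ, ∀ᶠ ε in 𝓝 (0 : ℝ), InModel a s C (γ ε)}

end Functional

/-! ### Structural equations and flip interventions -/

/-- A nonparametric structural equation model: measurable functions `f_{X,t}`, `f_{A,t}`, `f_Y`. -/
structure NPSEM (T d : ℕ) (UX UA : Fin T → Type v) (UY : Type v)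
    [∀ t, MeasurableSpace (UX t)] [∀ t, MeasurableSpace (UA t)] [MeasurableSpace UY] where
  fX : ∀ t, Past T d t × UX t → Cov d
  fA : ∀ t, Hist T d t × UA t → Bool
  fY : Traj T d × UY → ℝ
  measurable_fX : ∀ t, Measurable (fX t)
  measurable_fA : ∀ t, Measurable (fA t)
  measurable_fY : Measurable fY

/-- Values of the vector of exogenous variables. -/
abbrev Exo {T : ℕ} (UX UA : Fin T → Type v) (UY : Type v) : Type v :=
  (∀ t, UX t) × (∀ t, UA t) × UY

section NPSEM

variable {T d : ℕ} {UX UA : Fin T → Type v} {UY : Type v}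
  [∀ t, MeasurableSpace (UX t)] [∀ t, MeasurableSpace (UA t)] [MeasurableSpace UY]

namespace NPSEM

/-- The trajectory generated when, at each time `t`, the assigned treatment is `δ t h n`, where `h`
is the (counterfactual) history generated so far and `n = f_{A,t}(h, U_{A,t})` is the natural value
of treatment. -/
def traj (M : NPSEM T d UX UA UY) (δ : ∀ t, Hist T d t → Bool → Bool) (w : Exo UX UA UY)
    (t : Fin T) : Cov d × Bool :=
  let past : Past T d t := fun i => M.traj δ w i.1
  let h : Hist T d t := (past, M.fX t (past, w.1 t))
  (h.2, δ t h (M.fA t (h, w.2.1 t)))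
termination_by t
decreasing_by exact i.2

/-- The outcome under the interventions `δ`. -/
def outcomeUnder (M : NPSEM T d UX UA UY) (δ : ∀ t, Hist T d t → Bool → Bool)
    (w : Exo UX UA UY) : ℝ := M.fY (M.traj δ w, w.2.2)

/-- No intervention: the assigned treatment is the natural value. -/
def noIntervention (T d : ℕ) : ∀ t : Fin T, Hist T d t → Bool → Bool := fun _ _ n => n

/-- The observation generated by the model. -/
def observed (M : NPSEM T d UX UA UY) (w : Exo UX UA UY) : Obs T d :=
  (M.traj (noIntervention T d) w, M.outcomeUnder (noIntervention T d) w)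

/-- The flip intervention targeting `a` with weights `f` and auxiliary values `V`: keep the natural
value `n` if it is the target; otherwise switch to the target if `V_t ≤ f_t(h)`. -/
def flip (a : Fin T → Bool) (f : ∀ t, Hist T d t → ℝ) (V : Fin T → ℝ) :
    ∀ t, Hist T d t → Bool → Bool :=
  fun t h n => if n = a t then n else if V t ≤ f t h then a t else n

lemma measurable_traj (M : NPSEM T d UX UA UY) (t : Fin T) :
    Measurable (fun w => M.traj (noIntervention T d) w t) := by
  induction t using WellFoundedLT.induction with
  | ind t ih =>
    have hp : Measurable
        (fun w => (fun i => M.traj (noIntervention T d) w i.1 : Past T d t)) :=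
      measurable_pi_lambda _ fun (i : Set.Iio t) => ih i.1 i.2
    have hx := (M.measurable_fX t).comp
      (hp.prodMk ((measurable_pi_apply t).comp measurable_fst))
    have hA := (M.measurable_fA t).comp ((hp.prodMk hx).prodMk
      ((measurable_pi_apply t).comp (measurable_fst.comp measurable_snd)))
    have := hx.prodMk hA
    convert this using 2 with w
    rw [traj]
    rfl

lemma measurable_histOf_traj (M : NPSEM T d UX UA UY) (t : Fin T) :
    Measurable (fun w => histOf t (M.traj (noIntervention T d) w)) :=
  (measurable_pi_lambda _ fun (i : Set.Iio t) => M.measurable_traj i.1).prodMk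
    (measurable_fst.comp (M.measurable_traj t))

/-- Strong sequential randomization: for every `t`, given `H_t`, the variable `U_{A,t}` is
independent of all later `U_{X,s}` and `U_{A,s}` and of `U_Y`. -/
def StrongSequentialRandomization {Ω : Type u} [MeasurableSpace Ω] [StandardBorelSpace Ω]
    (μ : Measure Ω) [IsFiniteMeasure μ] (M : NPSEM T d UX UA UY) {W : Ω → Exo UX UA UY}
    (hW : Measurable W) : Prop :=
  ∀ t : Fin T,
    CondIndepFun
      (MeasurableSpace.comap (fun ω => histOf t (M.traj (noIntervention T d) (W ω))) inferInstance)
      ((M.measurable_histOf_traj t).comp hW).comap_le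
      (fun ω => (W ω).2.1 t)
      (fun ω => ((fun i : Set.Ioi t => (W ω).1 i.1), (fun i : Set.Ioi t => (W ω).2.1 i.1),
        (W ω).2.2))
      μ

end NPSEM

end NPSEM

end Flip

end

/-!
Two descriptions of the identified mean carry the proof. It is defined by iterated regressions, and
telescoping over time turns it into the mean of the outcome weighted by the product of the ratios
`r_t` (`InModel.identifiedMean_eq`). The ratios are used in a version that is bounded and measurable
with respect to the history everywhere (`flipWeight`, and `cumWeight` for the products), so that
integrability is never in question. The telescoping works for the weights of any law
(`InModel.integral_cumWeight_mul_outcome_sub`), which is what the differentiation needs.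

*Identification.* Consider the interventions that act from time `k` on and leave the treatment alone
before (`startAt`). Passing from `k = t` to `k = t + 1` is compensated by the weight of time `t`
(`lintegral_startAt_succ`): given the history, the natural treatment is independent of everything
that happens later, so that it may be integrated out, and averaging over the uniform variable `V_t`
turns the propensity score into the intervention propensity score (`lintegral_resumeOutcome_flip`).
After all times no intervention is left, and the counterfactual mean has become the weighted mean of
the observed outcome. The argument is carried out for nonnegative functions of the outcome, hence
gives the law of the counterfactual outcome (`lintegral_outcomeUnder_flip`), and with it
integrability.

*Pathwise differentiability.* Along a path `P_ε` the identified mean is the mean under `P_ε` of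
`R_ε Y`, where `R_ε` is the product of the ratios of `P_ε`. Its increment is the sum of
`∫ R_ε Y (dP_ε - dP)` and of the effect under `P` of the change of weights, which telescopes into
one term for each time and arm. By the sequential criterion only sequences `ε_n → 0` are needed,
and after passing to subsequences the `ε_n` may be taken summable (`IsQMDSequence`). Then `R_ε` and
all conditional probabilities converge almost surely. Limits of integrals follow because a sequence
that is bounded in `L²` and converges almost surely converges weakly, while difference quotients of
square roots of densities converge strongly (`tendsto_integral_mul_of_tendsto_ae_of_tendsto`). Two
points are delicate.

* No bound on `Y` is available, only on its variances under the laws of the path. Together with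
  convergence in total variation these bound the second moments (`exists_integral_sq_le`).
* Propensity scores may be arbitrarily small, so that a difference quotient of the ratio of an arm
  need not be bounded in `L²`. On the set where the conditional densities given the history, with or
  without the arm, stay within a factor `2` of `1` (`stableSet`), the quotient is under control
  (`lintegral_indicator_sq_mul_le`). The complement has probability `O(ε²)` by a bound on the
  Hellinger distance (`measureReal_compl_stableSet_le`), and the weights are bounded there, so that
  its contribution is `o(ε)`. The result is `tendsto_arm_derivative`.

The derivative is the inner product of the score with `gradFun`, which is almost surely equal to
`φ_m + φ_Q` (`InModel.ae_phi_eq`).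

*Efficiency.* For a bounded `S` of mean zero the laws with density `1 + ε S` stay in the model: by
Bayes' formula their propensity scores are comparable to those of `P`, so that the ratios stay
bounded (`InModel.tilt_mem_nonparametricSubmodels`). Bounded functions of mean zero are dense among
the square integrable ones, so that the tangent space contains every square integrable function of
mean zero (`mem_tangentSpace_of_forall_tilt`), the influence function in particular.
-/

namespace Flip

/-! ### Weak convergence against strong convergence in `L²` -/

section SquareIntegrable

variable {Ω : Type*} {mΩ : MeasurableSpace Ω} {μ : Measure Ω}

lemma integrable_mul_of_memLp_two {f g : Ω → ℝ} (hf : MemLp f 2 μ) (hg : MemLp g 2 μ) :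
    Integrable (fun z => f z * g z) μ := hf.integrable_mul hg

lemma abs_integral_mul_le_sqrt {f g : Ω → ℝ} (hf : MemLp f 2 μ) (hg : MemLp g 2 μ) :
    |∫ z, f z * g z ∂μ| ≤ √(∫ z, f z ^ 2 ∂μ) * √(∫ z, g z ^ 2 ∂μ) := by
  have h := integral_mul_norm_le_Lp_mul_Lq (μ := μ) (f := f) (g := g)
    Real.HolderConjugate.two_two (by simpa using hf) (by simpa using hg)
  calc |∫ z, f z * g z ∂μ| ≤ ∫ z, ‖f z‖ * ‖g z‖ ∂μ := by
        refine (abs_integral_le_integral_abs).trans (le_of_eq ?_)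
        simp [abs_mul]
    _ ≤ _ := h.trans (le_of_eq (by simp [Real.sqrt_eq_rpow]))

lemma eLpNorm_two_eq_ofReal_sqrt {f : Ω → ℝ} (hf : MemLp f 2 μ) :
    eLpNorm f 2 μ = ENNReal.ofReal (√(∫ z, f z ^ 2 ∂μ)) := by
  rw [hf.eLpNorm_eq_integral_rpow_norm (by simp) (by simp), Real.sqrt_eq_rpow]
  simp

/-- Fatou's lemma for second moments. -/
lemma memLp_two_of_tendsto_ae {w : ℕ → Ω → ℝ} {w' : Ω → ℝ} {B : ℝ}
    (hw : ∀ n, MemLp (w n) 2 μ) (hB : ∀ n, ∫ z, w n z ^ 2 ∂μ ≤ B)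
    (hlim : ∀ᵐ z ∂μ, Tendsto (fun n => w n z) atTop (𝓝 (w' z))) :
    MemLp w' 2 μ ∧ ∫ z, w' z ^ 2 ∂μ ≤ B := by
  have hB0 : 0 ≤ B := (integral_nonneg fun z => sq_nonneg (w 0 z)).trans (hB 0)
  have hle : eLpNorm w' 2 μ ≤ ENNReal.ofReal (√B) := by
    refine (Lp.eLpNorm_lim_le_liminf_eLpNorm (fun n => (hw n).1) w' hlim).trans ?_
    refine liminf_le_of_le (by isBoundedDefault) fun b hb => ?_
    obtain ⟨n, hn⟩ := hb.exists
    refine hn.trans ?_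
    rw [eLpNorm_two_eq_ofReal_sqrt (hw n)]
    exact ENNReal.ofReal_le_ofReal (Real.sqrt_le_sqrt (hB n))
  have hmem : MemLp w' 2 μ :=
    ⟨aestronglyMeasurable_of_tendsto_ae atTop (fun n => (hw n).1) hlim,
      hle.trans_lt ENNReal.ofReal_lt_top⟩
  refine ⟨hmem, ?_⟩
  rw [eLpNorm_two_eq_ofReal_sqrt hmem, ENNReal.ofReal_le_ofReal_iff (Real.sqrt_nonneg _)] at hle
  exact (Real.sqrt_le_sqrt_iff hB0).1 hle

lemma integral_sub_sq_le {f g : Ω → ℝ} (hf : MemLp f 2 μ) (hg : MemLp g 2 μ) :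
    ∫ z, (f z - g z) ^ 2 ∂μ ≤ 2 * ∫ z, f z ^ 2 ∂μ + 2 * ∫ z, g z ^ 2 ∂μ := by
  rw [← integral_const_mul, ← integral_const_mul, ← integral_add (hf.integrable_sq.const_mul 2)
    (hg.integrable_sq.const_mul 2)]
  refine integral_mono (hf.sub hg).integrable_sq
    ((hf.integrable_sq.const_mul 2).add (hg.integrable_sq.const_mul 2)) fun z => ?_
  nlinarith [sq_nonneg (f z + g z)]

lemma two_mul_integral_mul_le {f g : Ω → ℝ} (hf : MemLp f 2 μ) (hg : MemLp g 2 μ) :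
    2 * ∫ z, f z * g z ∂μ ≤ ∫ z, f z ^ 2 ∂μ + ∫ z, g z ^ 2 ∂μ := by
  rw [← integral_const_mul, ← integral_add hf.integrable_sq hg.integrable_sq]
  refine integral_mono ((integrable_mul_of_memLp_two hf hg).const_mul 2)
    (hf.integrable_sq.add hg.integrable_sq) fun z => ?_
  simp only
  nlinarith [sq_nonneg (f z - g z)]

/-- A sequence that is bounded in `L²` and converges almost everywhere converges weakly in `L²`. -/
lemma tendsto_integral_mul_of_tendsto_ae {w : ℕ → Ω → ℝ} {w' v : Ω → ℝ} {B : ℝ}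
    (hw : ∀ n, MemLp (w n) 2 μ) (hB : ∀ n, ∫ z, w n z ^ 2 ∂μ ≤ B)
    (hlim : ∀ᵐ z ∂μ, Tendsto (fun n => w n z) atTop (𝓝 (w' z))) (hv : MemLp v 2 μ) :
    Tendsto (fun n => ∫ z, w n z * v z ∂μ) atTop (𝓝 (∫ z, w' z * v z ∂μ)) := by
  obtain ⟨hw', hB'⟩ := memLp_two_of_tendsto_ae hw hB hlim
  have hB0 : 0 ≤ B := (integral_nonneg fun z => sq_nonneg (w' z)).trans hB'
  have hx : ∀ n, MemLp (fun z => w n z - w' z) 2 μ := fun n => (hw n).sub hw'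
  have hxB : ∀ n, ∫ z, (w n z - w' z) ^ 2 ∂μ ≤ 4 * B := fun n => by
    linarith [integral_sub_sq_le (hw n) hw', hB n]
  -- the part of the product where `|w n - w'|` is at most a multiple of `|v|` is dominated
  have hdom : ∀ K : ℝ, 0 < K → Tendsto
      (fun n => ∫ z, min |w n z - w' z| (K * |v z|) * |v z| ∂μ) atTop (𝓝 0) := fun K hK => by
    have := tendsto_integral_of_dominated_convergence (μ := μ)
      (F := fun n z => min |w n z - w' z| (K * |v z|) * |v z|) (f := fun _ => 0)
      (fun z => K * v z ^ 2) (fun n => ?_) (hv.integrable_sq.const_mul K)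
      (fun n => Eventually.of_forall fun z => ?_) ?_
    · simpa using this
    · have h1 : AEMeasurable (fun z => |w n z - w' z|) μ := (hx n).1.aemeasurable.abs
      have h2 : AEMeasurable (fun z => |v z|) μ := hv.1.aemeasurable.abs
      exact ((h1.min (h2.const_mul K)).mul h2).aestronglyMeasurable
    · have h0 : 0 ≤ min |w n z - w' z| (K * |v z|) := by positivity
      rw [Real.norm_eq_abs, abs_mul, abs_abs, abs_of_nonneg h0]
      calc _ ≤ K * |v z| * |v z| := by gcongr; exact min_le_right _ _
        _ = K * v z ^ 2 := by rw [mul_assoc, abs_mul_abs_self]; ring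
    · filter_upwards [hlim] with z hz
      have h1 : Tendsto (fun n => |w n z - w' z|) atTop (𝓝 0) := by
        simpa using (hz.sub_const (w' z)).abs
      have h2 := (h1.min (tendsto_const_nhds (x := K * |v z|))).mul_const |v z|
      have h3 : min 0 (K * |v z|) = 0 := min_eq_left (by positivity)
      simpa [h3] using h2
  have hbound : ∀ K : ℝ, 0 < K → ∀ n, |∫ z, w n z * v z ∂μ - ∫ z, w' z * v z ∂μ| ≤
      ∫ z, min |w n z - w' z| (K * |v z|) * |v z| ∂μ + 4 * B / K := fun K hK n => by
    have hint : Integrable (fun z => min |w n z - w' z| (K * |v z|) * |v z|) μ := by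
      refine (hv.integrable_sq.const_mul K).mono' ?_ (Eventually.of_forall fun z => ?_)
      · have h1 : AEMeasurable (fun z => |w n z - w' z|) μ := (hx n).1.aemeasurable.abs
        have h2 : AEMeasurable (fun z => |v z|) μ := hv.1.aemeasurable.abs
        exact ((h1.min (h2.const_mul K)).mul h2).aestronglyMeasurable
      · have h0 : 0 ≤ min |w n z - w' z| (K * |v z|) := by positivity
        rw [Real.norm_eq_abs, abs_mul, abs_abs, abs_of_nonneg h0]
        calc _ ≤ K * |v z| * |v z| := by gcongr; exact min_le_right _ _
          _ = K * v z ^ 2 := by rw [mul_assoc, abs_mul_abs_self]; ring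
    rw [← integral_sub (integrable_mul_of_memLp_two (hw n) hv)
      (integrable_mul_of_memLp_two hw' hv)]
    have h4 : ∫ z, |w n z * v z - w' z * v z| ∂μ ≤
        ∫ z, (min |w n z - w' z| (K * |v z|) * |v z| + (w n z - w' z) ^ 2 / K) ∂μ := by
      refine integral_mono ((integrable_mul_of_memLp_two (hw n) hv).sub
          (integrable_mul_of_memLp_two hw' hv)).abs
        (hint.add ((hx n).integrable_sq.div_const K)) fun z => ?_
      have h5 : |w n z * v z - w' z * v z| = |w n z - w' z| * |v z| := by
        rw [← abs_mul, sub_mul]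
      simp only [h5]
      rcases le_total |w n z - w' z| (K * |v z|) with h | h
      · rw [min_eq_left h]
        have : 0 ≤ (w n z - w' z) ^ 2 / K := by positivity
        linarith
      · have h6 : |w n z - w' z| * |v z| ≤ (w n z - w' z) ^ 2 / K := by
          rw [le_div_iff₀ hK, ← sq_abs (w n z - w' z)]
          nlinarith [abs_nonneg (w n z - w' z)]
        have h7 : 0 ≤ min |w n z - w' z| (K * |v z|) * |v z| := by positivity
        linarith
    rw [integral_add hint ((hx n).integrable_sq.div_const K), integral_div] at h4
    have h8 : (∫ z, (w n z - w' z) ^ 2 ∂μ) / K ≤ 4 * B / K := by gcongr; exact hxB n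
    exact (abs_integral_le_integral_abs).trans (h4.trans (by linarith))
  rw [Metric.tendsto_atTop]
  intro η hη
  set K : ℝ := (8 * B + 1) / η with hKdef
  have hK : 0 < K := by positivity
  obtain ⟨N, hN⟩ := (Metric.tendsto_atTop.1 (hdom K hK)) (η / 2) (by positivity)
  refine ⟨N, fun n hn => ?_⟩
  have h1 := hbound K hK n
  have h2 := hN n hn
  rw [Real.dist_eq, sub_zero] at h2
  have h3 := (le_abs_self _).trans_lt h2
  have h4 : 4 * B / K < η / 2 := by
    rw [hKdef, div_div_eq_mul_div, div_lt_iff₀ (by positivity)]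
    nlinarith
  rw [Real.dist_eq]
  linarith

/-- The product of a weakly convergent and a strongly convergent sequence. -/
lemma tendsto_integral_mul_of_tendsto_ae_of_tendsto {w v : ℕ → Ω → ℝ} {w' v' : Ω → ℝ} {B : ℝ}
    (hw : ∀ n, MemLp (w n) 2 μ) (hB : ∀ n, ∫ z, w n z ^ 2 ∂μ ≤ B)
    (hlim : ∀ᵐ z ∂μ, Tendsto (fun n => w n z) atTop (𝓝 (w' z)))
    (hv : ∀ n, MemLp (v n) 2 μ) (hv' : MemLp v' 2 μ)
    (hvlim : Tendsto (fun n => ∫ z, (v n z - v' z) ^ 2 ∂μ) atTop (𝓝 0)) :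
    Tendsto (fun n => ∫ z, w n z * v n z ∂μ) atTop (𝓝 (∫ z, w' z * v' z ∂μ)) := by
  have h1 := tendsto_integral_mul_of_tendsto_ae hw hB hlim hv'
  have h2 : Tendsto (fun n => ∫ z, w n z * (v n z - v' z) ∂μ) atTop (𝓝 0) := by
    have h3 : Tendsto (fun n => √B * √(∫ z, (v n z - v' z) ^ 2 ∂μ)) atTop (𝓝 0) := by
      simpa using (hvlim.sqrt).const_mul (√B)
    refine squeeze_zero_norm (fun n => ?_) h3
    refine (abs_integral_mul_le_sqrt (hw n) ((hv n).sub hv')).trans ?_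
    simp only [Pi.sub_apply]
    gcongr
    exact hB n
  refine (add_zero (∫ z, w' z * v' z ∂μ) ▸ h1.add h2).congr fun n => ?_
  rw [← integral_add (integrable_mul_of_memLp_two (hw n) hv')
    (integrable_mul_of_memLp_two (g := fun z => v n z - v' z) (hw n) ((hv n).sub hv'))]
  exact integral_congr_ae (Eventually.of_forall fun z => by simp only; ring)

/-- A family of nonnegative functions whose integrals are summable tends to zero almost
everywhere. -/
lemma tendsto_zero_ae_of_summable_integral {f : ℕ → Ω → ℝ} (hf0 : ∀ n z, 0 ≤ f n z)
    (hf : ∀ n, Integrable (f n) μ) (hs : Summable fun n => ∫ z, f n z ∂μ) :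
    ∀ᵐ z ∂μ, Tendsto (fun n => f n z) atTop (𝓝 0) := by
  have h1 : ∫⁻ z, ∑' n, ENNReal.ofReal (f n z) ∂μ ≠ ∞ := by
    rw [lintegral_tsum fun n => (hf n).1.aemeasurable.ennreal_ofReal]
    have : ∀ n, ∫⁻ z, ENNReal.ofReal (f n z) ∂μ = ENNReal.ofReal (∫ z, f n z ∂μ) := fun n =>
      (ofReal_integral_eq_lintegral_ofReal (hf n) (Eventually.of_forall (hf0 n))).symm
    simp_rw [this]
    rw [← ENNReal.ofReal_tsum_of_nonneg (fun n => integral_nonneg (hf0 n)) hs]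
    exact ENNReal.ofReal_ne_top
  have h2 := ae_lt_top' (AEMeasurable.tsum fun n =>
    (hf n).1.aemeasurable.ennreal_ofReal) h1
  filter_upwards [h2] with z hz
  have h3 := ENNReal.tendsto_atTop_zero_of_tsum_ne_top hz.ne
  have h4 := (ENNReal.tendsto_toReal ENNReal.zero_ne_top).comp h3
  simpa [Function.comp_def, ENNReal.toReal_ofReal (hf0 _ z)] using h4

end SquareIntegrable

/-! ### Conditional expectations and the regression on one arm -/

section Conditional

variable {Ω : Type*} {m m0 : MeasurableSpace Ω} {μ : Measure Ω}

/-- Factors that are measurable with respect to the conditioning σ-algebra pull out of the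
integral of a nonnegative function, with no integrability requirement on the factor. -/
lemma lintegral_mul_ofReal_condExp [IsFiniteMeasure μ] (hm : m ≤ m0) {f : Ω → ℝ}
    (hf : Integrable f μ)
    (hf0 : 0 ≤ᵐ[μ] f) {g : Ω → ℝ≥0∞} (hg : Measurable[m] g) :
    ∫⁻ z, g z * ENNReal.ofReal (μ[f|m] z) ∂μ = ∫⁻ z, g z * ENNReal.ofReal (f z) ∂μ := by
  have hg' : Measurable g := hg.mono hm le_rfl
  have h1 : ∀ f' : Ω → ℝ, Integrable f' μ → ∫⁻ z, g z * ENNReal.ofReal (f' z) ∂μ =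
      ∫⁻ z, g z ∂((μ.withDensity fun z => ENNReal.ofReal (f' z)).trim hm) := fun f' hf' => by
    rw [lintegral_trim hm hg, lintegral_withDensity_eq_lintegral_mul₀
      hf'.1.aemeasurable.ennreal_ofReal hg'.aemeasurable]
    simp [mul_comm]
  rw [h1 _ integrable_condExp, h1 _ hf]
  congr 1
  refine @Measure.ext _ m _ _ fun s hs => ?_
  rw [trim_measurableSet_eq hm hs, trim_measurableSet_eq hm hs, withDensity_apply _ (hm s hs),
    withDensity_apply _ (hm s hs),
    ← ofReal_integral_eq_lintegral_ofReal integrable_condExp.integrableOn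
      (ae_restrict_of_ae (condExp_nonneg hf0)),
    ← ofReal_integral_eq_lintegral_ofReal hf.integrableOn (ae_restrict_of_ae hf0),
    setIntegral_condExp hm hf hs]

lemma integrable_mul_condExp {f g : Ω → ℝ} (hg : AEStronglyMeasurable[m] g μ)
    (hf : Integrable f μ) (hgf : Integrable (fun z => g z * f z) μ) :
    Integrable (fun z => g z * μ[f|m] z) μ :=
  integrable_condExp.congr (condExp_mul_of_aestronglyMeasurable_left hg hgf hf)

lemma integral_mul_condExp [IsFiniteMeasure μ] (hm : m ≤ m0) {f g : Ω → ℝ}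
    (hg : AEStronglyMeasurable[m] g μ)
    (hf : Integrable f μ) (hgf : Integrable (fun z => g z * f z) μ) :
    ∫ z, g z * μ[f|m] z ∂μ = ∫ z, g z * f z ∂μ := by
  rw [← integral_condExp hm (f := fun z => g z * f z)]
  exact integral_congr_ae (condExp_mul_of_aestronglyMeasurable_left hg hgf hf).symm

lemma ae_eq_zero_of_condExp_eq_zero [IsFiniteMeasure μ] (hm : m ≤ m0) {f : Ω → ℝ}
    (hf : Integrable f μ)
    (hf0 : 0 ≤ᵐ[μ] f) : ∀ᵐ z ∂μ, μ[f|m] z = 0 → f z = 0 := by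
  have hN : MeasurableSet[m] {z | μ[f|m] z = 0} :=
    stronglyMeasurable_condExp.measurable (measurableSet_singleton 0)
  have h := lintegral_mul_ofReal_condExp hm hf hf0
    (g := {z | μ[f|m] z = 0}.indicator fun _ => 1) (measurable_const.indicator hN)
  have h0 : ∫⁻ z, {z | μ[f|m] z = 0}.indicator (fun _ => 1) z *
      ENNReal.ofReal (μ[f|m] z) ∂μ = 0 := by
    rw [lintegral_eq_zero_of_ae_eq_zero]
    refine Eventually.of_forall fun z => ?_
    by_cases hz : z ∈ {z | μ[f|m] z = 0}
    · have : μ[f|m] z = 0 := hz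
      simp [this]
    · simp [Set.indicator_of_notMem hz]
  rw [h0] at h
  have h2 := (lintegral_eq_zero_iff' (((measurable_const.indicator (hm _ hN))).aemeasurable.mul
    hf.1.aemeasurable.ennreal_ofReal)).1 h.symm
  filter_upwards [h2, hf0] with z hz hz0 hzN
  have : ENNReal.ofReal (f z) = 0 := by
    have hmem : z ∈ {z | μ[f|m] z = 0} := hzN
    simpa [Set.indicator_of_mem hmem] using hz
  exact le_antisymm (ENNReal.ofReal_eq_zero.1 this) hz0

/-- If the densities `p n` tend to `1` fast enough in `L¹`, then conditional expectations of
bounded functions under these densities tend to the unperturbed ones almost everywhere. -/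
lemma tendsto_condExp_mul_of_summable [IsProbabilityMeasure μ] {p : ℕ → Ω → ℝ}
    (hp : ∀ n, Integrable (p n) μ)
    (hs : Summable fun n => ∫ z, |p n z - 1| ∂μ) {J : Ω → ℝ} (hJ : Measurable J)
    (hJ1 : ∀ z, |J z| ≤ 1) :
    ∀ᵐ z ∂μ, Tendsto (fun n => μ[fun z => J z * p n z|m] z) atTop (𝓝 (μ[J|m] z)) := by
  have hJi : Integrable J μ := Integrable.of_bound hJ.aestronglyMeasurable 1
    (Eventually.of_forall hJ1)
  have hJp : ∀ n, Integrable (fun z => J z * p n z) μ := fun n =>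
    (hp n).bdd_mul hJ.aestronglyMeasurable (Eventually.of_forall hJ1)
  have habs : ∀ n, Integrable (fun z => |p n z - 1|) μ := fun n =>
    ((hp n).sub (integrable_const 1)).abs
  have h1 : ∀ᵐ z ∂μ, Tendsto (fun n => |μ[fun z => J z * p n z - J z|m] z|) atTop (𝓝 0) := by
    refine tendsto_zero_ae_of_summable_integral (fun n z => abs_nonneg _)
      (fun n => integrable_condExp.abs) (Summable.of_nonneg_of_le
        (fun n => integral_nonneg fun z => abs_nonneg _) (fun n => ?_) hs)
    refine (integral_abs_condExp_le _).trans
      (integral_mono ((hJp n).sub hJi).abs (habs n) fun z => ?_)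
    have : J z * p n z - J z = J z * (p n z - 1) := by ring
    simp only [this, abs_mul]
    exact mul_le_of_le_one_left (abs_nonneg _) (hJ1 z)
  have h2 : ∀ᵐ z ∂μ, ∀ n, μ[fun z => J z * p n z - J z|m] z =
      μ[fun z => J z * p n z|m] z - μ[J|m] z := by
    rw [ae_all_iff]
    exact fun n => condExp_sub (hJp n) hJi m
  filter_upwards [h1, h2] with z hz1 hz2
  have h3 := (tendsto_zero_iff_abs_tendsto_zero _).2 hz1
  have h4 := h3.add_const (μ[J|m] z)
  rw [zero_add] at h4
  exact h4.congr fun n => by simp [hz2 n]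

end Conditional

section Arm

variable {Ω : Type*}

/-- The indicator of the event that the arm is `b`. -/
def armInd (A : Ω → Bool) (b : Bool) (z : Ω) : ℝ := if A z = b then 1 else 0

lemma armInd_nonneg (A : Ω → Bool) (b : Bool) (z : Ω) : 0 ≤ armInd A b z := by
  unfold armInd; split_ifs <;> norm_num

lemma armInd_le_one (A : Ω → Bool) (b : Bool) (z : Ω) : armInd A b z ≤ 1 := by
  unfold armInd; split_ifs <;> norm_num

lemma abs_armInd_le_one (A : Ω → Bool) (b : Bool) (z : Ω) : |armInd A b z| ≤ 1 := by
  rw [abs_of_nonneg (armInd_nonneg A b z)]; exact armInd_le_one A b z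

lemma armInd_mul_self (A : Ω → Bool) (b : Bool) (z : Ω) :
    armInd A b z * armInd A b z = armInd A b z := by
  unfold armInd; split_ifs <;> norm_num

lemma sum_armInd_mul (A : Ω → Bool) (g : Bool → ℝ) (z : Ω) :
    ∑ b : Bool, armInd A b z * g b = g (A z) := by
  cases h : A z <;> simp [armInd, h]

lemma measurable_armInd [MeasurableSpace Ω] {A : Ω → Bool} (hA : Measurable A) (b : Bool) :
    Measurable (armInd A b) :=
  Measurable.ite (hA (measurableSet_singleton b)) measurable_const measurable_const

/-- The conditional probability of the arm `b`. -/
noncomputable def armProp (m : MeasurableSpace Ω) {m0 : MeasurableSpace Ω} (μ : Measure Ω)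
    (A : Ω → Bool) (b : Bool) :
    Ω → ℝ := μ[armInd A b|m]

/-- The regression on the arm `b`, with value zero where that arm has probability zero. -/
noncomputable def armMean (m : MeasurableSpace Ω) {m0 : MeasurableSpace Ω} (μ : Measure Ω)
    (A : Ω → Bool) (b : Bool)
    (W : Ω → ℝ) : Ω → ℝ := fun z => (μ[fun z => armInd A b z * W z|m]) z / armProp m μ A b z

variable {m m0 : MeasurableSpace Ω} {μ : Measure Ω} {A : Ω → Bool}

lemma stronglyMeasurable_armProp (b : Bool) : StronglyMeasurable[m] (armProp m μ A b) :=
  stronglyMeasurable_condExp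

lemma stronglyMeasurable_armMean (b : Bool) (W : Ω → ℝ) :
    StronglyMeasurable[m] (armMean m μ A b W) :=
  StronglyMeasurable.div stronglyMeasurable_condExp stronglyMeasurable_condExp

lemma armMean_eq_zero {b : Bool} {W : Ω → ℝ} {z : Ω} (h : armProp m μ A b z = 0) :
    armMean m μ A b W z = 0 := by simp [armMean, h]

lemma integrable_armInd_mul (hA : Measurable A) (b : Bool) {W : Ω → ℝ} (hW : Integrable W μ) :
    Integrable (fun z => armInd A b z * W z) μ :=
  hW.bdd_mul (measurable_armInd hA b).aestronglyMeasurable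
    (Eventually.of_forall (abs_armInd_le_one A b))

lemma ae_armProp_nonneg (b : Bool) : ∀ᵐ z ∂μ, 0 ≤ armProp m μ A b z :=
  condExp_nonneg (Eventually.of_forall (armInd_nonneg A b))

variable [IsProbabilityMeasure μ]

lemma integrable_armInd (hA : Measurable A) (b : Bool) : Integrable (armInd A b) μ :=
  Integrable.of_bound (measurable_armInd hA b).aestronglyMeasurable 1
    (Eventually.of_forall (abs_armInd_le_one A b))

lemma ae_armProp_not (hm : m ≤ m0) (hA : Measurable A) (b : Bool) :
    ∀ᵐ z ∂μ, armProp m μ A (!b) z = 1 - armProp m μ A b z := by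
  have h1 : armInd A (!b) = (fun _ => (1 : ℝ)) - armInd A b := by
    funext z
    cases h : A z <;> cases b <;> simp [armInd, h]
  have h2 := condExp_sub (μ := μ) (integrable_const (1 : ℝ)) (integrable_armInd hA b) m
  rw [← h1, condExp_const hm] at h2
  exact h2

lemma ae_armProp_le_one (hm : m ≤ m0) (hA : Measurable A) (b : Bool) :
    ∀ᵐ z ∂μ, armProp m μ A b z ≤ 1 := by
  filter_upwards [ae_armProp_not hm hA b, ae_armProp_nonneg (m := m) (μ := μ) (A := A) (!b)]
    with z h1 h2
  linarith

lemma ae_armProp_pos (hm : m ≤ m0) (hA : Measurable A) (b : Bool) :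
    ∀ᵐ z ∂μ, A z = b → 0 < armProp m μ A b z := by
  filter_upwards [ae_eq_zero_of_condExp_eq_zero hm (integrable_armInd (μ := μ) hA b)
    (Eventually.of_forall (armInd_nonneg A b)), ae_armProp_nonneg (m := m) (μ := μ) (A := A) b]
    with z h1 h2 hz
  refine lt_of_le_of_ne h2 fun h => ?_
  have := h1 h.symm
  simp [armInd, hz] at this

lemma ae_armProp_mul_armMean (hm : m ≤ m0) (hA : Measurable A) (b : Bool) {W : Ω → ℝ} :
    ∀ᵐ z ∂μ, armProp m μ A b z * armMean m μ A b W z = (μ[fun z => armInd A b z * W z|m]) z := by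
  have hN : MeasurableSet[m] {z | armProp m μ A b z = 0} :=
    (stronglyMeasurable_armProp b).measurable (measurableSet_singleton 0)
  have h1 : (fun z => armInd A b z * W z) =ᵐ[μ.restrict {z | armProp m μ A b z = 0}] 0 := by
    rw [EventuallyEq, ae_restrict_iff' (hm _ hN)]
    filter_upwards [ae_armProp_pos (μ := μ) hm hA b] with z hz hz0
    have hz0 : armProp m μ A b z = 0 := hz0
    have : A z ≠ b := fun h => (hz h).ne' hz0
    simp [armInd, this]
  have h2 := condExp_ae_eq_restrict_zero hN h1
  rw [EventuallyEq, ae_restrict_iff' (hm _ hN)] at h2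
  filter_upwards [h2] with z hz
  by_cases h : armProp m μ A b z = 0
  · rw [h, zero_mul]; exact (hz h).symm
  · rw [armMean, mul_div_cancel₀ _ h]

/-- On the arm `b`, an integrable variable may be replaced by its regression under integrals
against functions of the conditioning variables. -/
lemma integral_mul_armInd_mul (hm : m ≤ m0) (hA : Measurable A) (b : Bool) {W g : Ω → ℝ}
    (hW : Integrable W μ) (hg : AEStronglyMeasurable[m] g μ)
    (hgW : Integrable (fun z => g z * (armInd A b z * W z)) μ) :
    Integrable (fun z => g z * (armProp m μ A b z * armMean m μ A b W z)) μ ∧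
      ∫ z, g z * (armProp m μ A b z * armMean m μ A b W z) ∂μ =
        ∫ z, g z * (armInd A b z * W z) ∂μ := by
  have hJW := integrable_armInd_mul hA b hW
  have h1 : (fun z => g z * (μ[fun z => armInd A b z * W z|m]) z) =ᵐ[μ]
      fun z => g z * (armProp m μ A b z * armMean m μ A b W z) := by
    filter_upwards [ae_armProp_mul_armMean (μ := μ) hm hA b (W := W)] with z hz
    rw [hz]
  exact ⟨(integrable_mul_condExp hg hJW hgW).congr h1,
    (integral_congr_ae h1).symm.trans (integral_mul_condExp hm hg hJW hgW)⟩

/-- The regression contracts second moments. The truncations of the regression are bounded, so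
that they may be used as test functions. -/
lemma memLp_armInd_mul_armMean (hm : m ≤ m0) (hA : Measurable A) (b : Bool) {W : Ω → ℝ}
    (hW : MemLp W 2 μ) : MemLp (fun z => armInd A b z * armMean m μ A b W z) 2 μ := by
  set M := armMean m μ A b W with hM
  have hMm : Measurable[m] M := (stronglyMeasurable_armMean b W).measurable
  let N : ℕ → Ω → ℝ := fun k z => if |M z| ≤ k then M z else 0
  have hNm : ∀ k, Measurable[m] (N k) := fun k =>
    Measurable.ite (measurableSet_le (measurable_abs.comp hMm) measurable_const) hMm
      measurable_const
  have hNb : ∀ k z, |N k z| ≤ k := fun k z => by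
    simp only [N]; split_ifs with h
    · exact h
    · simp
  have hNM : ∀ k z, N k z * M z = N k z * N k z := fun k z => by
    simp only [N]; split_ifs <;> simp
  have hN' : ∀ k, AEStronglyMeasurable (N k) μ := fun k =>
    ((hNm k).mono hm le_rfl).aestronglyMeasurable
  have hJ := measurable_armInd hA b
  have hw : ∀ k, MemLp (fun z => armInd A b z * N k z) 2 μ := fun k =>
    MemLp.of_bound (hJ.aestronglyMeasurable.mul (hN' k)) k (Eventually.of_forall fun z => by
      rw [Real.norm_eq_abs, abs_mul]
      exact (mul_le_of_le_one_left (abs_nonneg _) (abs_armInd_le_one A b z)).trans (hNb k z))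
  have hWi : Integrable W μ := hW.integrable (by norm_num)
  refine (memLp_two_of_tendsto_ae (B := ∫ z, W z ^ 2 ∂μ) hw (fun k => ?_)
    (Eventually.of_forall fun z => ?_)).1
  · have h1 := integral_mul_armInd_mul (g := N k) hm hA b hWi
      (hNm k).stronglyMeasurable.aestronglyMeasurable
      ((integrable_armInd_mul hA b hWi).bdd_mul (hN' k) (Eventually.of_forall (hNb k)))
    have hNN : ∀ z, |N k z * N k z| ≤ k * k := fun z => by
      rw [abs_mul]; gcongr <;> exact hNb k z
    have h2 := integral_mul_condExp hm (g := fun z => N k z * N k z)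
      ((hNm k).mul (hNm k)).stronglyMeasurable.aestronglyMeasurable
      (integrable_armInd (μ := μ) hA b)
      ((integrable_armInd hA b).bdd_mul ((hN' k).mul (hN' k)) (Eventually.of_forall hNN))
    have h3 : ∫ z, N k z * (armProp m μ A b z * M z) ∂μ = ∫ z, N k z * N k z * armInd A b z ∂μ := by
      rw [← h2]
      refine integral_congr_ae (Eventually.of_forall fun z => ?_)
      change N k z * (armProp m μ A b z * M z) = N k z * N k z * armProp m μ A b z
      rw [← hNM]; ring
    have h4 : ∫ z, (armInd A b z * N k z) ^ 2 ∂μ = ∫ z, (armInd A b z * N k z) * W z ∂μ := by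
      calc ∫ z, (armInd A b z * N k z) ^ 2 ∂μ = ∫ z, N k z * N k z * armInd A b z ∂μ :=
            integral_congr_ae (Eventually.of_forall fun z => by
              simp only
              rw [mul_pow, sq, armInd_mul_self]; ring)
        _ = ∫ z, N k z * (armInd A b z * W z) ∂μ := by rw [← h3, h1.2]
        _ = _ := integral_congr_ae (Eventually.of_forall fun z => by simp only; ring)
    have h5 := two_mul_integral_mul_le (μ := μ) (hw k) hW
    linarith
  · refine tendsto_const_nhds.congr' ?_
    obtain ⟨k0, hk0⟩ := exists_nat_ge |M z|
    filter_upwards [eventually_ge_atTop k0] with k hk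
    have : |M z| ≤ k := hk0.trans (by exact_mod_cast hk)
    simp [N, this]

end Arm

/-! ### Perturbing the weight of one arm -/

section Perturbation

variable {Ω : Type*} {m m0 : MeasurableSpace Ω} {μ : Measure Ω}

lemma memLp_two_of_lintegral_sq_le {w : Ω → ℝ} (hw : AEStronglyMeasurable w μ) {B : ℝ}
    (hB : 0 ≤ B) (h : ∫⁻ z, ENNReal.ofReal (w z ^ 2) ∂μ ≤ ENNReal.ofReal B) :
    MemLp w 2 μ ∧ ∫ z, w z ^ 2 ∂μ ≤ B := by
  have hi : Integrable (fun z => w z ^ 2) μ := by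
    refine ⟨hw.pow 2, ?_⟩
    rw [hasFiniteIntegral_iff_ofReal (Eventually.of_forall fun z => sq_nonneg _)]
    exact h.trans_lt ENNReal.ofReal_lt_top
  refine ⟨(memLp_two_iff_integrable_sq hw).2 hi, ?_⟩
  rw [← ofReal_integral_eq_lintegral_ofReal hi (Eventually.of_forall fun z => sq_nonneg _),
    ENNReal.ofReal_le_ofReal_iff hB] at h
  exact h

lemma memLp_sqrt {p : Ω → ℝ} (hp0 : ∀ z, 0 ≤ p z) (hp : Integrable p μ) :
    MemLp (fun z => √(p z)) 2 μ := by
  rw [memLp_two_iff_integrable_sq (hp.1.aemeasurable.sqrt).aestronglyMeasurable]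
  simpa [Real.sq_sqrt (hp0 _)] using hp

variable [IsProbabilityMeasure μ]

lemma memLp_sqrt_sub_one {p : Ω → ℝ} (hp0 : ∀ z, 0 ≤ p z) (hp : Integrable p μ) :
    MemLp (fun z => √(p z) - 1) 2 μ := (memLp_sqrt hp0 hp).sub (memLp_const 1)

/-- An event whose probability is at least halved or at least doubled by the density `p` has
probability of the order of the squared Hellinger distance. -/
lemma measureReal_le_hellinger {p : Ω → ℝ} (hp0 : ∀ z, 0 ≤ p z) (hp : Integrable p μ) {B : Set Ω}
    (h : ∫ z in B, p z ∂μ ≤ μ.real B / 2 ∨ 2 * μ.real B ≤ ∫ z in B, p z ∂μ) :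
    μ.real B ≤ 12 * ∫ z, (√(p z) - 1) ^ 2 ∂μ := by
  have hu := (memLp_sqrt_sub_one hp0 hp).integrable_sq
  have h1 : ∫ z in B, (√(p z) - 1) ^ 2 ∂μ ≤ ∫ z, (√(p z) - 1) ^ 2 ∂μ :=
    setIntegral_le_integral hu (Eventually.of_forall fun z => sq_nonneg _)
  have hc : ∀ c d : ℝ, (∀ z, c * p z + d ≤ (√(p z) - 1) ^ 2) →
      c * ∫ z in B, p z ∂μ + d * μ.real B ≤ ∫ z in B, (√(p z) - 1) ^ 2 ∂μ := fun c d hcd => by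
    have h2 : ∫ z in B, (c * p z + d) ∂μ = c * ∫ z in B, p z ∂μ + d * μ.real B := by
      rw [integral_add (hp.integrableOn.const_mul c) (integrable_const d), integral_const_mul]
      simp [mul_comm]
    rw [← h2]
    exact integral_mono ((hp.integrableOn.const_mul c).add (integrable_const d)) hu.integrableOn hcd
  have hs := fun z => Real.sq_sqrt (hp0 z)
  rcases h with h | h
  · have := hc (-1 / 3) (1 / 4) fun z => by nlinarith [hs z, sq_nonneg (4 * √(p z) - 3)]
    linarith
  · have := hc (1 / 4) (-1 / 3) fun z => by nlinarith [hs z, sq_nonneg (3 * √(p z) - 4)]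
    linarith [measureReal_nonneg (μ := μ) (s := B)]

variable {A : Ω → Bool}

/-- On the set where conditioning on the history and on the arm changes the density by at most
the factor two, a function of the history that is square integrable on the arm `b` keeps a
bounded second moment under the perturbed law. -/
theorem lintegral_indicator_sq_mul_le (hm : m ≤ m0) (hA : Measurable A) (b : Bool) {M : Ω → ℝ}
    (hM : Measurable[m] M) {p : Ω → ℝ} (hp0 : ∀ z, 0 ≤ p z) (hp : Integrable p μ) {G : Set Ω}
    (hG : MeasurableSet[m] G) (hq : ∀ z ∈ G, μ[fun z => armInd A b z * p z|m] z ≤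
      2 * armProp m μ A b z) (hh : ∀ z ∈ G, μ[p|m] z ≤ 2) :
    ∫⁻ z, G.indicator (fun z => ENNReal.ofReal (M z ^ 2)) z *
        ENNReal.ofReal ((armInd A b z + armProp m μ A b z) * (p z + 1)) ∂μ ≤
      6 * ∫⁻ z, ENNReal.ofReal ((armInd A b z * M z) ^ 2) ∂μ := by
  set g : Ω → ℝ≥0∞ := G.indicator fun z => ENNReal.ofReal (M z ^ 2) with hgdef
  have hg : Measurable[m] g := Measurable.indicator (hM.pow_const 2).ennreal_ofReal hG
  have hg' : Measurable g := hg.mono hm le_rfl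
  have hJm := measurable_armInd hA b
  have hpm : Measurable[m] (armProp m μ A b) := (stronglyMeasurable_armProp b).measurable
  set D := ∫⁻ z, ENNReal.ofReal ((armInd A b z * M z) ^ 2) ∂μ with hD
  have k1 : AEMeasurable (fun z => g z * ENNReal.ofReal (armInd A b z * p z)) μ :=
    hg'.aemeasurable.mul (integrable_armInd_mul hA b hp).1.aemeasurable.ennreal_ofReal
  have k2 : Measurable fun z => g z * ENNReal.ofReal (armInd A b z) := hg'.mul hJm.ennreal_ofReal
  have k3' : Measurable[m] fun z => g z * ENNReal.ofReal (armProp m μ A b z) :=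
    hg.mul hpm.ennreal_ofReal
  have k3 : Measurable fun z => g z * ENNReal.ofReal (armProp m μ A b z) := k3'.mono hm le_rfl
  have k4 : AEMeasurable
      (fun z => g z * ENNReal.ofReal (armProp m μ A b z) * ENNReal.ofReal (p z)) μ :=
    k3.aemeasurable.mul hp.1.aemeasurable.ennreal_ofReal
  have hgM : ∀ z, g z ≤ ENNReal.ofReal (M z ^ 2) := fun z => Set.indicator_le_self _ _ z
  have t2 : ∫⁻ z, g z * ENNReal.ofReal (armInd A b z) ∂μ ≤ D := by
    refine lintegral_mono fun z => ?_
    refine (mul_le_mul_left (hgM z) _).trans (le_of_eq ?_)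
    rw [← ENNReal.ofReal_mul (sq_nonneg _), mul_pow, sq (armInd A b z), armInd_mul_self, mul_comm]
  have t4 : ∫⁻ z, g z * ENNReal.ofReal (armProp m μ A b z) ∂μ ≤ D :=
    (lintegral_mul_ofReal_condExp hm (integrable_armInd hA b)
      (Eventually.of_forall (armInd_nonneg A b)) hg).trans_le t2
  have t1 : ∫⁻ z, g z * ENNReal.ofReal (armInd A b z * p z) ∂μ ≤ 2 * D := by
    rw [← lintegral_mul_ofReal_condExp hm (integrable_armInd_mul hA b hp)
      (Eventually.of_forall fun z => mul_nonneg (armInd_nonneg A b z) (hp0 z)) hg]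
    calc _ ≤ ∫⁻ z, 2 * (g z * ENNReal.ofReal (armProp m μ A b z)) ∂μ := by
          refine lintegral_mono fun z => ?_
          by_cases hz : z ∈ G
          · calc _ ≤ g z * ENNReal.ofReal (2 * armProp m μ A b z) := by gcongr; exact hq z hz
              _ = _ := by rw [ENNReal.ofReal_mul (by norm_num)]; simp; ring
          · simp [hgdef, hz]
      _ ≤ _ := by
          rw [lintegral_const_mul _ k3]
          gcongr
  have t3 : ∫⁻ z, g z * ENNReal.ofReal (armProp m μ A b z) * ENNReal.ofReal (p z) ∂μ ≤ 2 * D := by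
    rw [← lintegral_mul_ofReal_condExp hm hp (Eventually.of_forall hp0) k3']
    calc _ ≤ ∫⁻ z, 2 * (g z * ENNReal.ofReal (armProp m μ A b z)) ∂μ := by
          refine lintegral_mono fun z => ?_
          by_cases hz : z ∈ G
          · calc _ ≤ g z * ENNReal.ofReal (armProp m μ A b z) * ENNReal.ofReal 2 := by
                  gcongr; exact hh z hz
              _ = _ := by simp; ring
          · simp [hgdef, hz]
      _ ≤ _ := by
          rw [lintegral_const_mul _ k3]
          gcongr
  calc _ = ∫⁻ z, ((g z * ENNReal.ofReal (armInd A b z * p z) + g z * ENNReal.ofReal (armInd A b z))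
        + (g z * ENNReal.ofReal (armProp m μ A b z) * ENNReal.ofReal (p z)
          + g z * ENNReal.ofReal (armProp m μ A b z))) ∂μ := by
        refine lintegral_congr_ae ?_
        filter_upwards [ae_armProp_nonneg (m := m) (μ := μ) (A := A) b] with z hz
        have hJ := armInd_nonneg A b z
        have e : (armInd A b z + armProp m μ A b z) * (p z + 1) = (armInd A b z * p z +
          armInd A b z) + (armProp m μ A b z * p z + armProp m μ A b z) := by ring
        have := hp0 z
        rw [e, ENNReal.ofReal_add (by positivity) (by positivity), ENNReal.ofReal_add
          (by positivity) (by positivity), ENNReal.ofReal_add (by positivity) (by positivity),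
          ENNReal.ofReal_mul hz]
        ring
    _ ≤ (2 * D + D) + (2 * D + D) := by
        have k12 : AEMeasurable (fun z => g z * ENNReal.ofReal (armInd A b z * p z) +
          g z * ENNReal.ofReal (armInd A b z)) μ := k1.add k2.aemeasurable
        rw [lintegral_add_left' k12, lintegral_add_left' k1,
          lintegral_add_left' k4]
        gcongr
    _ = 6 * D := by ring

/-- The set where conditioning on the history, with or without the arm `b`, changes the density
`p` by at most the factor two. -/
def stableSet (m : MeasurableSpace Ω) {m0 : MeasurableSpace Ω} (μ : Measure Ω) (A : Ω → Bool)
    (b : Bool) (p : Ω → ℝ) : Set Ω :=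
  {z | 0 < armProp m μ A b z ∧ (armProp m μ A b z / 2 ≤ μ[fun z => armInd A b z * p z|m] z ∧
    μ[fun z => armInd A b z * p z|m] z ≤ 2 * armProp m μ A b z) ∧
    (1 / 2 ≤ μ[p|m] z ∧ μ[p|m] z ≤ 2)}

omit [IsProbabilityMeasure μ] in
lemma measurableSet_stableSet (b : Bool) (p : Ω → ℝ) :
    MeasurableSet[m] (stableSet m μ A b p) := by
  have h1 : Measurable[m] (armProp m μ A b) := (stronglyMeasurable_armProp b).measurable
  have h2 : Measurable[m] (μ[fun z => armInd A b z * p z|m]) :=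
    stronglyMeasurable_condExp.measurable
  have h3 : Measurable[m] (μ[p|m]) := stronglyMeasurable_condExp.measurable
  exact (measurableSet_lt measurable_const h1).inter
    (((measurableSet_le (h1.div_const 2) h2).inter (measurableSet_le h2 (h1.const_mul 2))).inter
      ((measurableSet_le measurable_const h3).inter (measurableSet_le h3 measurable_const)))

omit [IsProbabilityMeasure μ] in
lemma setIntegral_armInd_mul (hA : Measurable A) (b : Bool) (N : Set Ω) (p : Ω → ℝ) :
    ∫ z in N, armInd A b z * p z ∂μ = ∫ z in N ∩ A ⁻¹' {b}, p z ∂μ := by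
  rw [← setIntegral_indicator (hA (measurableSet_singleton b))]
  refine integral_congr_ae (Eventually.of_forall fun z => ?_)
  by_cases h : A z = b <;> simp [armInd, Set.indicator, h]

/-- On each of the events that make up the complement of the stable set, a conditional density is
below `1 / 2` or above `2`, so that the Hellinger distance bounds its probability. For a sequence of
laws at distance `O(ε)` this is `O(ε ^ 2)`. -/
lemma measureReal_compl_stableSet_le (hm : m ≤ m0) (hA : Measurable A) (b : Bool) {p : Ω → ℝ}
    (hp0 : ∀ z, 0 ≤ p z) (hp : Integrable p μ) :
    μ.real (A ⁻¹' {b} ∩ (stableSet m μ A b p)ᶜ) ≤ 48 * ∫ z, (√(p z) - 1) ^ 2 ∂μ := by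
  have h1 : Measurable[m] (armProp m μ A b) := (stronglyMeasurable_armProp b).measurable
  have h2 : Measurable[m] (μ[fun z => armInd A b z * p z|m]) :=
    stronglyMeasurable_condExp.measurable
  have h3 : Measurable[m] (μ[p|m]) := stronglyMeasurable_condExp.measurable
  set B1 : Set Ω := {z | μ[p|m] z < 1 / 2} with hB1
  set B2 : Set Ω := {z | 2 < μ[p|m] z} with hB2
  set N3 : Set Ω := {z | μ[fun z => armInd A b z * p z|m] z < armProp m μ A b z / 2} with hN3
  set N4 : Set Ω := {z | 2 * armProp m μ A b z < μ[fun z => armInd A b z * p z|m] z} with hN4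
  have mB1 : MeasurableSet[m] B1 := measurableSet_lt h3 measurable_const
  have mB2 : MeasurableSet[m] B2 := measurableSet_lt measurable_const h3
  have mN3 : MeasurableSet[m] N3 := measurableSet_lt h2 (h1.div_const 2)
  have mN4 : MeasurableSet[m] N4 := measurableSet_lt (h1.const_mul 2) h2
  have hJp := integrable_armInd_mul (μ := μ) hA b hp
  have hpi : Integrable (armProp m μ A b) μ := integrable_condExp
  have hpr : ∀ N : Set Ω, MeasurableSet[m] N →
      ∫ z in N, armProp m μ A b z ∂μ = μ.real (N ∩ A ⁻¹' {b}) := fun N hN => by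
    have e := setIntegral_armInd_mul (μ := μ) hA b N (fun _ => 1)
    simp only [mul_one] at e
    rw [armProp, setIntegral_condExp hm (integrable_armInd hA b) hN, e]
    simp
  have b1 : μ.real B1 ≤ 12 * ∫ z, (√(p z) - 1) ^ 2 ∂μ := by
    refine measureReal_le_hellinger hp0 hp (Or.inl ?_)
    rw [← setIntegral_condExp hm hp mB1]
    refine (setIntegral_mono_on integrable_condExp.integrableOn
      (integrable_const (1 / 2 : ℝ)).integrableOn (hm _ mB1) fun z hz => le_of_lt hz).trans ?_
    simp
    linarith
  have b2 : μ.real B2 ≤ 12 * ∫ z, (√(p z) - 1) ^ 2 ∂μ := by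
    refine measureReal_le_hellinger hp0 hp (Or.inr ?_)
    rw [← setIntegral_condExp hm hp mB2]
    refine le_trans ?_ (setIntegral_mono_on (integrable_const (2 : ℝ)).integrableOn
      integrable_condExp.integrableOn (hm _ mB2) fun z hz => le_of_lt hz)
    simp
    linarith
  have b3 : μ.real (N3 ∩ A ⁻¹' {b}) ≤ 12 * ∫ z, (√(p z) - 1) ^ 2 ∂μ := by
    refine measureReal_le_hellinger hp0 hp (Or.inl ?_)
    rw [← setIntegral_armInd_mul hA b N3 p, ← setIntegral_condExp hm hJp mN3, ← hpr N3 mN3,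
      ← integral_div]
    exact setIntegral_mono_on integrable_condExp.integrableOn (hpi.div_const 2).integrableOn
      (hm _ mN3) fun z hz => le_of_lt hz
  have b4 : μ.real (N4 ∩ A ⁻¹' {b}) ≤ 12 * ∫ z, (√(p z) - 1) ^ 2 ∂μ := by
    refine measureReal_le_hellinger hp0 hp (Or.inr ?_)
    rw [← setIntegral_armInd_mul hA b N4 p, ← setIntegral_condExp hm hJp mN4, ← hpr N4 mN4,
      ← integral_const_mul]
    exact setIntegral_mono_on (hpi.const_mul 2).integrableOn integrable_condExp.integrableOn
      (hm _ mN4) fun z hz => le_of_lt hz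
  have hsub : μ.real (A ⁻¹' {b} ∩ (stableSet m μ A b p)ᶜ) ≤
      μ.real ((B1 ∪ B2) ∪ ((N3 ∩ A ⁻¹' {b}) ∪ (N4 ∩ A ⁻¹' {b}))) := by
    refine ENNReal.toReal_mono (measure_ne_top _ _) (measure_mono_ae ?_)
    filter_upwards [ae_armProp_pos (μ := μ) hm hA b] with z hz hzmem
    obtain ⟨hzb, hzs⟩ := hzmem
    have hzb' : A z = b := hzb
    by_contra hcon
    refine hzs ⟨hz hzb', ⟨?_, ?_⟩, ?_, ?_⟩ <;> by_contra hlt <;> push Not at hlt <;> apply hcon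
    · exact Or.inr (Or.inl ⟨hlt, hzb⟩)
    · exact Or.inr (Or.inr ⟨hlt, hzb⟩)
    · exact Or.inl (Or.inl hlt)
    · exact Or.inl (Or.inr hlt)
  have u1 := measureReal_union_le (μ := μ) (B1 ∪ B2) ((N3 ∩ A ⁻¹' {b}) ∪ (N4 ∩ A ⁻¹' {b}))
  have u2 := measureReal_union_le (μ := μ) B1 B2
  have u3 := measureReal_union_le (μ := μ) (N3 ∩ A ⁻¹' {b}) (N4 ∩ A ⁻¹' {b})
  linarith

end Perturbation

/-! ### Differentiability in quadratic mean along sequences -/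

section QMD

variable {Ω : Type*} {m m0 : MeasurableSpace Ω} {μ : Measure Ω}

/-- Probability densities `p n` that are differentiable in quadratic mean, with score `S`, along a
summable sequence `ε n` of nonzero parameters. Summability makes all the densities and their
conditional expectations converge almost everywhere. -/
structure IsQMDSequence (μ : Measure Ω) (ε : ℕ → ℝ) (p : ℕ → Ω → ℝ) (S : Ω → ℝ) : Prop where
  ne_zero : ∀ n, ε n ≠ 0
  summable : Summable fun n => |ε n|
  nonneg : ∀ n z, 0 ≤ p n z
  integrable : ∀ n, Integrable (p n) μ
  integral_eq_one : ∀ n, ∫ z, p n z ∂μ = 1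
  memLp_score : MemLp S 2 μ
  tendsto : Tendsto (fun n => ∫ z, ((√(p n z) - 1) / ε n - S z / 2) ^ 2 ∂μ) atTop (𝓝 0)

namespace IsQMDSequence

variable [IsProbabilityMeasure μ] {ε : ℕ → ℝ} {p : ℕ → Ω → ℝ} {S : Ω → ℝ}

lemma memLp_quot (h : IsQMDSequence μ ε p S) (n : ℕ) :
    MemLp (fun z => (√(p n z) - 1) / ε n) 2 μ := by
  have := (memLp_sqrt_sub_one (h.nonneg n) (h.integrable n)).mul_const (ε n)⁻¹
  simpa [div_eq_mul_inv] using this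

omit [IsProbabilityMeasure μ] in
lemma memLp_half (h : IsQMDSequence μ ε p S) : MemLp (fun z => S z / 2) 2 μ := by
  simpa [div_eq_mul_inv] using h.memLp_score.mul_const (2 : ℝ)⁻¹

lemma exists_hellinger_le (h : IsQMDSequence μ ε p S) :
    ∃ c : ℝ, 0 ≤ c ∧ ∀ n, ∫ z, (√(p n z) - 1) ^ 2 ∂μ ≤ c * ε n ^ 2 := by
  obtain ⟨c, hc⟩ := h.tendsto.bddAbove_range
  refine ⟨2 * c + 2 * ∫ z, (S z / 2) ^ 2 ∂μ, ?_, fun n => ?_⟩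
  · have h0 := hc (Set.mem_range_self 0)
    have h1 : 0 ≤ ∫ z, ((√(p 0 z) - 1) / ε 0 - S z / 2) ^ 2 ∂μ :=
      integral_nonneg fun z => sq_nonneg _
    have h2 : 0 ≤ ∫ z, (S z / 2) ^ 2 ∂μ := integral_nonneg fun z => sq_nonneg _
    linarith
  · have h0 := hc (Set.mem_range_self n)
    have h1 := integral_sub_sq_le (f := fun z => (√(p n z) - 1) / ε n - S z / 2)
      (g := fun z => - (S z / 2)) ((h.memLp_quot n).sub h.memLp_half) h.memLp_half.neg
    have h2 : ∫ z, ((√(p n z) - 1) / ε n - S z / 2 - -(S z / 2)) ^ 2 ∂μ =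
        (∫ z, (√(p n z) - 1) ^ 2 ∂μ) / ε n ^ 2 := by
      rw [← integral_div]
      refine integral_congr_ae (Eventually.of_forall fun z => ?_)
      simp only
      rw [← div_pow]; ring
    have h3 : 0 < ε n ^ 2 := by have := h.ne_zero n; positivity
    rw [h2] at h1
    simp only [neg_sq] at h1
    rw [← div_le_iff₀ h3]
    linarith

/-- The `L¹` distances of the densities from `1` are of the order of the parameters. -/
lemma summable_integral_abs (h : IsQMDSequence μ ε p S) :
    Summable fun n => ∫ z, |p n z - 1| ∂μ := by
  obtain ⟨c, hc0, hc⟩ := h.exists_hellinger_le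
  refine Summable.of_nonneg_of_le (fun n => integral_nonneg fun z => abs_nonneg _) (fun n => ?_)
    (h.summable.mul_left (√c * √4))
  have hs := memLp_sqrt (h.nonneg n) (h.integrable n)
  have h1 := abs_integral_mul_le_sqrt (f := fun z => |√(p n z) - 1|) (g := fun z => √(p n z) + 1)
    (memLp_sqrt_sub_one (h.nonneg n) (h.integrable n)).abs (hs.add (memLp_const 1))
  have e1 : ∀ z, |√(p n z) - 1| * (√(p n z) + 1) = |p n z - 1| := fun z => by
    have : 0 ≤ √(p n z) + 1 := by positivity
    rw [← abs_of_nonneg this, ← abs_mul]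
    congr 1
    nlinarith [Real.sq_sqrt (h.nonneg n z)]
  simp only [e1, sq_abs] at h1
  have h2 : ∫ z, (√(p n z) + 1) ^ 2 ∂μ ≤ 4 := by
    have := integral_sub_sq_le (g := fun _ => (-1 : ℝ)) hs (memLp_const (-1))
    simp only [sub_neg_eq_add, Real.sq_sqrt (h.nonneg n _), h.integral_eq_one n] at this
    refine this.trans (by simp; norm_num)
  calc ∫ z, |p n z - 1| ∂μ ≤ _ := (le_abs_self _).trans h1
    _ ≤ √(c * ε n ^ 2) * √4 := by gcongr; exact hc n
    _ = √c * √4 * |ε n| := by rw [Real.sqrt_mul hc0, Real.sqrt_sq_eq_abs]; ring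

lemma ae_tendsto (h : IsQMDSequence μ ε p S) :
    ∀ᵐ z ∂μ, Tendsto (fun n => p n z) atTop (𝓝 1) := by
  filter_upwards [tendsto_zero_ae_of_summable_integral (fun n z => abs_nonneg (p n z - 1))
    (fun n => ((h.integrable n).sub (integrable_const 1)).abs) h.summable_integral_abs] with z hz
  have := ((tendsto_zero_iff_abs_tendsto_zero _).2 hz).add_const 1
  simpa using this

lemma ae_tendsto_condExp (hm : m ≤ m0) (h : IsQMDSequence μ ε p S) :
    ∀ᵐ z ∂μ, Tendsto (fun n => μ[p n|m] z) atTop (𝓝 1) := by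
  have := tendsto_condExp_mul_of_summable (m := m) h.integrable h.summable_integral_abs
    (J := fun _ => 1) measurable_const (fun z => by simp)
  simpa [condExp_const hm] using this

lemma ae_tendsto_condExp_armInd (h : IsQMDSequence μ ε p S) {A : Ω → Bool} (hA : Measurable A)
    (b : Bool) : ∀ᵐ z ∂μ, Tendsto (fun n => μ[fun z => armInd A b z * p n z|m] z) atTop
      (𝓝 (armProp m μ A b z)) :=
  tendsto_condExp_mul_of_summable h.integrable h.summable_integral_abs (measurable_armInd hA b)
    (abs_armInd_le_one A b)

end IsQMDSequence

end QMD

/-! ### Derivative of the contribution of one arm -/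

section ArmDerivative

variable {Ω : Type*} {m m0 : MeasurableSpace Ω} {μ : Measure Ω} [IsProbabilityMeasure μ]
  {A : Ω → Bool} {b : Bool} {W : Ω → ℝ} {ε : ℕ → ℝ} {p : ℕ → Ω → ℝ} {S : Ω → ℝ}

lemma eventually_mem_stableSet (hm : m ≤ m0) (hA : Measurable A) (b : Bool)
    (h : IsQMDSequence μ ε p S) :
    ∀ᵐ z ∂μ, 0 < armProp m μ A b z → ∀ᶠ n in atTop, z ∈ stableSet m μ A b (p n) := by
  filter_upwards [h.ae_tendsto_condExp hm, h.ae_tendsto_condExp_armInd (m := m) hA b]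
    with z h1 h2 hz
  filter_upwards [h1.eventually (Icc_mem_nhds (a := 1 / 2) (b := 2) (by norm_num) (by norm_num)),
    h2.eventually (Icc_mem_nhds (a := armProp m μ A b z / 2) (b := 2 * armProp m μ A b z)
      (by linarith) (by linarith))] with n h3 h4
  exact ⟨hz, h4, h3⟩

/-- The weights `ρ n` of an arm may be compared off the stable set at no cost: that set carries
probability of order `ε n ^ 2`, and the regression is square integrable. -/
lemma tendsto_integral_compl_stableSet (hm : m ≤ m0) (hA : Measurable A) (hW : MemLp W 2 μ)
    (h : IsQMDSequence μ ε p S) {K : ℝ} {F : ℕ → Ω → ℝ} (hF : ∀ n, Measurable (F n))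
    (hFK : ∀ n z, |F n z| ≤ K) :
    Tendsto (fun n => (∫ z, (stableSet m μ A b (p n))ᶜ.indicator
      (fun z => F n z * (armInd A b z * armMean m μ A b W z)) z ∂μ) / ε n) atTop (𝓝 0) := by
  have hJM := memLp_armInd_mul_armMean (μ := μ) hm hA b hW
  set J := armInd A b with hJ
  set M := armMean m μ A b W with hM
  set G : ℕ → Set Ω := fun n => stableSet m μ A b (p n) with hG
  have mG : ∀ n, MeasurableSet (G n) := fun n => hm _ (measurableSet_stableSet b (p n))
  have hb : MeasurableSet (A ⁻¹' {b}) := hA (measurableSet_singleton b)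
  obtain ⟨c, hc0, hc⟩ := h.exists_hellinger_le
  set f : ℕ → Ω → ℝ := fun n => (G n)ᶜ.indicator fun z => F n z * (J z * M z) with hf
  have hfle : ∀ n z, |f n z| ≤ K * |J z * M z| := fun n z => by
    have hK : 0 ≤ K := (abs_nonneg _).trans (hFK n z)
    by_cases hz : z ∈ (G n)ᶜ
    · rw [hf]; simp only [Set.indicator_of_mem hz, abs_mul (F n z)]
      gcongr
      exact hFK n z
    · rw [hf]; simp only [Set.indicator_of_notMem hz, abs_zero]
      positivity
  have hfm : ∀ n, AEStronglyMeasurable (f n) μ := fun n =>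
    ((hF n).aestronglyMeasurable.mul hJM.1).indicator (mG n).compl
  have hf2 : ∀ n, MemLp (f n) 2 μ := fun n =>
    MemLp.of_le_mul (c := K) hJM (hfm n) (Eventually.of_forall fun z => hfle n z)
  have hlim : Tendsto (fun n => ∫ z, f n z ^ 2 ∂μ) atTop (𝓝 0) := by
    have := tendsto_integral_of_dominated_convergence (μ := μ) (F := fun n z => f n z ^ 2)
      (f := fun _ => 0) (fun z => (K * |J z * M z|) ^ 2) (fun n => (hfm n).pow 2) ?_
      (fun n => Eventually.of_forall fun z => ?_) ?_
    · simpa using this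
    · exact (hJM.abs.const_mul K).integrable_sq
    · rw [Real.norm_eq_abs, abs_pow]
      gcongr
      exact hfle n z
    · filter_upwards [eventually_mem_stableSet hm hA b h,
        ae_armProp_nonneg (m := m) (μ := μ) (A := A) b] with z hz hz0
      rcases hz0.lt_or_eq with hpos | hzero
      · refine tendsto_const_nhds.congr' ?_
        filter_upwards [hz hpos] with n hn
        have : z ∉ (G n)ᶜ := fun hcon => hcon hn
        simp [hf, Set.indicator_of_notMem this]
      · have : M z = 0 := armMean_eq_zero hzero.symm
        have h0 : ∀ n, f n z = 0 := fun n => by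
          simp only [hf, Set.indicator, this, mul_zero, ite_self]
        simp [h0]
  have hbound : ∀ n, |(∫ z, f n z ∂μ) / ε n| ≤ √(∫ z, f n z ^ 2 ∂μ) * √(48 * c) := fun n => by
    set g : Ω → ℝ := (A ⁻¹' {b} ∩ (G n)ᶜ).indicator fun _ => 1 with hg
    have hgm : MemLp g 2 μ := (memLp_const 1).indicator (hb.inter (mG n).compl)
    have hfg : ∀ z, f n z * g z = f n z := fun z => by
      by_cases hz : z ∈ A ⁻¹' {b} ∩ (G n)ᶜ
      · simp [hg, Set.indicator_of_mem hz]
      · by_cases hz' : z ∈ (G n)ᶜ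
        · have : A z ≠ b := fun hcon => hz ⟨hcon, hz'⟩
          have h0 : f n z = 0 := by simp [hf, hJ, armInd, Set.indicator, this]
          rw [h0, zero_mul]
        · simp [hf, Set.indicator_of_notMem hz']
    have h1 := abs_integral_mul_le_sqrt (hf2 n) hgm
    simp only [hfg] at h1
    have h2 : ∫ z, g z ^ 2 ∂μ = μ.real (A ⁻¹' {b} ∩ (G n)ᶜ) := by
      have : ∀ z, g z ^ 2 = g z := fun z => by
        by_cases hz : z ∈ A ⁻¹' {b} ∩ (G n)ᶜ <;> simp [hg, hz]
      simp only [this]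
      rw [hg, integral_indicator_const _ (hb.inter (mG n).compl)]
      simp
    have h3 : ∫ z, g z ^ 2 ∂μ ≤ 48 * c * ε n ^ 2 := by
      rw [h2]
      have := measureReal_compl_stableSet_le (μ := μ) hm hA b (h.nonneg n) (h.integrable n)
      linarith [hc n]
    have h4 : √(∫ z, g z ^ 2 ∂μ) ≤ √(48 * c) * |ε n| := by
      rw [← Real.sqrt_sq_eq_abs, ← Real.sqrt_mul (by positivity)]
      exact Real.sqrt_le_sqrt h3
    have hε : 0 < |ε n| := abs_pos.2 (h.ne_zero n)
    rw [abs_div, div_le_iff₀ hε, mul_assoc]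
    exact h1.trans (by gcongr)
  refine squeeze_zero_norm hbound ?_
  simpa using hlim.sqrt.mul_const (√(48 * c))

/-- The derivative of `∫ R (ρ - ρ') 1(A = b) M` along a sequence of perturbed laws, where `M` is
the regression of `W` on the arm `b`. The weight `ρ n` of the perturbed law is described through
the increment of `π ρ`, which is proportional to the increment of the arm probability `π`. That
increment is a conditional expectation against `p n - 1`, so that on the stable set the integral
becomes one of a sequence bounded in `L²` against the difference quotients of `√(p n)`. -/
theorem tendsto_arm_derivative (hm : m ≤ m0) (hA : Measurable A) (hW : MemLp W 2 μ)
    (h : IsQMDSequence μ ε p S) {K : ℝ} (hK : 0 ≤ K) {R ρ Δ : ℕ → Ω → ℝ} {R' ρ' L : Ω → ℝ}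
    (hR : ∀ n, Measurable[m] (R n)) (hRK : ∀ n z, |R n z| ≤ K)
    (hRlim : ∀ᵐ z ∂μ, Tendsto (fun n => R n z) atTop (𝓝 (R' z)))
    (hρ : ∀ n, Measurable[m] (ρ n)) (hρK : ∀ n z, |ρ n z| ≤ K)
    (hρ' : Measurable[m] ρ') (hρ'K : ∀ z, |ρ' z| ≤ K)
    (hρlim : ∀ᵐ z ∂μ, 0 < armProp m μ A b z → Tendsto (fun n => ρ n z) atTop (𝓝 (ρ' z)))
    (hΔ : ∀ n, Measurable[m] (Δ n)) (hΔK : ∀ n z, |Δ n z| ≤ K)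
    (hΔlim : ∀ᵐ z ∂μ, Tendsto (fun n => Δ n z) atTop (𝓝 (L z)))
    (hrel : ∀ n, ∀ᵐ z ∂μ, 0 < armProp m μ A b z → 0 < μ[fun z => armInd A b z * p n z|m] z →
      0 < μ[p n|m] z → armProp m μ A b z * (ρ n z - ρ' z) = (Δ n z - ρ n z) *
        (μ[fun z => armInd A b z * p n z|m] z / μ[p n|m] z - armProp m μ A b z)) :
    MemLp (fun z => R' z * ((L z - ρ' z) * (armMean m μ A b W z *
        (armInd A b z - armProp m μ A b z)))) 2 μ ∧
      Tendsto (fun n => (∫ z, R n z * (ρ n z - ρ' z) * (armInd A b z * armMean m μ A b W z) ∂μ)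
        / ε n) atTop (𝓝 (∫ z, R' z * ((L z - ρ' z) * (armMean m μ A b W z *
          (armInd A b z - armProp m μ A b z))) * S z ∂μ)) := by
  have hJM := memLp_armInd_mul_armMean (μ := μ) hm hA b hW
  have hMm : Measurable[m] (armMean m μ A b W) := (stronglyMeasurable_armMean b W).measurable
  have hπm : Measurable[m] (armProp m μ A b) := (stronglyMeasurable_armProp b).measurable
  have hJm := measurable_armInd hA b
  have hπ0 := ae_armProp_nonneg (m := m) (μ := μ) (A := A) b
  have hπ1 := ae_armProp_le_one (μ := μ) hm hA b
  set J := armInd A b with hJ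
  set M := armMean m μ A b W with hM
  set π := armProp m μ A b with hπ
  set q : ℕ → Ω → ℝ := fun n => μ[fun z => J z * p n z|m] with hq
  set k : ℕ → Ω → ℝ := fun n => μ[p n|m] with hk
  set G : ℕ → Set Ω := fun n => stableSet m μ A b (p n) with hG
  have mG' : ∀ n, MeasurableSet[m] (G n) := fun n => measurableSet_stableSet b (p n)
  have mG : ∀ n, MeasurableSet (G n) := fun n => hm _ (mG' n)
  have hkm : ∀ n, Measurable[m] (k n) := fun n => stronglyMeasurable_condExp.measurable
  set g : ℕ → Ω → ℝ := fun n => (G n).indicator fun z => R n z * (Δ n z - ρ n z) / k n z * M z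
    with hg
  have hgm : ∀ n, Measurable[m] (g n) := fun n =>
    Measurable.indicator ((((hR n).mul ((hΔ n).sub (hρ n))).div (hkm n)).mul hMm) (mG' n)
  set w : ℕ → Ω → ℝ := fun n z => g n z * ((J z - π z) * (√(p n z) + 1)) with hw
  have hFm : ∀ n, Measurable fun z => R n z * (ρ n z - ρ' z) := fun n =>
    ((hR n).mono hm le_rfl).mul (((hρ n).mono hm le_rfl).sub (hρ'.mono hm le_rfl))
  have hFK : ∀ n z, |R n z * (ρ n z - ρ' z)| ≤ K * (K + K) := fun n z => by
    rw [abs_mul]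
    gcongr
    · exact hRK n z
    · exact (abs_sub _ _).trans (add_le_add (hρK n z) (hρ'K z))
  -- second moments of the weights on the stable set
  have hw2 : ∀ n, MemLp (w n) 2 μ ∧ ∫ z, w n z ^ 2 ∂μ ≤ 192 * K ^ 4 * ∫ z, (J z * M z) ^ 2 ∂μ := by
    intro n
    refine memLp_two_of_lintegral_sq_le ?_ (mul_nonneg (by positivity)
      (integral_nonneg fun z => sq_nonneg _)) ?_
    · have h1 : AEMeasurable (fun z => √(p n z)) μ := (h.integrable n).1.aemeasurable.sqrt
      exact (((hgm n).mono hm le_rfl).aemeasurable.mul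
        ((hJm.sub (hπm.mono hm le_rfl)).aemeasurable.mul
        (h1.add_const 1))).aestronglyMeasurable
    · have h1 := lintegral_indicator_sq_mul_le (μ := μ) hm hA b hMm (h.nonneg n) (h.integrable n)
        (mG' n) (fun z hz => hz.2.1.2) (fun z hz => hz.2.2.2)
      calc ∫⁻ z, ENNReal.ofReal (w n z ^ 2) ∂μ
          ≤ ∫⁻ z, ENNReal.ofReal (32 * K ^ 4) *
            ((G n).indicator (fun z => ENNReal.ofReal (M z ^ 2)) z *
              ENNReal.ofReal ((J z + π z) * (p n z + 1))) ∂μ := by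
            refine lintegral_mono_ae ?_
            filter_upwards [hπ0, hπ1] with z hz0 hz1
            by_cases hz : z ∈ G n
            · have hkpos : 1 / 2 ≤ k n z := hz.2.2.1
              have hJ0 := armInd_nonneg A b z
              have hp0 := h.nonneg n z
              simp only [hw, hg, Set.indicator_of_mem hz]
              rw [← ENNReal.ofReal_mul (sq_nonneg _), ← ENNReal.ofReal_mul (by positivity)]
              refine ENNReal.ofReal_le_ofReal ?_
              have a1 : |R n z * (Δ n z - ρ n z) / k n z| ≤ 4 * K ^ 2 := by
                rw [abs_div, abs_mul, abs_of_pos (show 0 < k n z by linarith),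
                  div_le_iff₀ (by linarith)]
                have b1 : |R n z| * |Δ n z - ρ n z| ≤ K * (K + K) := by
                  gcongr
                  · exact hRK n z
                  · exact (abs_sub _ _).trans (add_le_add (hΔK n z) (hρK n z))
                nlinarith [sq_nonneg K]
              have a2 : (R n z * (Δ n z - ρ n z) / k n z) ^ 2 ≤ 16 * K ^ 4 := by
                rw [← sq_abs]
                calc _ ≤ (4 * K ^ 2) ^ 2 := by gcongr
                  _ = _ := by ring
              have a3 : (J z - π z) ^ 2 ≤ J z + π z := by
                have := armInd_mul_self A b z
                nlinarith
              have a4 : (√(p n z) + 1) ^ 2 ≤ 2 * (p n z + 1) := by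
                nlinarith [Real.sq_sqrt hp0, sq_nonneg (√(p n z) - 1)]
              calc _ = (R n z * (Δ n z - ρ n z) / k n z) ^ 2 * M z ^ 2 *
                    ((J z - π z) ^ 2 * (√(p n z) + 1) ^ 2) := by ring
                _ ≤ (16 * K ^ 4) * M z ^ 2 * ((J z + π z) * (2 * (p n z + 1))) := by gcongr
                _ = _ := by ring
            · simp [hw, hg, hz]
        _ ≤ ENNReal.ofReal (32 * K ^ 4) * (6 * ∫⁻ z, ENNReal.ofReal ((J z * M z) ^ 2) ∂μ) := by
            rw [lintegral_const_mul' _ _ ENNReal.ofReal_ne_top]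
            gcongr
        _ = _ := by
            rw [← ofReal_integral_eq_lintegral_ofReal hJM.integrable_sq
              (Eventually.of_forall fun z => sq_nonneg _),
              show (6 : ℝ≥0∞) = ENNReal.ofReal 6 by simp, ← ENNReal.ofReal_mul (by norm_num),
              ← ENNReal.ofReal_mul (by positivity)]
            congr 1; ring
  have hwlim : ∀ᵐ z ∂μ, Tendsto (fun n => w n z) atTop
      (𝓝 (R' z * ((L z - ρ' z) * (M z * (J z - π z))) * 2)) := by
    filter_upwards [hπ0, eventually_mem_stableSet hm hA b h, hRlim, hρlim, hΔlim,
      h.ae_tendsto_condExp hm, h.ae_tendsto] with z hz0 hst hRz hρz hΔz hkz hpz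
    rcases hz0.lt_or_eq with hpos | hzero
    · have h1 := (((hRz.mul (hΔz.sub (hρz hpos))).div hkz one_ne_zero).mul_const (M z)).mul
        ((hpz.sqrt.add_const 1).const_mul (J z - π z))
      have e : R' z * (L z - ρ' z) / 1 * M z * ((J z - π z) * (√1 + 1)) =
        R' z * ((L z - ρ' z) * (M z * (J z - π z))) * 2 := by rw [Real.sqrt_one]; ring
      rw [e] at h1
      refine h1.congr' ?_
      filter_upwards [hst hpos] with n hn
      simp [hw, hg, hG, Set.indicator_of_mem hn, hk]
    · have hM0 : M z = 0 := armMean_eq_zero hzero.symm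
      have h0 : ∀ n, w n z = 0 := fun n => by simp [hw, hg, hM0]
      simp [h0, hM0]
  have hmem : MemLp (fun z => R' z * ((L z - ρ' z) * (M z * (J z - π z))) * 2) 2 μ :=
    (memLp_two_of_tendsto_ae (fun n => (hw2 n).1) (fun n => (hw2 n).2) hwlim).1
  refine ⟨by simpa [mul_assoc] using hmem.mul_const (2⁻¹ : ℝ), ?_⟩
  have hmain := tendsto_integral_mul_of_tendsto_ae_of_tendsto (fun n => (hw2 n).1)
    (fun n => (hw2 n).2) hwlim h.memLp_quot h.memLp_half h.tendsto
  have hbad := tendsto_integral_compl_stableSet (b := b) hm hA hW h hFm hFK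
  have hsum := hmain.add hbad
  have elim : ∫ z, R' z * ((L z - ρ' z) * (M z * (J z - π z))) * 2 * (S z / 2) ∂μ + 0 =
      ∫ z, R' z * ((L z - ρ' z) * (M z * (J z - π z))) * S z ∂μ := by
    rw [add_zero]
    exact integral_congr_ae (Eventually.of_forall fun z => by simp only; ring)
  rw [elim] at hsum
  refine hsum.congr fun n => ?_
  have hu := memLp_sqrt_sub_one (h.nonneg n) (h.integrable n)
  have hFi : Integrable (fun z => R n z * (ρ n z - ρ' z) * (J z * M z)) μ :=
    (hJM.integrable (by norm_num)).bdd_mul (hFm n).aestronglyMeasurable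
      (Eventually.of_forall (hFK n))
  -- the contribution of the stable set
  have hgood : ∫ z, (G n).indicator (fun z => R n z * (ρ n z - ρ' z) * (J z * M z)) z ∂μ =
      ∫ z, w n z * (√(p n z) - 1) ∂μ := by
    set c : Ω → ℝ := (G n).indicator fun z => R n z * (ρ n z - ρ' z) * M z with hc
    have hcm : Measurable[m] c :=
      Measurable.indicator (((hR n).mul ((hρ n).sub hρ')).mul hMm) (mG' n)
    have e1 : ∀ z, (G n).indicator (fun z => R n z * (ρ n z - ρ' z) * (J z * M z)) z =
        c z * J z := fun z => by
      by_cases hz : z ∈ G n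
      · simp only [hc, Set.indicator_of_mem hz]; ring
      · simp [hc, hz]
    have hcJ : Integrable (fun z => c z * J z) μ :=
      (hFi.indicator (mG n)).congr (Eventually.of_forall e1)
    set X : Ω → ℝ := fun z => (J z - π z) * (p n z - 1) with hX
    have hπb : ∀ᵐ z ∂μ, ‖π z‖ ≤ 1 := by
      filter_upwards [hπ0, hπ1] with z hz0 hz1
      rw [Real.norm_eq_abs, abs_of_nonneg hz0]; exact hz1
    have hπp : Integrable (fun z => π z * p n z) μ :=
      (h.integrable n).bdd_mul (hπm.mono hm le_rfl).aestronglyMeasurable hπb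
    have hJp := integrable_armInd_mul (μ := μ) hA b (h.integrable n)
    have hJi := integrable_armInd (μ := μ) hA b
    have hπi : Integrable π μ := integrable_condExp
    have eX : X = ((fun z => J z * p n z) - J) - ((fun z => π z * p n z) - π) := by
      funext z; simp only [hX, Pi.sub_apply]; ring
    have hXi : Integrable X μ := by rw [eX]; exact (hJp.sub hJi).sub (hπp.sub hπi)
    have hXc : μ[X|m] =ᵐ[μ] fun z => q n z - π z * k n z := by
      rw [eX]
      have c1 := condExp_sub (hJp.sub hJi) (hπp.sub hπi) m
      have c2 := condExp_sub hJp hJi m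
      have c3 := condExp_sub hπp hπi m
      have c4 := condExp_mul_of_stronglyMeasurable_left (m := m) (μ := μ)
        (stronglyMeasurable_armProp (A := A) b) hπp (h.integrable n)
      have c5 : μ[π|m] = π := condExp_of_stronglyMeasurable hm (stronglyMeasurable_armProp b) hπi
      filter_upwards [c1, c2, c3, c4] with z z1 z2 z3 z4
      have z4' : (μ[fun z => π z * p n z|m]) z = π z * k n z := z4
      have z6 : μ[J|m] z = π z := rfl
      rw [z1, Pi.sub_apply, z2, z3, Pi.sub_apply, Pi.sub_apply, z4', c5, z6]
      ring
    have egX : ∀ z, g n z * X z = w n z * (√(p n z) - 1) := fun z => by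
      simp only [hX, hw]
      linear_combination (-(g n z * (J z - π z))) * Real.sq_sqrt (h.nonneg n z)
    have hgX : Integrable (fun z => g n z * X z) μ :=
      (integrable_mul_of_memLp_two (hw2 n).1 hu).congr
        (Eventually.of_forall fun z => (egX z).symm)
    calc _ = ∫ z, c z * J z ∂μ := integral_congr_ae (Eventually.of_forall e1)
      _ = ∫ z, c z * π z ∂μ := (integral_mul_condExp hm
          hcm.stronglyMeasurable.aestronglyMeasurable hJi hcJ).symm
      _ = ∫ z, g n z * μ[X|m] z ∂μ := by
          refine integral_congr_ae ?_
          filter_upwards [hXc, hrel n] with z hz hrz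
          rw [hz]
          by_cases hzG : z ∈ G n
          · have hkpos : 0 < k n z := lt_of_lt_of_le (by norm_num) hzG.2.2.1
            have hqpos : 0 < q n z := lt_of_lt_of_le (by have := hzG.1; positivity) hzG.2.1.1
            have hr := hrz hzG.1 hqpos hkpos
            have hr' : π z * (ρ n z - ρ' z) = (Δ n z - ρ n z) * (q n z / k n z - π z) := hr
            simp only [hc, hg, Set.indicator_of_mem hzG]
            have e3 : q n z / k n z - π z = (q n z - π z * k n z) / k n z := by
              field_simp
            rw [e3] at hr'
            calc _ = R n z * M z * (π z * (ρ n z - ρ' z)) := by ring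
              _ = _ := by rw [hr']; ring
          · simp [hc, hg, hzG]
      _ = ∫ z, g n z * X z ∂μ := integral_mul_condExp hm
          (hgm n).stronglyMeasurable.aestronglyMeasurable hXi hgX
      _ = _ := integral_congr_ae (Eventually.of_forall egX)
  have hsplit : ∫ z, R n z * (ρ n z - ρ' z) * (J z * M z) ∂μ =
      ∫ z, (G n).indicator (fun z => R n z * (ρ n z - ρ' z) * (J z * M z)) z ∂μ +
      ∫ z, (G n)ᶜ.indicator (fun z => R n z * (ρ n z - ρ' z) * (J z * M z)) z ∂μ := by
    rw [integral_indicator (mG n), integral_indicator (mG n).compl,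
      integral_add_compl (mG n) hFi]
  rw [hsplit, hgood, add_div]
  congr 1
  rw [← integral_div]
  exact integral_congr_ae (Eventually.of_forall fun z => by simp only; ring)

end ArmDerivative

/-! ### Change of measure and conditioning -/

section ChangeOfMeasure

variable {Ω : Type*} {m m0 : MeasurableSpace Ω} {μ ν : Measure Ω} {A : Ω → Bool}

lemma ae_condExp_eq_zero_of_mem (hm : m ≤ m0) {f : Ω → ℝ} {N : Set Ω} (hN : MeasurableSet[m] N)
    (h : ∀ᵐ z ∂μ, z ∈ N → f z = 0) :
    ∀ᵐ z ∂μ, z ∈ N → μ[f|m] z = 0 := by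
  have h1 : f =ᵐ[μ.restrict N] 0 := by
    rw [EventuallyEq, ae_restrict_iff' (hm _ hN)]; exact h
  have h2 := condExp_ae_eq_restrict_zero hN h1
  rwa [EventuallyEq, ae_restrict_iff' (hm _ hN)] at h2

/-- An event of the conditioning σ-algebra that excludes the arm `b` carries no conditional
probability of that arm. -/
lemma ae_armProp_eq_zero_of_mem [IsProbabilityMeasure μ]
    (hm : m ≤ m0) (b : Bool) {N : Set Ω}
    (hN : MeasurableSet[m] N) (h : ∀ᵐ z ∂μ, A z = b → z ∉ N) :
    ∀ᵐ z ∂μ, z ∈ N → armProp m μ A b z = 0 := by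
  refine ae_condExp_eq_zero_of_mem hm hN ?_
  filter_upwards [h] with z hz hzN
  have : A z ≠ b := fun hb => hz hb hzN
  simp [armInd, this]

lemma integral_mul_armInd_mul_armMean [IsProbabilityMeasure μ]
    (hm : m ≤ m0) (hA : Measurable A) (b : Bool) {W g : Ω → ℝ}
    (hW : MemLp W 2 μ) (hg : Measurable[m] g) {K : ℝ} (hgK : ∀ z, |g z| ≤ K) :
    ∫ z, g z * (armInd A b z * armMean m μ A b W z) ∂μ = ∫ z, g z * (armInd A b z * W z) ∂μ := by
  have hJM := memLp_armInd_mul_armMean (μ := μ) hm hA b hW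
  have hWi : Integrable W μ := hW.integrable (by norm_num)
  have hg' : AEStronglyMeasurable g μ := (hg.mono hm le_rfl).aestronglyMeasurable
  have hgM : Measurable[m] fun z => g z * armMean m μ A b W z :=
    hg.mul (stronglyMeasurable_armMean b W).measurable
  rw [← (integral_mul_armInd_mul hm hA b hWi hg.stronglyMeasurable.aestronglyMeasurable
    ((integrable_armInd_mul hA b hWi).bdd_mul hg' (Eventually.of_forall hgK))).2]
  have h1 := integral_mul_condExp hm (g := fun z => g z * armMean m μ A b W z)
    hgM.stronglyMeasurable.aestronglyMeasurable (integrable_armInd (μ := μ) hA b)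
    (((hJM.integrable (by norm_num)).bdd_mul hg' (Eventually.of_forall hgK)).congr
      (Eventually.of_forall fun z => by simp only; ring))
  calc _ = ∫ z, g z * armMean m μ A b W z * armInd A b z ∂μ :=
        integral_congr_ae (Eventually.of_forall fun z => by simp only; ring)
    _ = ∫ z, g z * armMean m μ A b W z * μ[armInd A b|m] z ∂μ := h1.symm
    _ = _ := integral_congr_ae (Eventually.of_forall fun z => by simp only [armProp]; ring)

/-- A real-valued version of the density of `ν` with respect to `μ`. -/
noncomputable def density (ν μ : Measure Ω) (z : Ω) : ℝ := (ν.rnDeriv μ z).toReal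

lemma density_nonneg (z : Ω) : 0 ≤ density ν μ z := ENNReal.toReal_nonneg

lemma integrable_density [IsProbabilityMeasure ν] : Integrable (density ν μ) μ :=
  Measure.integrable_toReal_rnDeriv

lemma integral_density_mul [IsProbabilityMeasure μ] [IsProbabilityMeasure ν] (h : ν ≪ μ)
    (f : Ω → ℝ) :
    ∫ z, density ν μ z * f z ∂μ = ∫ z, f z ∂ν := integral_rnDeriv_smul h

lemma integrable_density_mul [IsProbabilityMeasure μ] [IsProbabilityMeasure ν]
    (h : ν ≪ μ) {f : Ω → ℝ} :
    Integrable (fun z => density ν μ z * f z) μ ↔ Integrable f ν :=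
  integrable_rnDeriv_smul_iff h

/-- Bayes' formula for the conditional probability of an arm under a dominated law. -/
lemma ae_armProp_mul_condExp_density [IsProbabilityMeasure μ] [IsProbabilityMeasure ν]
    (hm : m ≤ m0) (hA : Measurable A) (b : Bool) (h : ν ≪ μ) :
    ∀ᵐ z ∂μ, armProp m ν A b z * μ[density ν μ|m] z =
      μ[fun z => armInd A b z * density ν μ z|m] z := by
  set p := density ν μ with hp
  set π := armProp m ν A b with hπ
  have hpi : Integrable p μ := integrable_density
  have hJp := integrable_armInd_mul hA b hpi
  have hπp : Integrable (fun z => π z * p z) μ :=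
    ((integrable_density_mul h).2 (integrable_condExp (f := armInd A b) (m := m) (μ := ν))).congr
      (Eventually.of_forall fun z => mul_comm _ _)
  have h1 : (0 : Ω → ℝ) =ᵐ[μ] μ[(fun z => armInd A b z * p z) - fun z => π z * p z|m] := by
    refine ae_eq_condExp_of_forall_setIntegral_eq hm (hJp.sub hπp)
      (fun s _ _ => integrableOn_zero) (fun N hN _ => ?_)
      stronglyMeasurable_zero.aestronglyMeasurable
    have e : ∀ f : Ω → ℝ, ∫ z in N, f z * p z ∂μ = ∫ z in N, f z ∂ν := fun f => by
      rw [← integral_indicator (hm _ hN), ← integral_indicator (hm _ hN),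
        ← integral_density_mul h]
      refine integral_congr_ae (Eventually.of_forall fun z => ?_)
      by_cases hz : z ∈ N <;> simp [hz, hp, mul_comm]
    simp only [Pi.zero_apply, integral_zero, Pi.sub_apply]
    rw [integral_sub hJp.integrableOn hπp.integrableOn, e, e, hπ, armProp,
      setIntegral_condExp hm (integrable_armInd hA b) hN, sub_self]
  have h2 := condExp_sub hJp hπp m
  have h3 := condExp_mul_of_stronglyMeasurable_left (m := m) (μ := μ)
    (stronglyMeasurable_armProp (A := A) (μ := ν) b) hπp hpi
  filter_upwards [h1, h2, h3] with z z1 z2 z3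
  have z3' : (μ[fun z => π z * p z|m]) z = π z * μ[p|m] z := z3
  rw [z2, Pi.sub_apply, z3'] at z1
  simp only [Pi.zero_apply] at z1
  linarith

/-- A property of the conditioning variables that holds under a dominated law holds wherever the
density given these variables does not vanish. -/
lemma ae_of_ae_of_condExp_density [IsProbabilityMeasure μ] [IsProbabilityMeasure ν]
    (hm : m ≤ m0) (h : ν ≪ μ) {N : Set Ω}
    (hN : MeasurableSet[m] N) (hν : ∀ᵐ z ∂ν, z ∈ N) :
    ∀ᵐ z ∂μ, 0 < μ[density ν μ|m] z → z ∈ N := by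
  have h1 : ∀ᵐ z ∂μ, z ∈ Nᶜ → density ν μ z = 0 := by
    have h2 : ∀ᵐ z ∂μ, Nᶜ.indicator (density ν μ) z = 0 := by
      refine (integral_eq_zero_iff_of_nonneg (fun z => Set.indicator_nonneg
        (fun z _ => density_nonneg z) z) (integrable_density.indicator (hm _ hN.compl))).1 ?_
      have e : ∀ z, Nᶜ.indicator (density ν μ) z = density ν μ z * Nᶜ.indicator (fun _ => 1) z :=
        fun z => by by_cases hz : z ∈ N <;> simp [hz]
      simp only [e]
      rw [integral_density_mul h]
      refine integral_eq_zero_of_ae ?_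
      filter_upwards [hν] with z hz
      simp [hz]
    filter_upwards [h2] with z hz hzN
    simpa [Set.indicator_of_mem hzN] using hz
  have hNc : MeasurableSet[m] Nᶜ := hN.compl
  filter_upwards [ae_condExp_eq_zero_of_mem hm hNc h1] with z hz hpos
  by_contra hcon
  exact hpos.ne' (hz hcon)

end ChangeOfMeasure

/-! ### The flip weights as functions of the history -/

section Weights

variable {T d : ℕ} {a : Fin T → Bool} {s : Fin T → ℝ → ℝ} {C : ℝ} {P : Measure (Obs T d)}

lemma measurable_hist (t : Fin T) : Measurable (hist (d := d) t) :=
  (measurable_pi_lambda _ fun i => (measurable_pi_apply i.1).comp measurable_fst).prodMk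
    (measurable_fst.comp ((measurable_pi_apply t).comp measurable_fst))

lemma measurable_treat (t : Fin T) : Measurable (treat (d := d) t) :=
  measurable_snd.comp ((measurable_pi_apply t).comp measurable_fst)

lemma histSigma_le (t : Fin T) :
    histSigma T d t ≤ (inferInstance : MeasurableSpace (Obs T d)) :=
  (measurable_hist t).comap_le

lemma measurable_histSigma_treat {j t : Fin T} (h : j < t) :
    Measurable[histSigma T d t] (treat (d := d) j) := by
  have : treat (d := d) j = (fun x : Hist T d t => (x.1 ⟨j, h⟩).2) ∘ hist t := rfl
  rw [this]
  exact (measurable_snd.comp ((measurable_pi_apply _).comp measurable_fst)).comp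
    (comap_measurable (hist t))

lemma histSigma_mono {j t : Fin T} (h : j < t) : histSigma T d j ≤ histSigma T d t := by
  have e : hist (d := d) j = (fun x : Hist T d t =>
      ((fun i : Set.Iio j => x.1 ⟨i.1, lt_trans i.2 h⟩, (x.1 ⟨j, h⟩).1) : Hist T d j)) ∘ hist t :=
    rfl
  have hφ : Measurable fun x : Hist T d t =>
      ((fun i : Set.Iio j => x.1 ⟨i.1, lt_trans i.2 h⟩, (x.1 ⟨j, h⟩).1) : Hist T d j) :=
    (measurable_pi_lambda _ fun i => (measurable_pi_apply _).comp measurable_fst).prodMk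
      (measurable_fst.comp ((measurable_pi_apply _).comp measurable_fst))
  rw [histSigma, e, ← MeasurableSpace.comap_comp]
  exact MeasurableSpace.comap_mono hφ.comap_le

lemma prop_eq_armProp (P : Measure (Obs T d)) (t : Fin T) (b : Bool) :
    prop P t b = armProp (histSigma T d t) P (treat t) b := rfl

lemma condMean_eq_armMean (P : Measure (Obs T d)) (t : Fin T) (b : Bool) (W : Obs T d → ℝ) :
    condMean P t b W = armMean (histSigma T d t) P (treat t) b W := by
  have : (fun z => if treat t z = b then W z else 0) = fun z => armInd (treat t) b z * W z := by
    funext z; simp [armInd]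
  unfold condMean armMean
  rw [this]
  rfl

/-- The probability of assigning the target treatment, as a function of the propensity score. -/
noncomputable def flipProb (s : ℝ → ℝ) (x : ℝ) : ℝ := x + s x * (1 - x)

/-- The propensity score of the target treatment, in a version that takes values in `[0,1]`
everywhere; the weights are only controlled on this interval. -/
noncomputable def targetScore (a : Fin T → Bool) (P : Measure (Obs T d)) (t : Fin T)
    (z : Obs T d) : ℝ :=
  max 0 (min 1 (prop P t (a t) z))

/-- The propensity score of the arm `b` derived from `targetScore`. -/
noncomputable def armScore (a : Fin T → Bool) (P : Measure (Obs T d)) (t : Fin T)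
    (b : Bool) (z : Obs T d) : ℝ :=
  if b = a t then targetScore a P t z else 1 - targetScore a P t z

/-- The intervention propensity score of the arm `b` derived from `targetScore`. -/
noncomputable def armFlip (a : Fin T → Bool) (s : Fin T → ℝ → ℝ) (P : Measure (Obs T d))
    (t : Fin T) (b : Bool) (z : Obs T d) : ℝ :=
  if b = a t then flipProb (s t) (targetScore a P t z) else 1 - flipProb (s t) (targetScore a P t z)

/-- The ratio of the intervention propensity score and the propensity score of the arm `b`,
truncated at `C`. It is bounded and measurable with respect to the history everywhere, and it agrees
with the ratio almost surely in the model with bound `C`. -/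
noncomputable def flipWeight (a : Fin T → Bool) (s : Fin T → ℝ → ℝ) (C : ℝ)
    (P : Measure (Obs T d)) (t : Fin T) (b : Bool) (z : Obs T d) : ℝ :=
  max (-C) (min C (armFlip a s P t b z / armScore a P t b z))

/-- The product of the flip weights at the first `k` timepoints. -/
noncomputable def cumWeight (a : Fin T → Bool) (s : Fin T → ℝ → ℝ) (C : ℝ)
    (P : Measure (Obs T d)) (k : ℕ) (z : Obs T d) : ℝ :=
  ∏ j : Fin T with j.val < k, flipWeight a s C P j (treat j z) z

lemma targetScore_mem (t : Fin T) (z : Obs T d) : targetScore a P t z ∈ Set.Icc (0 : ℝ) 1 :=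
  ⟨le_max_left _ _, max_le zero_le_one (min_le_left _ _)⟩

lemma measurable_prop (t : Fin T) (b : Bool) : Measurable[histSigma T d t] (prop P t b) :=
  (stronglyMeasurable_armProp (A := treat t) b).measurable

lemma measurable_targetScore (t : Fin T) : Measurable[histSigma T d t] (targetScore a P t) :=
  Measurable.max measurable_const (Measurable.min measurable_const (measurable_prop t (a t)))

lemma measurable_armScore (t : Fin T) (b : Bool) :
    Measurable[histSigma T d t] (armScore a P t b) := by
  unfold armScore
  split_ifs
  · exact measurable_targetScore t
  · exact measurable_const.sub (measurable_targetScore t)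

lemma measurable_comp_of_continuousOn {Ω : Type*} {m : MeasurableSpace Ω} {f : ℝ → ℝ}
    (hf : ContinuousOn f (Set.Icc 0 1)) {x : Ω → ℝ} (hx : Measurable x)
    (hx01 : ∀ z, x z ∈ Set.Icc (0 : ℝ) 1) : Measurable fun z => f (x z) :=
  (continuousOn_iff_continuous_domRestrict.1 hf).measurable.comp (hx.subtype_mk (h := hx01))

lemma continuousOn_flipProb {s : ℝ → ℝ} (hs : IsSmoothWeight s) :
    ContinuousOn (flipProb s) (Set.Icc 0 1) :=
  continuousOn_id.add (hs.differentiableOn.continuousOn.mul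
    (continuousOn_const.sub continuousOn_id))

lemma measurable_armFlip (hs : ∀ t, IsSmoothWeight (s t)) (t : Fin T) (b : Bool) :
    Measurable[histSigma T d t] (armFlip a s P t b) := by
  have h := measurable_comp_of_continuousOn (continuousOn_flipProb (hs t))
    (measurable_targetScore (a := a) (P := P) t) (targetScore_mem t)
  unfold armFlip
  split_ifs
  · exact h
  · exact measurable_const.sub h

lemma measurable_flipWeight (hs : ∀ t, IsSmoothWeight (s t)) (t : Fin T) (b : Bool) :
    Measurable[histSigma T d t] (flipWeight a s C P t b) :=
  Measurable.max measurable_const (Measurable.min measurable_const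
    ((measurable_armFlip hs t b).div (measurable_armScore t b)))

lemma abs_flipWeight_le (hC : 0 ≤ C) (t : Fin T) (b : Bool) (z : Obs T d) :
    |flipWeight a s C P t b z| ≤ C :=
  abs_le.2 ⟨le_max_left _ _, max_le (by linarith) (min_le_left _ _)⟩

lemma measurable_cumWeight (hs : ∀ t, IsSmoothWeight (s t)) (t : Fin T) {k : ℕ} (hk : k ≤ t.val) :
    Measurable[histSigma T d t] (cumWeight a s C P k) := by
  unfold cumWeight
  refine Finset.measurable_prod _ fun j hj => ?_
  have hjt : j < t := Fin.lt_def.2 (lt_of_lt_of_le (Finset.mem_filter.1 hj).2 hk)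
  have hb : ∀ b, Measurable[histSigma T d t] (flipWeight a s C P j b) := fun b =>
    (measurable_flipWeight hs j b).mono (histSigma_mono hjt) le_rfl
  have e : (fun z => flipWeight a s C P j (treat j z) z) = fun z =>
      if treat j z = true then flipWeight a s C P j true z else flipWeight a s C P j false z := by
    funext z; cases treat j z <;> simp
  rw [e]
  exact Measurable.ite (measurable_histSigma_treat hjt (measurableSet_singleton true))
    (hb true) (hb false)

lemma measurable_flipWeight_treat (hs : ∀ t, IsSmoothWeight (s t)) (t : Fin T) :
    Measurable (fun z => flipWeight a s C P t (treat t z) z) := by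
  have hb : ∀ b, Measurable (flipWeight a s C P t b) := fun b =>
    (measurable_flipWeight hs t b).mono (histSigma_le t) le_rfl
  have e : (fun z => flipWeight a s C P t (treat t z) z) = fun z =>
      if treat t z = true then flipWeight a s C P t true z else flipWeight a s C P t false z := by
    funext z; cases treat t z <;> simp
  rw [e]
  exact Measurable.ite (measurable_treat t (measurableSet_singleton true)) (hb true) (hb false)

lemma measurable_cumWeight' (hs : ∀ t, IsSmoothWeight (s t)) (k : ℕ) :
    Measurable (cumWeight a s C P k : Obs T d → ℝ) :=
  Finset.measurable_prod _ fun j _ => measurable_flipWeight_treat hs j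

lemma abs_cumWeight_le (hC : 1 ≤ C) (k : ℕ) (z : Obs T d) : |cumWeight a s C P k z| ≤ C ^ T := by
  unfold cumWeight
  rw [Finset.abs_prod]
  calc _ ≤ ∏ j : Fin T with j.val < k, C :=
        Finset.prod_le_prod (fun _ _ => abs_nonneg _)
          fun j _ => abs_flipWeight_le (by linarith) _ _ _
    _ = C ^ (Finset.univ.filter fun j : Fin T => j.val < k).card := by rw [Finset.prod_const]
    _ ≤ C ^ T := by
        refine pow_le_pow_right₀ hC ((Finset.card_filter_le _ _).trans (by simp))

lemma cumWeight_zero (z : Obs T d) : cumWeight a s C P 0 z = 1 := by simp [cumWeight]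

lemma cumWeight_succ (t : Fin T) (z : Obs T d) :
    cumWeight a s C P (t + 1) z = cumWeight a s C P t z * flipWeight a s C P t (treat t z) z := by
  unfold cumWeight
  have : (Finset.univ.filter fun j : Fin T => j.val < t.val + 1) =
      insert t (Finset.univ.filter fun j : Fin T => j.val < t.val) := by
    ext j
    simp only [Finset.mem_filter, Finset.mem_univ, true_and, Finset.mem_insert, Fin.ext_iff]
    omega
  rw [this, Finset.prod_insert (by simp), mul_comm]

lemma InModel.mono {C' : ℝ} (h : InModel a s C P) (hC : C ≤ C') : InModel a s C' P :=
  ⟨h.isProb, h.memLp, h.variance_le.trans hC, fun t => (h.ratio_le t).mono fun _ hz => hz.trans hC,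
    h.identification⟩

section

variable [IsProbabilityMeasure P]

lemma ae_targetScore_eq (t : Fin T) : ∀ᵐ z ∂P, targetScore a P t z = prop P t (a t) z := by
  filter_upwards [ae_armProp_nonneg (m := histSigma T d t) (μ := P) (A := treat t) (a t),
    ae_armProp_le_one (μ := P) (histSigma_le t) (measurable_treat t) (a t)] with z h0 h1
  rw [targetScore, prop_eq_armProp, min_eq_right h1, max_eq_right h0]

lemma ae_armScore_eq (t : Fin T) (b : Bool) : ∀ᵐ z ∂P, armScore a P t b z = prop P t b z := by
  filter_upwards [ae_targetScore_eq (a := a) (P := P) t,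
    ae_armProp_not (μ := P) (histSigma_le t) (measurable_treat t) (a t)] with z h0 h1
  unfold armScore
  split_ifs with hb
  · rw [h0, hb]
  · rw [h0, show b = !(a t) by cases b <;> cases h : a t <;> simp_all, prop_eq_armProp,
      prop_eq_armProp, h1]

lemma ae_armFlip_eq (t : Fin T) (b : Bool) :
    ∀ᵐ z ∂P, armFlip a s P t b z = intProp a s P t b z := by
  filter_upwards [ae_targetScore_eq (a := a) (P := P) t] with z h0
  simp only [armFlip, intProp, h0, flipProb]

lemma ae_ratio_eq (t : Fin T) :
    ∀ᵐ z ∂P, ratio a s P t z = armFlip a s P t (treat t z) z / armScore a P t (treat t z) z := by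
  filter_upwards [ae_armFlip_eq (a := a) (s := s) (P := P) t true,
    ae_armFlip_eq (a := a) (s := s) (P := P) t false, ae_armScore_eq (a := a) (P := P) t true,
    ae_armScore_eq (a := a) (P := P) t false] with z h1 h2 h3 h4
  unfold ratio
  cases treat t z <;> simp only [h1, h2, h3, h4]

end

lemma clip_eq {x : ℝ} (h : |x| ≤ C) : max (-C) (min C x) = x := by
  rw [min_eq_right (abs_le.1 h).2, max_eq_right (abs_le.1 h).1]

/-- In the model the truncation is inactive wherever the arm has positive probability. -/
lemma InModel.ae_flipWeight_eq (h : InModel a s C P) (hs : ∀ t, IsSmoothWeight (s t)) (t : Fin T)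
    (b : Bool) : ∀ᵐ z ∂P, 0 < prop P t b z →
      flipWeight a s C P t b z = armFlip a s P t b z / armScore a P t b z := by
  have := h.isProb
  have hN : MeasurableSet[histSigma T d t]
      {z : Obs T d | C < |armFlip a s P t b z / armScore a P t b z|} :=
    measurableSet_lt measurable_const (measurable_abs.comp
      ((measurable_armFlip hs t b).div (measurable_armScore t b)))
  filter_upwards [ae_armProp_eq_zero_of_mem (μ := P) (A := treat t) (histSigma_le t) b hN (by
    filter_upwards [h.ratio_le t, ae_ratio_eq (a := a) (s := s) (P := P) t] with z h1 h2 hb hz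
    rw [h2, hb] at h1
    exact absurd h1 (not_le.2 hz))] with z hz hpos
  refine clip_eq (not_lt.1 fun hlt => ?_)
  exact hpos.ne' (hz hlt)

lemma InModel.ae_flipWeight_treat (h : InModel a s C P) (t : Fin T) :
    ∀ᵐ z ∂P, flipWeight a s C P t (treat t z) z = ratio a s P t z := by
  have := h.isProb
  filter_upwards [h.ratio_le t, ae_ratio_eq (a := a) (s := s) (P := P) t] with z h1 h2
  rw [flipWeight, ← h2, clip_eq h1]

/-- The intervention propensity score vanishes with the propensity score. For the target treatment
this is the identification condition, for the other treatment it is built into the intervention. -/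
lemma InModel.ae_flipWeight_mul_prop (h : InModel a s C P) (hs : ∀ t, IsSmoothWeight (s t))
    (t : Fin T) (b : Bool) :
    ∀ᵐ z ∂P, flipWeight a s C P t b z * prop P t b z = intProp a s P t b z := by
  have := h.isProb
  have hid : ∀ᵐ z ∂P, prop P t (a t) z = 0 → s t (prop P t (a t) z) = 0 := by
    rcases h.identification with h1 | h1
    · exact h1 t
    · have h2 : ∀ᵐ z ∂P, prop P t (a t) z ≠ 0 := by
        rw [ae_iff]; simpa using h1 t
      filter_upwards [h2] with z hz hz0
      exact absurd hz0 hz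
  filter_upwards [h.ae_flipWeight_eq hs t b, ae_armScore_eq (a := a) (P := P) t b,
    ae_armScore_eq (a := a) (P := P) t (a t),
    ae_armFlip_eq (a := a) (s := s) (P := P) t b, hid,
    ae_armProp_nonneg (m := histSigma T d t) (μ := P) (A := treat t) b] with z h1 h2 h2' h3 h4 h5
  rcases h5.lt_or_eq with hpos | hzero
  · rw [h1 hpos, h2, h3, div_mul_cancel₀]
    exact hpos.ne'
  · have hz : prop P t b z = 0 := hzero.symm
    rw [hz, mul_zero]
    unfold intProp
    by_cases hb : b = a t
    · rw [if_pos hb]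
      rw [hb] at hz
      have h6 := h4 hz
      rw [hz] at h6 ⊢
      rw [h6]; ring
    · rw [if_neg hb]
      have h7 : prop P t (a t) z = 1 := by
        rw [← h2']
        rw [hz] at h2
        simp only [armScore, if_neg hb, if_true] at h2 ⊢
        linarith
      rw [h7]; ring

end Weights

/-! ### The identified mean as a weighted mean of the outcome -/

section WeightedArms

variable {Ω : Type*} {m m0 : MeasurableSpace Ω} {μ : Measure Ω} [IsProbabilityMeasure μ]
  {A : Ω → Bool}

/-- The weight of the received arm may be integrated arm by arm, against the regressions. -/
lemma integral_arm_weight_mul (hm : m ≤ m0) (hA : Measurable A) {W g : Ω → ℝ}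
    (hW : MemLp W 2 μ) {ρ : Bool → Ω → ℝ} {K : ℝ} (hg : Measurable[m] g)
    (hgK : ∀ z, |g z| ≤ K) (hρ : ∀ b, Measurable[m] (ρ b)) (hρK : ∀ b z, |ρ b z| ≤ K) :
    ∫ z, g z * ρ (A z) z * W z ∂μ =
      ∑ b : Bool, ∫ z, g z * ρ b z * (armInd A b z * armMean m μ A b W z) ∂μ := by
  have hWi : Integrable W μ := hW.integrable (by norm_num)
  have hgρ : ∀ b, Measurable[m] fun z => g z * ρ b z := fun b => hg.mul (hρ b)
  have hgρK : ∀ b z, |g z * ρ b z| ≤ K * K := fun b z => by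
    have hK : 0 ≤ K := (abs_nonneg _).trans (hgK z)
    rw [abs_mul]
    gcongr
    · exact hgK z
    · exact hρK b z
  have hint : ∀ b, Integrable (fun z => g z * ρ b z * (armInd A b z * W z)) μ := fun b =>
    (integrable_armInd_mul hA b hWi).bdd_mul ((hgρ b).mono hm le_rfl).aestronglyMeasurable
      (Eventually.of_forall (hgρK b))
  calc _ = ∫ z, ∑ b : Bool, g z * ρ b z * (armInd A b z * W z) ∂μ := by
        refine integral_congr_ae (Eventually.of_forall fun z => ?_)
        simp only
        rw [← sum_armInd_mul A (fun b => g z * ρ b z * W z)]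
        exact Finset.sum_congr rfl fun b _ => by ring
    _ = ∑ b : Bool, ∫ z, g z * ρ b z * (armInd A b z * W z) ∂μ :=
        integral_finsetSum _ fun b _ => hint b
    _ = _ := Finset.sum_congr rfl fun b _ =>
        (integral_mul_armInd_mul_armMean hm hA b hW (hgρ b) (hgρK b)).symm

end WeightedArms

section IdentifiedMean

variable {T d : ℕ} {a : Fin T → Bool} {s : Fin T → ℝ → ℝ} {C : ℝ} {P : Measure (Obs T d)}

lemma pseudo_fin (t : Fin T) : pseudo a s P t.val =
    fun z => ∑ b : Bool, seqReg a s P t b z * intProp a s P t b z := by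
  rw [pseudo, dif_pos t.2]
  rfl

lemma pseudo_last : pseudo a s P T = outcome := by
  rw [pseudo, dif_neg (lt_irrefl T)]

lemma seqReg_eq_armMean (t : Fin T) (b : Bool) : seqReg a s P t b =
    armMean (histSigma T d t) P (treat t) b (pseudo a s P (t + 1)) := condMean_eq_armMean P t b _

lemma InModel.ae_pseudo_eq (h : InModel a s C P) (hs : ∀ t, IsSmoothWeight (s t)) (t : Fin T) :
    ∀ᵐ z ∂P, pseudo a s P t z = ∑ b : Bool, flipWeight a s C P t b z *
      (P[fun z => armInd (treat t) b z * pseudo a s P (t + 1) z | histSigma T d t]) z := by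
  have := h.isProb
  have h1 : ∀ᵐ z ∂P, ∀ b, flipWeight a s C P t b z * prop P t b z = intProp a s P t b z :=
    ae_all_iff.2 fun b => h.ae_flipWeight_mul_prop hs t b
  have h2 : ∀ᵐ z ∂P, ∀ b, prop P t b z * seqReg a s P t b z =
      (P[fun z => armInd (treat t) b z * pseudo a s P (t + 1) z | histSigma T d t]) z := by
    refine ae_all_iff.2 fun b => ?_
    rw [seqReg_eq_armMean]
    exact ae_armProp_mul_armMean (histSigma_le t) (measurable_treat t) b
  filter_upwards [h1, h2] with z z1 z2
  rw [pseudo_fin]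
  refine Finset.sum_congr rfl fun b _ => ?_
  rw [← z1, ← z2]
  ring

lemma InModel.memLp_pseudo_add (h : InModel a s C P) (hs : ∀ t, IsSmoothWeight (s t)) (hC : 0 ≤ C)
    (n k : ℕ) (hk : k + n = T) : MemLp (pseudo a s P k) 2 P := by
  have := h.isProb
  induction n generalizing k with
  | zero =>
    obtain rfl : k = T := by omega
    rw [pseudo_last]
    exact h.memLp
  | succ n ih =>
    have ih' := ih (k + 1) (by omega)
    set t : Fin T := ⟨k, by omega⟩
    have hmem : MemLp (fun z => ∑ b : Bool, flipWeight a s C P t b z *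
        (P[fun z => armInd (treat t) b z * pseudo a s P (t + 1) z | histSigma T d t]) z) 2 P := by
      refine memLp_finsetSum _ fun b _ => ?_
      have h1 : MemLp (fun z => armInd (treat t) b z * pseudo a s P (t + 1) z) 2 P :=
        MemLp.of_le ih' ((measurable_armInd (measurable_treat t) b).aestronglyMeasurable.mul ih'.1)
          (Eventually.of_forall fun z => by
            rw [norm_mul]
            exact mul_le_of_le_one_left (norm_nonneg _) (abs_armInd_le_one _ _ _))
      have h2 := h1.condExp (m := histSigma T d t) (by norm_num)
      refine MemLp.of_le_mul (c := C) h2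
        (((measurable_flipWeight hs t b).mono (histSigma_le t) le_rfl).aestronglyMeasurable.mul
          h2.1) (Eventually.of_forall fun z => ?_)
      rw [norm_mul]
      gcongr
      exact abs_flipWeight_le hC t b z
    refine (memLp_congr_ae ?_).2 hmem
    exact h.ae_pseudo_eq hs t

lemma InModel.memLp_pseudo (h : InModel a s C P) (hs : ∀ t, IsSmoothWeight (s t)) (hC : 0 ≤ C)
    {k : ℕ} (hk : k ≤ T) : MemLp (pseudo a s P k) 2 P :=
  h.memLp_pseudo_add hs hC (T - k) k (by omega)

/-- Against functions of the history, the pseudo-outcome at time `t` may be replaced by the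
pseudo-outcome at time `t + 1` weighted by the ratio at time `t`. -/
lemma InModel.integral_mul_pseudo (h : InModel a s C P) (hs : ∀ t, IsSmoothWeight (s t))
    (hC : 0 ≤ C) (t : Fin T) {g : Obs T d → ℝ} {K : ℝ} (hg : Measurable[histSigma T d t] g)
    (hgK : ∀ z, |g z| ≤ K) :
    ∫ z, g z * pseudo a s P t z ∂P = ∑ b : Bool, ∫ z, g z * flipWeight a s C P t b z *
      (armInd (treat t) b z * seqReg a s P t b z) ∂P := by
  have := h.isProb
  have hW := h.memLp_pseudo hs hC (k := t.val + 1) t.2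
  have hWi : Integrable (pseudo a s P (t + 1)) P := hW.integrable (by norm_num)
  have hgρ : ∀ b, Measurable[histSigma T d t] fun z => g z * flipWeight a s C P t b z := fun b =>
    hg.mul (measurable_flipWeight hs t b)
  have hgρK : ∀ b z, |g z * flipWeight a s C P t b z| ≤ K * C := fun b z => by
    have hK : 0 ≤ K := (abs_nonneg _).trans (hgK z)
    rw [abs_mul]
    gcongr
    · exact hgK z
    · exact abs_flipWeight_le hC t b z
  have hint : ∀ b, Integrable (fun z => g z * flipWeight a s C P t b z *
      (armInd (treat t) b z * pseudo a s P (t + 1) z)) P := fun b =>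
    (integrable_armInd_mul (measurable_treat t) b hWi).bdd_mul
      ((hgρ b).mono (histSigma_le t) le_rfl).aestronglyMeasurable (Eventually.of_forall (hgρK b))
  have hJW := fun b => integrable_armInd_mul (measurable_treat (d := d) t) b hWi
  calc _ = ∫ z, ∑ b : Bool, g z * flipWeight a s C P t b z *
        (P[fun z => armInd (treat t) b z * pseudo a s P (t + 1) z | histSigma T d t]) z ∂P := by
        refine integral_congr_ae ?_
        filter_upwards [h.ae_pseudo_eq hs t] with z hz
        rw [hz, Finset.mul_sum]
        exact Finset.sum_congr rfl fun b _ => by ring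
    _ = ∑ b : Bool, ∫ z, g z * flipWeight a s C P t b z *
        (P[fun z => armInd (treat t) b z * pseudo a s P (t + 1) z | histSigma T d t]) z ∂P :=
        integral_finsetSum _ fun b _ => integrable_mul_condExp
          (hgρ b).stronglyMeasurable.aestronglyMeasurable (hJW b) (hint b)
    _ = _ := by
        refine Finset.sum_congr rfl fun b _ => ?_
        rw [integral_mul_condExp (histSigma_le t) (hgρ b).stronglyMeasurable.aestronglyMeasurable
          (hJW b) (hint b), seqReg_eq_armMean]
        exact (integral_mul_armInd_mul_armMean (histSigma_le t) (measurable_treat t) b hW (hgρ b)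
          (hgρK b)).symm

/-- One step of the telescoping sum that compares the weights of two laws `P` and `Q` under `P`. -/
lemma InModel.integral_cumWeight_succ_sub (h : InModel a s C P) (hs : ∀ t, IsSmoothWeight (s t))
    (hC : 1 ≤ C) (Q : Measure (Obs T d)) (t : Fin T) :
    ∫ z, cumWeight a s C Q (t + 1) z * pseudo a s P (t + 1) z ∂P -
        ∫ z, cumWeight a s C Q t z * pseudo a s P t z ∂P =
      ∑ b : Bool, ∫ z, cumWeight a s C Q t z *
        (flipWeight a s C Q t b z - flipWeight a s C P t b z) *
          (armInd (treat t) b z * seqReg a s P t b z) ∂P := by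
  have := h.isProb
  have hC0 : 0 ≤ C := by linarith
  have hW := h.memLp_pseudo hs hC0 (k := t.val + 1) t.2
  set K := max (C ^ T) C with hK
  have hR := measurable_cumWeight (C := C) (a := a) (P := Q) hs t le_rfl
  have hRK : ∀ z, |cumWeight a s C Q t z| ≤ K := fun z =>
    (abs_cumWeight_le hC _ z).trans (le_max_left _ _)
  have hwK : ∀ (P' : Measure (Obs T d)) b z, |flipWeight a s C P' t b z| ≤ K := fun P' b z =>
    (abs_flipWeight_le hC0 t b z).trans (le_max_right _ _)
  have hJM : ∀ b, Integrable (fun z => armInd (treat t) b z * seqReg a s P t b z) P := fun b => by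
    rw [seqReg_eq_armMean]
    exact (memLp_armInd_mul_armMean (histSigma_le t) (measurable_treat t) b hW).integrable
      (by norm_num)
  have hint : ∀ (P' : Measure (Obs T d)) b, Integrable (fun z => cumWeight a s C Q t z *
      flipWeight a s C P' t b z * (armInd (treat t) b z * seqReg a s P t b z)) P := fun P' b =>
    (hJM b).bdd_mul (c := K * K)
      ((hR.mul (measurable_flipWeight hs t b)).mono (histSigma_le t) le_rfl).aestronglyMeasurable
      (Eventually.of_forall fun z => by
        rw [Real.norm_eq_abs, abs_mul]
        have hK0 : 0 ≤ K := (abs_nonneg _).trans (hRK z)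
        gcongr
        · exact hRK z
        · exact hwK P' b z)
  have e1 := integral_arm_weight_mul (histSigma_le t) (measurable_treat t) hW hR hRK
    (fun b => measurable_flipWeight (C := C) (a := a) (P := Q) hs t b) (hwK Q)
  simp only [cumWeight_succ]
  rw [h.integral_mul_pseudo hs hC0 t hR hRK, e1, ← Finset.sum_sub_distrib]
  refine Finset.sum_congr rfl fun b _ => ?_
  rw [← seqReg_eq_armMean, ← integral_sub (hint Q b) (hint P b)]
  exact integral_congr_ae (Eventually.of_forall fun z => by simp only; ring)

/-- The effect under `P` of using the weights of a second law `Q` is a sum of contributions of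
single times and arms. -/
lemma InModel.integral_cumWeight_mul_outcome_sub (h : InModel a s C P)
    (hs : ∀ t, IsSmoothWeight (s t)) (hC : 1 ≤ C) (Q : Measure (Obs T d)) :
    ∫ z, cumWeight a s C Q T z * outcome z ∂P - identifiedMean a s P =
      ∑ t : Fin T, ∑ b : Bool, ∫ z, cumWeight a s C Q t z *
        (flipWeight a s C Q t b z - flipWeight a s C P t b z) *
          (armInd (treat t) b z * seqReg a s P t b z) ∂P := by
  rw [← Finset.sum_congr rfl fun t _ => h.integral_cumWeight_succ_sub hs hC Q t,
    Fin.sum_univ_eq_sum_range (fun k => ∫ z, cumWeight a s C Q (k + 1) z *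
      pseudo a s P (k + 1) z ∂P - ∫ z, cumWeight a s C Q k z * pseudo a s P k z ∂P) T,
    Finset.sum_range_sub (fun k => ∫ z, cumWeight a s C Q k z * pseudo a s P k z ∂P)]
  simp [cumWeight_zero, identifiedMean, pseudo_last]

/-- The identified mean is the mean of the outcome weighted by the ratios. -/
lemma InModel.identifiedMean_eq (h : InModel a s C P) (hs : ∀ t, IsSmoothWeight (s t))
    (hC : 1 ≤ C) : identifiedMean a s P = ∫ z, cumWeight a s C P T z * outcome z ∂P := by
  have := h.integral_cumWeight_mul_outcome_sub hs hC P
  simp only [sub_self, mul_zero, zero_mul, integral_zero, Finset.sum_const_zero] at this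
  linarith

end IdentifiedMean

/-! ### The intervention propensity score as a function of the propensity score -/

section FlipProb

/-- The derivative of `flipProb`. -/
noncomputable def flipDeriv (s : ℝ → ℝ) (x : ℝ) : ℝ :=
  1 - s x + derivWithin s (Set.Icc 0 1) x * (1 - x)

/-- The difference quotient of `flipProb`, continued by the derivative. -/
noncomputable def flipSlope (s : ℝ → ℝ) (x y : ℝ) : ℝ :=
  if y = x then flipDeriv s x else (flipProb s y - flipProb s x) / (y - x)

variable {s : ℝ → ℝ}

lemma flipSlope_mul_sub (x y : ℝ) :
    flipSlope s x y * (y - x) = flipProb s y - flipProb s x := by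
  unfold flipSlope
  split_ifs with h
  · simp [h]
  · rw [div_mul_cancel₀ _ (sub_ne_zero.2 h)]

lemma IsSmoothWeight.hasDerivWithinAt_flipProb (hs : IsSmoothWeight s) {x : ℝ}
    (hx : x ∈ Set.Icc (0 : ℝ) 1) :
    HasDerivWithinAt (flipProb s) (flipDeriv s x) (Set.Icc 0 1) x := by
  have h1 := (hs.differentiableOn x hx).hasDerivWithinAt
  have h2 := (hasDerivWithinAt_id x (Set.Icc (0 : ℝ) 1)).add
    (h1.mul ((hasDerivWithinAt_const x _ (1 : ℝ)).sub (hasDerivWithinAt_id x _)))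
  refine h2.congr_deriv ?_
  simp [flipDeriv]
  ring

lemma IsSmoothWeight.exists_abs_flipDeriv_le (hs : IsSmoothWeight s) :
    ∃ K : ℝ, 0 ≤ K ∧ ∀ x ∈ Set.Icc (0 : ℝ) 1, |flipDeriv s x| ≤ K := by
  obtain ⟨K, hK⟩ := hs.bounded
  have hK0 : 0 ≤ K := (abs_nonneg _).trans (hK 0 (by simp)).1
  refine ⟨1 + K, by linarith, fun x hx => ?_⟩
  have h1 := hs.mapsTo hx
  have h2 : |1 - s x| ≤ 1 := abs_le.2 ⟨by linarith [h1.2], by linarith [h1.1]⟩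
  have h3 : |derivWithin s (Set.Icc 0 1) x * (1 - x)| ≤ K * 1 := by
    rw [abs_mul]
    exact mul_le_mul (hK x hx).1 (abs_le.2 ⟨by linarith [hx.2], by linarith [hx.1]⟩)
      (abs_nonneg _) hK0
  unfold flipDeriv
  exact (abs_add_le _ _).trans (by linarith)

lemma IsSmoothWeight.exists_abs_flipSlope_le (hs : IsSmoothWeight s) :
    ∃ K : ℝ, 0 ≤ K ∧ ∀ x ∈ Set.Icc (0 : ℝ) 1, ∀ y ∈ Set.Icc (0 : ℝ) 1, |flipSlope s x y| ≤ K := by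
  obtain ⟨K, hK0, hK⟩ := hs.exists_abs_flipDeriv_le
  refine ⟨K, hK0, fun x hx y hy => ?_⟩
  unfold flipSlope
  split_ifs with h
  · exact hK x hx
  · have h1 := (convex_Icc (0 : ℝ) 1).norm_image_sub_le_of_norm_hasDerivWithin_le
      (fun z hz => hs.hasDerivWithinAt_flipProb hz) (fun z hz => hK z hz) hx hy
    rw [abs_div, div_le_iff₀ (abs_pos.2 (sub_ne_zero.2 h))]
    exact h1

lemma IsSmoothWeight.tendsto_flipSlope (hs : IsSmoothWeight s) {x : ℝ}
    (hx : x ∈ Set.Icc (0 : ℝ) 1) {y : ℕ → ℝ} (hy : ∀ n, y n ∈ Set.Icc (0 : ℝ) 1)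
    (hlim : Tendsto y atTop (𝓝 x)) :
    Tendsto (fun n => flipSlope s x (y n)) atTop (𝓝 (flipDeriv s x)) := by
  have h1 : Tendsto (flipSlope s x) (𝓝[Set.Icc 0 1] x) (𝓝 (flipDeriv s x)) := by
    have h2 := hasDerivWithinAt_iff_tendsto_slope.1 (hs.hasDerivWithinAt_flipProb hx)
    rw [← Set.insert_sdiff_self_of_mem hx, nhdsWithin_insert]
    refine Tendsto.sup ?_ (h2.congr' ?_)
    · rw [tendsto_pure_left]
      intro U hU
      simpa [flipSlope] using mem_of_mem_nhds hU
    · filter_upwards [self_mem_nhdsWithin] with z hz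
      have : z ≠ x := fun h => hz.2 h
      rw [flipSlope, if_neg this, slope_def_field]
  exact h1.comp (tendsto_nhdsWithin_iff.2 ⟨hlim, Eventually.of_forall hy⟩)

lemma IsSmoothWeight.continuousOn_flipDeriv (hs : IsSmoothWeight s) :
    ContinuousOn (flipDeriv s) (Set.Icc 0 1) :=
  (continuousOn_const.sub hs.differentiableOn.continuousOn).add
    (hs.differentiableOn_deriv.continuousOn.mul (continuousOn_const.sub continuousOn_id))

lemma IsSmoothWeight.measurable_flipSlope (hs : IsSmoothWeight s) {Ω : Type*}
    {m : MeasurableSpace Ω} {x y : Ω → ℝ} (hx : Measurable x) (hy : Measurable y)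
    (hx01 : ∀ z, x z ∈ Set.Icc (0 : ℝ) 1) (hy01 : ∀ z, y z ∈ Set.Icc (0 : ℝ) 1) :
    Measurable fun z => flipSlope s (x z) (y z) :=
  Measurable.ite (measurableSet_eq_fun hy hx)
    (measurable_comp_of_continuousOn hs.continuousOn_flipDeriv hx hx01)
    (((measurable_comp_of_continuousOn (continuousOn_flipProb hs) hy hy01).sub
      (measurable_comp_of_continuousOn (continuousOn_flipProb hs) hx hx01)).div (hy.sub hx))

end FlipProb

/-! ### Derivative of the identified mean along a sequence of laws -/

section Derivative

variable {T d : ℕ} {a : Fin T → Bool} {s : Fin T → ℝ → ℝ} {C : ℝ} {P : Measure (Obs T d)}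
  {Q : ℕ → Measure (Obs T d)} {ε : ℕ → ℝ} {S : Obs T d → ℝ}

/-- The contribution of time `t` and arm `b` to the influence function: the response of the
intervention propensity score and of the denominator of the ratio to a change of the propensity
score. -/
noncomputable def gradTerm (a : Fin T → Bool) (s : Fin T → ℝ → ℝ) (C : ℝ) (P : Measure (Obs T d))
    (t : Fin T) (b : Bool) (z : Obs T d) : ℝ :=
  cumWeight a s C P t z * ((flipDeriv (s t) (targetScore a P t z) - flipWeight a s C P t b z) *
    (seqReg a s P t b z * (armInd (treat t) b z - prop P t b z)))

lemma armFlip_sub_armFlip (P' : Measure (Obs T d)) (t : Fin T) (b : Bool) (z : Obs T d) :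
    armFlip a s P' t b z - armFlip a s P t b z =
      flipSlope (s t) (targetScore a P t z) (targetScore a P' t z) *
        (armScore a P' t b z - armScore a P t b z) := by
  have h := flipSlope_mul_sub (s := s t) (targetScore a P t z) (targetScore a P' t z)
  unfold armFlip armScore
  split_ifs
  · exact h.symm
  · linear_combination h

section

variable [IsProbabilityMeasure P] (hQ : ∀ n, IsProbabilityMeasure (Q n)) (hQP : ∀ n, Q n ≪ P)
  (h : IsQMDSequence P ε (fun n => density (Q n) P) S)

include hQ hQP h

lemma ae_tendsto_prop (t : Fin T) (b : Bool) :
    ∀ᵐ z ∂P, Tendsto (fun n => prop (Q n) t b z) atTop (𝓝 (prop P t b z)) := by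
  have h1 : ∀ᵐ z ∂P, ∀ n, prop (Q n) t b z * P[density (Q n) P|histSigma T d t] z =
      P[fun z => armInd (treat t) b z * density (Q n) P z|histSigma T d t] z :=
    ae_all_iff.2 fun n =>
      ae_armProp_mul_condExp_density (histSigma_le t) (measurable_treat t) b (hQP n)
  filter_upwards [h1, h.ae_tendsto_condExp (histSigma_le t),
    h.ae_tendsto_condExp_armInd (m := histSigma T d t) (measurable_treat t) b] with z z1 z2 z3
  have z4 := z3.div z2 one_ne_zero
  rw [div_one] at z4
  refine z4.congr' ?_
  filter_upwards [z2.eventually (lt_mem_nhds one_pos)] with n hn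
  simp only [Pi.div_apply]
  rw [← z1, mul_div_cancel_right₀ _ hn.ne']

lemma ae_tendsto_targetScore (t : Fin T) :
    ∀ᵐ z ∂P, Tendsto (fun n => targetScore a (Q n) t z) atTop (𝓝 (targetScore a P t z)) := by
  filter_upwards [ae_tendsto_prop hQ hQP h t (a t)] with z hz
  exact tendsto_const_nhds.max (tendsto_const_nhds.min hz)

lemma ae_tendsto_flipWeight (hs : ∀ t, IsSmoothWeight (s t)) (t : Fin T) (b : Bool) :
    ∀ᵐ z ∂P, 0 < prop P t b z → Tendsto (fun n => flipWeight a s C (Q n) t b z) atTop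
      (𝓝 (flipWeight a s C P t b z)) := by
  filter_upwards [ae_tendsto_targetScore (a := a) hQ hQP h t, ae_armScore_eq (a := a) (P := P) t b]
    with z hz hz2 hpos
  rw [← hz2] at hpos
  have h1 : Tendsto (fun n => flipProb (s t) (targetScore a (Q n) t z)) atTop
      (𝓝 (flipProb (s t) (targetScore a P t z))) :=
    (continuousOn_flipProb (hs t) _ (targetScore_mem t z)).tendsto.comp
      (tendsto_nhdsWithin_iff.2 ⟨hz, Eventually.of_forall fun n => targetScore_mem t z⟩)
  have h2 : Tendsto (fun n => armFlip a s (Q n) t b z) atTop (𝓝 (armFlip a s P t b z)) := by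
    unfold armFlip
    split_ifs
    · exact h1
    · exact h1.const_sub 1
  have h3 : Tendsto (fun n => armScore a (Q n) t b z) atTop (𝓝 (armScore a P t b z)) := by
    unfold armScore
    split_ifs
    · exact hz
    · exact hz.const_sub 1
  exact tendsto_const_nhds.max (tendsto_const_nhds.min (h2.div h3 hpos.ne'))

lemma ae_tendsto_cumWeight (hs : ∀ t, IsSmoothWeight (s t)) (k : ℕ) :
    ∀ᵐ z ∂P, Tendsto (fun n => cumWeight a s C (Q n) k z) atTop (𝓝 (cumWeight a s C P k z)) := by
  have h1 : ∀ᵐ z ∂P, ∀ t : Fin T, ∀ b, 0 < prop P t b z → Tendsto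
      (fun n => flipWeight a s C (Q n) t b z) atTop (𝓝 (flipWeight a s C P t b z)) :=
    ae_all_iff.2 fun t => ae_all_iff.2 fun b => ae_tendsto_flipWeight hQ hQP h hs t b
  have h2 : ∀ᵐ z ∂P, ∀ t : Fin T, ∀ b, treat t z = b → 0 < prop P t b z :=
    ae_all_iff.2 fun t => ae_all_iff.2 fun b =>
      ae_armProp_pos (histSigma_le t) (measurable_treat t) b
  filter_upwards [h1, h2] with z z1 z2
  exact tendsto_finsetProd _ fun j _ => z1 j _ (z2 j _ rfl)

end

/-- The change of the weights at time `t` and arm `b` contributes `gradTerm` to the derivative. -/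
lemma tendsto_gradTerm (hs : ∀ t, IsSmoothWeight (s t)) (hP : InModel a s C P) (hC : 1 ≤ C)
    (hQ : ∀ n, InModel a s C (Q n)) (hQP : ∀ n, Q n ≪ P)
    (h : IsQMDSequence P ε (fun n => density (Q n) P) S) (t : Fin T) (b : Bool) :
    MemLp (gradTerm a s C P t b) 2 P ∧
      Tendsto (fun n => (∫ z, cumWeight a s C (Q n) t z *
        (flipWeight a s C (Q n) t b z - flipWeight a s C P t b z) *
          (armInd (treat t) b z * seqReg a s P t b z) ∂P) / ε n) atTop
        (𝓝 (∫ z, gradTerm a s C P t b z * S z ∂P)) := by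
  have := hP.isProb
  have hQ' := fun n => (hQ n).isProb
  have hC0 : 0 ≤ C := by linarith
  obtain ⟨K1, hK10, hK1⟩ := (hs t).exists_abs_flipSlope_le
  set K := max (max (C ^ T) C) K1
  have hx := fun P' : Measure (Obs T d) => measurable_targetScore (a := a) (P := P') t
  have hWP := hP.memLp_pseudo hs hC0 (k := t.val + 1) t.2
  have key := tendsto_arm_derivative (μ := P) (A := treat t) (b := b) (K := K) (S := S)
    (W := pseudo a s P (t + 1))
    (R := fun n => cumWeight a s C (Q n) t) (R' := cumWeight a s C P t)
    (ρ := fun n => flipWeight a s C (Q n) t b) (ρ' := flipWeight a s C P t b)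
    (Δ := fun n z => flipSlope (s t) (targetScore a P t z) (targetScore a (Q n) t z))
    (L := fun z => flipDeriv (s t) (targetScore a P t z))
    (histSigma_le t) (measurable_treat t) hWP h (hK10.trans (le_max_right _ _))
    (fun n => measurable_cumWeight hs t le_rfl)
    (fun n z => (abs_cumWeight_le hC _ z).trans ((le_max_left _ _).trans (le_max_left _ _)))
    (ae_tendsto_cumWeight hQ' hQP h hs t)
    (fun n => measurable_flipWeight hs t b)
    (fun n z => (abs_flipWeight_le hC0 t b z).trans ((le_max_right _ _).trans (le_max_left _ _)))
    (measurable_flipWeight hs t b)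
    (fun z => (abs_flipWeight_le hC0 t b z).trans ((le_max_right _ _).trans (le_max_left _ _)))
    (ae_tendsto_flipWeight hQ' hQP h hs t b)
    (fun n => (hs t).measurable_flipSlope (hx P) (hx (Q n)) (targetScore_mem t) (targetScore_mem t))
    (fun n z => (hK1 _ (targetScore_mem t z) _ (targetScore_mem t z)).trans (le_max_right _ _))
    (by
      filter_upwards [ae_tendsto_targetScore (a := a) hQ' hQP h t] with z hz
      exact (hs t).tendsto_flipSlope (targetScore_mem t z) (fun n => targetScore_mem t z) hz)
    (fun n => by
      have := hQ' n
      set N : Set (Obs T d) := {z | armScore a (Q n) t b z = prop (Q n) t b z} ∩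
        ({z | prop (Q n) t b z ≤ 0} ∪ {z | flipWeight a s C (Q n) t b z =
          armFlip a s (Q n) t b z / armScore a (Q n) t b z}) with hN
      have mN : MeasurableSet[histSigma T d t] N :=
        (measurableSet_eq_fun (measurable_armScore t b) (measurable_prop t b)).inter
          ((measurableSet_le (measurable_prop t b) measurable_const).union
            (measurableSet_eq_fun (measurable_flipWeight hs t b)
              ((measurable_armFlip hs t b).div (measurable_armScore t b))))
      have hNae : ∀ᵐ z ∂(Q n), z ∈ N := by
        filter_upwards [ae_armScore_eq (a := a) (P := Q n) t b, (hQ n).ae_flipWeight_eq hs t b]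
          with z z1 z2
        exact ⟨z1, (le_or_gt (prop (Q n) t b z) 0).imp id z2⟩
      filter_upwards [ae_of_ae_of_condExp_density (histSigma_le t) (hQP n) mN hNae,
        ae_armProp_mul_condExp_density (histSigma_le t) (measurable_treat t) b (hQP n),
        ae_armScore_eq (a := a) (P := P) t b, hP.ae_flipWeight_eq hs t b]
        with z z1 z2 z3 z4 hπ hq hk
      obtain ⟨z5, z6⟩ := z1 hk
      have z5' : armScore a (Q n) t b z = prop (Q n) t b z := z5
      rw [← prop_eq_armProp] at hπ z2 ⊢
      rw [← z2] at hq ⊢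
      have hpos : 0 < prop (Q n) t b z := (mul_pos_iff_of_pos_right hk).1 hq
      have z7 : flipWeight a s C (Q n) t b z =
          armFlip a s (Q n) t b z / armScore a (Q n) t b z :=
        z6.resolve_left (not_le.2 hpos)
      have e := armFlip_sub_armFlip (a := a) (s := s) (P := P) (Q n) t b z
      rw [mul_div_cancel_right₀ _ hk.ne', z7, z4 hπ, sub_mul, ← z5', ← z3, ← e]
      rw [← z5'] at hpos
      rw [← z3] at hπ
      have := hpos.ne'
      have := hπ.ne'
      field_simp
      ring)
  simp only [← seqReg_eq_armMean, ← prop_eq_armProp] at key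
  exact key

end Derivative

/-! ### Pathwise differentiability -/

section SecondMoments

variable {Ω : Type*} {m0 : MeasurableSpace Ω} {μ : Measure Ω} [IsProbabilityMeasure μ]
  {ν : ℕ → Measure Ω} {ε : ℕ → ℝ} {S : Ω → ℝ}

/-- A score has mean zero: `(p n - 1) / ε n`, of mean zero, is the product of `√(p n) + 1` and the
difference quotient of `√(p n)`. -/
lemma IsQMDSequence.integral_score_eq_zero {p : ℕ → Ω → ℝ} (h : IsQMDSequence μ ε p S) :
    ∫ z, S z ∂μ = 0 := by
  have hs := fun n => memLp_sqrt (h.nonneg n) (h.integrable n)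
  have hw2 : ∀ n, ∫ z, (√(p n z) + 1) ^ 2 ∂μ ≤ 4 := fun n => by
    have := integral_sub_sq_le (g := fun _ => (-1 : ℝ)) (hs n) (memLp_const (-1))
    simp only [sub_neg_eq_add, Real.sq_sqrt (h.nonneg n _), h.integral_eq_one n] at this
    refine this.trans (by simp; norm_num)
  have h1 := tendsto_integral_mul_of_tendsto_ae_of_tendsto (w := fun n z => √(p n z) + 1)
    (w' := fun _ => 2) (fun n => (hs n).add (memLp_const 1)) hw2 (by
      filter_upwards [h.ae_tendsto] with z hz
      have := hz.sqrt.add_const 1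
      rw [Real.sqrt_one] at this
      norm_num at this
      exact this) h.memLp_quot h.memLp_half h.tendsto
  have h2 : ∀ n, ∫ z, (√(p n z) + 1) * ((√(p n z) - 1) / ε n) ∂μ = 0 := fun n => by
    have : ∀ z, (√(p n z) + 1) * ((√(p n z) - 1) / ε n) = (p n z - 1) / ε n := fun z => by
      rw [mul_div_assoc']
      congr 1
      linear_combination Real.sq_sqrt (h.nonneg n z)
    simp only [this]
    rw [integral_div, integral_sub (h.integrable n) (integrable_const 1), h.integral_eq_one n]
    simp
  simp only [h2] at h1
  have h3 := tendsto_nhds_unique h1 tendsto_const_nhds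
  simpa [mul_div_cancel₀] using h3

/-- Along a sequence of laws that converges in total variation, bounded variances force bounded
second moments: a bounded region keeps at least half of the mass, so that the means cannot
escape. -/
lemma exists_integral_sq_le (hν : ∀ n, IsProbabilityMeasure (ν n)) (hνμ : ∀ n, ν n ≪ μ)
    (h : IsQMDSequence μ ε (fun n => density (ν n) μ) S) {Y : Ω → ℝ} (hY : Measurable Y)
    (hYμ : MemLp Y 2 μ) (hYν : ∀ n, MemLp Y 2 (ν n)) {C : ℝ} (hC : ∀ n, Var[Y; ν n] ≤ C) :
    ∃ B : ℝ, ∀ n, ∫ z, Y z ^ 2 ∂(ν n) ≤ B := by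
  set N : ℝ := 4 * (∫ z, Y z ^ 2 ∂μ + 1) with hNdef
  have hE : 0 ≤ ∫ z, Y z ^ 2 ∂μ := integral_nonneg fun z => sq_nonneg _
  have hN : 0 < N := by positivity
  set B : Set Ω := {z | Y z ^ 2 < N} with hB
  have mB : MeasurableSet B := measurableSet_lt (hY.pow_const 2) measurable_const
  have hBμ : 3 / 4 ≤ μ.real B := by
    have h1 := mul_meas_ge_le_integral_of_nonneg (μ := μ) (f := fun z => Y z ^ 2)
      (Eventually.of_forall fun z => sq_nonneg _) hYμ.integrable_sq N
    have h2 : {z | N ≤ Y z ^ 2} = Bᶜ := by ext z; simp [hB]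
    rw [h2, measureReal_compl mB] at h1
    simp only [probReal_univ] at h1
    by_contra hlt
    push Not at hlt
    nlinarith
  have hev : ∀ᶠ n in atTop, ∫ z, Y z ^ 2 ∂(ν n) ≤ 5 * C + 2 * N := by
    filter_upwards [h.summable_integral_abs.tendsto_atTop_zero.eventually
      (gt_mem_nhds (show (0 : ℝ) < 1 / 4 by norm_num))] with n hn
    have := hν n
    have hp := integrable_density (ν := ν n) (μ := μ)
    have h1 : ∫ z in B, density (ν n) μ z ∂μ = (ν n).real B := by
      rw [← integral_indicator mB]
      have e : ∀ z, B.indicator (density (ν n) μ) z =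
          density (ν n) μ z * B.indicator (fun _ => 1) z := fun z => by
        by_cases hz : z ∈ B <;> simp [hz]
      simp only [e]
      rw [integral_density_mul (hνμ n), integral_indicator_const _ mB]
      simp
    have h2 : |∫ z in B, (density (ν n) μ z - 1) ∂μ| ≤ ∫ z, |density (ν n) μ z - 1| ∂μ :=
      (abs_integral_le_integral_abs).trans (setIntegral_le_integral
        (hp.sub (integrable_const 1)).abs (Eventually.of_forall fun z => abs_nonneg _))
    rw [integral_sub hp.integrableOn (integrable_const 1), h1] at h2
    simp only [integral_const, smul_eq_mul, mul_one, measureReal_restrict_apply_univ] at h2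
    have h3 : 1 / 2 ≤ (ν n).real B := by linarith [(abs_le.1 h2).1]
    set M := (ν n)[Y] with hM
    have hv := variance_eq_integral (μ := ν n) hY.aemeasurable
    have hsq : MemLp (fun z => Y z - M) 2 (ν n) := (hYν n).sub (memLp_const M)
    have h4 : ∫ z in B, (M ^ 2 / 2 - N) ∂(ν n) ≤ ∫ z in B, (Y z - M) ^ 2 ∂(ν n) := by
      refine setIntegral_mono_on (integrable_const _).integrableOn hsq.integrable_sq.integrableOn
        mB fun z hz => ?_
      have hz' : Y z ^ 2 < N := hz
      nlinarith [sq_nonneg (2 * Y z - M)]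
    have h5 : ∫ z in B, (Y z - M) ^ 2 ∂(ν n) ≤ C := by
      refine (setIntegral_le_integral hsq.integrable_sq
        (Eventually.of_forall fun z => sq_nonneg _)).trans ?_
      rw [hM, ← hv]
      exact hC n
    simp only [integral_const, smul_eq_mul, measureReal_restrict_apply_univ] at h4
    have h6 := variance_eq_sub (hYν n)
    have h7 : ∫ z, Y z ^ 2 ∂(ν n) = Var[Y; ν n] + M ^ 2 := by
      rw [h6]; simp [hM]
    have hC0 : 0 ≤ C := (variance_nonneg Y (ν n)).trans (hC n)
    rw [h7]
    have h8 : M ^ 2 ≤ 4 * C + 2 * N := by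
      by_contra hlt
      push Not at hlt
      nlinarith
    linarith [hC n]
  obtain ⟨B', hB'⟩ := (show IsBoundedUnder (· ≤ ·) atTop fun n => ∫ z, Y z ^ 2 ∂(ν n) from
    ⟨_, hev⟩).bddAbove_range
  exact ⟨B', fun n => hB' (Set.mem_range_self n)⟩

/-- The derivative of `∫ R Y` along a sequence of laws with bounded second moments of `Y`, when
the integrand `R` is held fixed in the limit. -/
lemma tendsto_integral_density_sub_one_mul (hν : ∀ n, IsProbabilityMeasure (ν n))
    (hνμ : ∀ n, ν n ≪ μ) (h : IsQMDSequence μ ε (fun n => density (ν n) μ) S) {Y : Ω → ℝ}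
    (hY : Measurable Y) (hYμ : MemLp Y 2 μ) (hYν : ∀ n, MemLp Y 2 (ν n)) {C : ℝ}
    (hC : ∀ n, Var[Y; ν n] ≤ C) {R : ℕ → Ω → ℝ} {R' : Ω → ℝ} {K : ℝ} (hR : ∀ n, Measurable (R n))
    (hRK : ∀ n z, |R n z| ≤ K) (hRlim : ∀ᵐ z ∂μ, Tendsto (fun n => R n z) atTop (𝓝 (R' z))) :
    MemLp (fun z => R' z * Y z) 2 μ ∧
      Tendsto (fun n => (∫ z, R n z * Y z ∂(ν n) - ∫ z, R n z * Y z ∂μ) / ε n) atTop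
        (𝓝 (∫ z, R' z * Y z * S z ∂μ)) := by
  obtain ⟨B, hB⟩ := exists_integral_sq_le hν hνμ h hY hYμ hYν hC
  have hYsq : ∀ n, Integrable (fun z => density (ν n) μ z * Y z ^ 2) μ := fun n => by
    have := hν n
    exact (integrable_density_mul (hνμ n)).2 (hYν n).integrable_sq
  have hYp : ∀ n, MemLp (fun z => Y z * √(density (ν n) μ z)) 2 μ := fun n => by
    have hm : AEStronglyMeasurable (fun z => Y z * √(density (ν n) μ z)) μ :=
      (hY.aemeasurable.mul (h.integrable n).1.aemeasurable.sqrt).aestronglyMeasurable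
    rw [memLp_two_iff_integrable_sq hm]
    refine (hYsq n).congr (Eventually.of_forall fun z => ?_)
    simp only [mul_pow, Real.sq_sqrt (h.nonneg n z), mul_comm]
  have hw : ∀ n, MemLp (fun z => R n z * (Y z * (√(density (ν n) μ z) + 1))) 2 μ ∧
      ∫ z, (R n z * (Y z * (√(density (ν n) μ z) + 1))) ^ 2 ∂μ ≤
        K ^ 2 * (2 * B + 2 * ∫ z, Y z ^ 2 ∂μ) := fun n => by
    have := hν n
    have h1 : MemLp (fun z => Y z * √(density (ν n) μ z) - -(Y z)) 2 μ := (hYp n).sub hYμ.neg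
    have h2 := integral_sub_sq_le (hYp n) hYμ.neg
    have e1 : ∫ z, (Y z * √(density (ν n) μ z)) ^ 2 ∂μ = ∫ z, Y z ^ 2 ∂(ν n) := by
      rw [← integral_density_mul (hνμ n)]
      refine integral_congr_ae (Eventually.of_forall fun z => ?_)
      simp only [mul_pow, Real.sq_sqrt (h.nonneg n z), mul_comm]
    have e2 : ∀ z, R n z * (Y z * (√(density (ν n) μ z) + 1)) =
        R n z * (Y z * √(density (ν n) μ z) - -(Y z)) := fun z => by ring
    simp only [e2]
    have hle : ∀ z, |R n z * (Y z * √(density (ν n) μ z) - -(Y z))| ≤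
        K * |Y z * √(density (ν n) μ z) - -(Y z)| := fun z => by
      rw [abs_mul]; gcongr; exact hRK n z
    have hmem : MemLp (fun z => R n z * (Y z * √(density (ν n) μ z) - -(Y z))) 2 μ :=
      MemLp.of_le_mul h1 ((hR n).aestronglyMeasurable.mul h1.1) (Eventually.of_forall hle)
    refine ⟨hmem, ?_⟩
    calc _ ≤ ∫ z, K ^ 2 * (Y z * √(density (ν n) μ z) - -(Y z)) ^ 2 ∂μ := by
          refine integral_mono hmem.integrable_sq (h1.integrable_sq.const_mul _) fun z => ?_
          have := pow_le_pow_left₀ (abs_nonneg _) (hle z) 2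
          rwa [mul_pow, sq_abs, sq_abs] at this
      _ ≤ _ := by
          rw [integral_const_mul]
          gcongr
          rw [e1] at h2
          simp only [Pi.neg_apply, neg_sq] at h2
          linarith [hB n]
  have hlim : ∀ᵐ z ∂μ, Tendsto (fun n => R n z * (Y z * (√(density (ν n) μ z) + 1))) atTop
      (𝓝 (R' z * Y z * 2)) := by
    filter_upwards [hRlim, h.ae_tendsto] with z z1 z2
    have := z1.mul ((z2.sqrt.add_const 1).const_mul (Y z))
    have e : R' z * (Y z * (√1 + 1)) = R' z * Y z * 2 := by rw [Real.sqrt_one]; ring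
    rwa [e] at this
  have hmem := (memLp_two_of_tendsto_ae (fun n => (hw n).1) (fun n => (hw n).2) hlim).1
  refine ⟨by simpa [mul_assoc] using hmem.mul_const (2⁻¹ : ℝ), ?_⟩
  have key := tendsto_integral_mul_of_tendsto_ae_of_tendsto (fun n => (hw n).1)
    (fun n => (hw n).2) hlim h.memLp_quot h.memLp_half h.tendsto
  have e : ∫ z, R' z * Y z * 2 * (S z / 2) ∂μ = ∫ z, R' z * Y z * S z ∂μ :=
    integral_congr_ae (Eventually.of_forall fun z => by simp only; ring)
  rw [e] at key
  refine key.congr fun n => ?_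
  have := hν n
  have hRY : ∀ (ν' : Measure Ω), MemLp Y 2 ν' → IsProbabilityMeasure ν' →
      Integrable (fun z => R n z * Y z) ν' := fun ν' hY' hp =>
    (hY'.integrable (by norm_num)).bdd_mul (hR n).aestronglyMeasurable
      (Eventually.of_forall (hRK n))
  have hi := (integrable_density_mul (hνμ n)).2 (hRY _ (hYν n) (hν n))
  rw [← integral_density_mul (hνμ n), ← integral_sub hi (hRY _ hYμ inferInstance), ← integral_div]
  refine integral_congr_ae (Eventually.of_forall fun z => ?_)
  simp only
  rw [show density (ν n) μ z * (R n z * Y z) - R n z * Y z =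
    R n z * Y z * ((√(density (ν n) μ z) + 1) * (√(density (ν n) μ z) - 1)) by
      linear_combination (-(R n z * Y z)) * Real.sq_sqrt (h.nonneg n z)]
  ring

end SecondMoments

section Gradient

variable {T d : ℕ} {a : Fin T → Bool} {s : Fin T → ℝ → ℝ} {C : ℝ} {P : Measure (Obs T d)}
  {S : Obs T d → ℝ}

/-- The influence function written as the derivative of the weighted mean of the outcome: a change
of the law of the observation, and a change of the weights of each time and arm. -/
noncomputable def gradFun (a : Fin T → Bool) (s : Fin T → ℝ → ℝ) (C : ℝ) (P : Measure (Obs T d))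
    (z : Obs T d) : ℝ :=
  cumWeight a s C P T z * outcome z - identifiedMean a s P +
    ∑ t : Fin T, ∑ b : Bool, gradTerm a s C P t b z

lemma measurable_outcome : Measurable (outcome : Obs T d → ℝ) := measurable_snd

/-- Pathwise differentiability. The identified mean under `Q n` is the mean under `Q n` of the
outcome weighted by the weights of `Q n`. Its change is the sum of the effect of the change of law,
for these weights, and of the effect under `P` of the change of weights. -/
lemma tendsto_identifiedMean {Q : ℕ → Measure (Obs T d)} {ε : ℕ → ℝ}
    (hs : ∀ t, IsSmoothWeight (s t)) (hP : InModel a s C P) (hC : 1 ≤ C)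
    (hQ : ∀ n, InModel a s C (Q n)) (hQP : ∀ n, Q n ≪ P)
    (h : IsQMDSequence P ε (fun n => density (Q n) P) S) :
    Tendsto (fun n => (identifiedMean a s (Q n) - identifiedMean a s P) / ε n) atTop
      (𝓝 (∫ z, gradFun a s C P z * S z ∂P)) := by
  have := hP.isProb
  have hQ' := fun n => (hQ n).isProb
  obtain ⟨hm0, hl0⟩ := tendsto_integral_density_sub_one_mul hQ' hQP h measurable_outcome hP.memLp
    (fun n => (hQ n).memLp) (fun n => (hQ n).variance_le)
    (fun n => measurable_cumWeight' (a := a) (C := C) (P := Q n) hs T)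
    (fun n z => abs_cumWeight_le hC T z) (ae_tendsto_cumWeight hQ' hQP h hs T)
  have hg := fun t b => tendsto_gradTerm hs hP hC hQ hQP h t b
  have hsum := hl0.add (tendsto_finsetSum Finset.univ fun t _ =>
    tendsto_finsetSum Finset.univ fun b _ => (hg t b).2)
  have elim : ∫ z, cumWeight a s C P T z * outcome z * S z ∂P +
      ∑ t : Fin T, ∑ b : Bool, ∫ z, gradTerm a s C P t b z * S z ∂P =
      ∫ z, gradFun a s C P z * S z ∂P := by
    have hi := fun t b => integrable_mul_of_memLp_two (hg t b).1 h.memLp_score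
    have hS : Integrable S P := h.memLp_score.integrable (by norm_num)
    have e1 : ∫ z, ∑ t : Fin T, ∑ b : Bool, gradTerm a s C P t b z * S z ∂P =
        ∑ t : Fin T, ∑ b : Bool, ∫ z, gradTerm a s C P t b z * S z ∂P := by
      rw [integral_finsetSum _ fun t _ => integrable_finsetSum _ fun b _ => hi t b]
      exact Finset.sum_congr rfl fun t _ => integral_finsetSum _ fun b _ => hi t b
    rw [← e1]
    have e2 : ∫ z, identifiedMean a s P * S z ∂P = 0 := by
      rw [integral_const_mul, h.integral_score_eq_zero, mul_zero]
    have hi0 := integrable_mul_of_memLp_two hm0 h.memLp_score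
    have hiS : Integrable (fun z => ∑ t : Fin T, ∑ b : Bool, gradTerm a s C P t b z * S z) P :=
      integrable_finsetSum _ fun t _ => integrable_finsetSum _ fun b _ => hi t b
    have hi2 : Integrable (fun z => cumWeight a s C P T z * outcome z * S z +
      ∑ t : Fin T, ∑ b : Bool, gradTerm a s C P t b z * S z) P := hi0.add hiS
    rw [← integral_add hi0 hiS, ← sub_zero (∫ z, _ ∂P), ← e2,
      ← integral_sub hi2 (hS.const_mul _)]
    refine integral_congr_ae (Eventually.of_forall fun z => ?_)
    simp only [gradFun, ← Finset.sum_mul]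
    ring
  rw [elim] at hsum
  refine hsum.congr fun n => ?_
  have e3 := hP.integral_cumWeight_mul_outcome_sub hs hC (Q n)
  rw [(hQ n).identifiedMean_eq hs hC]
  simp only [← Finset.sum_div]
  rw [← e3, ← add_div]
  congr 1
  ring

lemma prod_Iio_eq (t : Fin T) (f : Fin T → ℝ) :
    ∏ j ∈ Finset.Iio t, f j = ∏ j : Fin T with j.val < t.val, f j := by
  refine Finset.prod_congr (Finset.ext fun j => ?_) fun _ _ => rfl
  rw [Finset.mem_Iio, Finset.mem_filter, Fin.lt_def]
  exact ⟨fun h => ⟨Finset.mem_univ _, h⟩, fun h => h.2⟩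

lemma prod_Iic_eq (t : Fin T) (f : Fin T → ℝ) :
    ∏ j ∈ Finset.Iic t, f j = ∏ j : Fin T with j.val < t.val + 1, f j := by
  refine Finset.prod_congr (Finset.ext fun j => ?_) fun _ _ => rfl
  rw [Finset.mem_Iic, Finset.mem_filter, Fin.le_def, ← Nat.lt_succ_iff]
  exact ⟨fun h => ⟨Finset.mem_univ _, h⟩, fun h => h.2⟩

/-- The telescoping form of the influence function agrees with the sum of the weighted outcome and
the `gradTerm`s, because the flip weight times the propensity score of an arm is its intervention
propensity score. -/
lemma InModel.ae_phi_eq (h : InModel a s C P) (hs : ∀ t, IsSmoothWeight (s t)) :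
    ∀ᵐ z ∂P, phiM a s P z + phiQ a s P z = gradFun a s C P z := by
  have := h.isProb
  have h1 : ∀ᵐ z ∂P, ∀ t, flipWeight a s C P t (treat t z) z = ratio a s P t z :=
    ae_all_iff.2 fun t => h.ae_flipWeight_treat t
  have h2 : ∀ᵐ z ∂P, ∀ t, ∀ b, flipWeight a s C P t b z * prop P t b z = intProp a s P t b z :=
    ae_all_iff.2 fun t => ae_all_iff.2 fun b => h.ae_flipWeight_mul_prop hs t b
  have h3 : ∀ᵐ z ∂P, ∀ t, targetScore a P t z = prop P t (a t) z :=
    ae_all_iff.2 fun t => ae_targetScore_eq t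
  have h4 : ∀ᵐ z ∂P, ∀ t, prop P t (!(a t)) z = 1 - prop P t (a t) z :=
    ae_all_iff.2 fun t => ae_armProp_not (histSigma_le t) (measurable_treat t) (a t)
  filter_upwards [h1, h2, h3, h4] with z z1 z2 z3 z4
  have hphi : ∀ t b, phiProp a s P t b z = flipDeriv (s t) (targetScore a P t z) *
      (armInd (treat t) b z - prop P t b z) := fun t b => by
    rw [z3]
    unfold phiProp flipDeriv
    by_cases hb : b = a t
    · rw [if_pos hb, hb]; simp only [armInd]; ring
    · have hb' : b = !(a t) := by cases b <;> cases hat : a t <;> simp_all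
      rw [if_neg hb, hb', z4]
      have : armInd (treat t) (!(a t)) z = 1 - armInd (treat t) (a t) z := by
        unfold armInd; cases treat t z <;> cases a t <;> simp
      rw [this]; simp only [armInd]; ring
  have hstep : ∀ t : Fin T, cumWeight a s C P t z * pseudo a s P t z -
      cumWeight a s C P (t + 1) z * seqReg a s P t (treat t z) z +
      cumWeight a s C P t z * ∑ b : Bool, seqReg a s P t b z * phiProp a s P t b z =
      ∑ b : Bool, gradTerm a s C P t b z := fun t => by
    rw [cumWeight_succ, pseudo_fin, mul_assoc (cumWeight a s C P t z),
      ← sum_armInd_mul (treat t) (fun b => flipWeight a s C P t b z * seqReg a s P t b z),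
      ← mul_sub, ← mul_add, ← Finset.sum_sub_distrib, ← Finset.sum_add_distrib, Finset.mul_sum]
    refine Finset.sum_congr rfl fun b _ => ?_
    rw [gradTerm, hphi, ← z2]
    ring
  have htel : ∑ t : Fin T, (cumWeight a s C P (t + 1) z * pseudo a s P (t + 1) z -
      cumWeight a s C P t z * pseudo a s P t z) =
      cumWeight a s C P T z * outcome z - pseudo a s P 0 z := by
    rw [Fin.sum_univ_eq_sum_range (fun k => cumWeight a s C P (k + 1) z * pseudo a s P (k + 1) z -
      cumWeight a s C P k z * pseudo a s P k z) T,
      Finset.sum_range_sub (fun k => cumWeight a s C P k z * pseudo a s P k z), cumWeight_zero,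
      pseudo_last, one_mul]
  have hp1 : ∀ t, ∏ j ∈ Finset.Iic t, ratio a s P j z = cumWeight a s C P (t + 1) z := fun t => by
    rw [prod_Iic_eq]; exact Finset.prod_congr rfl fun j _ => (z1 j).symm
  have hp2 : ∀ t, ∏ j ∈ Finset.Iio t, ratio a s P j z = cumWeight a s C P t z := fun t => by
    rw [prod_Iio_eq]; exact Finset.prod_congr rfl fun j _ => (z1 j).symm
  unfold phiM phiQ gradFun
  simp only [hp1, hp2]
  rw [← Finset.sum_congr rfl fun t _ => hstep t]
  simp only [Finset.sum_sub_distrib, Finset.sum_add_distrib, mul_sub] at htel ⊢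
  linarith

end Gradient

section GradientProperties

variable {T d : ℕ} {a : Fin T → Bool} {s : Fin T → ℝ → ℝ} {C : ℝ} {P : Measure (Obs T d)}
  {S : Obs T d → ℝ}

/-- The constant sequence is differentiable in quadratic mean with score zero. -/
lemma isQMDSequence_const {Ω : Type*} {m0 : MeasurableSpace Ω} (μ : Measure Ω)
    [IsProbabilityMeasure μ] :
    IsQMDSequence μ (fun n => (1 / 2 : ℝ) ^ n) (fun _ => density μ μ) 0 where
  ne_zero n := by positivity
  summable := by
    simpa using summable_geometric_of_abs_lt_one (r := (2 : ℝ)⁻¹) (by norm_num [abs_of_pos])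
  nonneg _ := density_nonneg
  integrable _ := integrable_density
  integral_eq_one _ := by
    have := integral_density_mul (μ := μ) (ν := μ) Measure.AbsolutelyContinuous.rfl fun _ => (1 : ℝ)
    simpa using this
  memLp_score := MemLp.zero
  tendsto := by
    refine tendsto_const_nhds.congr fun n => (integral_eq_zero_of_ae ?_).symm
    filter_upwards [Measure.rnDeriv_self μ] with z hz
    simp [density, hz]

lemma InModel.memLp_gradTerm (h : InModel a s C P) (hs : ∀ t, IsSmoothWeight (s t)) (hC : 1 ≤ C)
    (t : Fin T) (b : Bool) : MemLp (gradTerm a s C P t b) 2 P := by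
  have := h.isProb
  exact (tendsto_gradTerm (Q := fun _ => P) hs h hC (fun _ => h)
    (fun _ => Measure.AbsolutelyContinuous.rfl) (isQMDSequence_const P) t b).1

lemma InModel.memLp_cumWeight_mul_outcome (h : InModel a s C P)
    (hs : ∀ t, IsSmoothWeight (s t)) (hC : 1 ≤ C) :
    MemLp (fun z => cumWeight a s C P T z * outcome z) 2 P :=
  MemLp.of_le_mul (c := C ^ T) h.memLp
    ((measurable_cumWeight' hs T).mul measurable_outcome).aestronglyMeasurable
    (Eventually.of_forall fun z => by
      rw [norm_mul]
      gcongr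
      exact abs_cumWeight_le hC T z)

lemma InModel.memLp_gradFun (h : InModel a s C P) (hs : ∀ t, IsSmoothWeight (s t)) (hC : 1 ≤ C) :
    MemLp (gradFun a s C P) 2 P := by
  have := h.isProb
  exact ((h.memLp_cumWeight_mul_outcome hs hC).sub (memLp_const _)).add
    (memLp_finsetSum _ fun t _ => memLp_finsetSum _ fun b _ => h.memLp_gradTerm hs hC t b)

lemma InModel.integral_gradTerm (h : InModel a s C P) (hs : ∀ t, IsSmoothWeight (s t))
    (hC : 1 ≤ C) (t : Fin T) (b : Bool) : ∫ z, gradTerm a s C P t b z ∂P = 0 := by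
  have := h.isProb
  have hJ := integrable_armInd (μ := P) (measurable_treat t) b
  have hπ : Integrable (prop P t b) P := integrable_condExp
  set g : Obs T d → ℝ := fun z => cumWeight a s C P t z *
    ((flipDeriv (s t) (targetScore a P t z) - flipWeight a s C P t b z) * seqReg a s P t b z)
  have hg : Measurable[histSigma T d t] g :=
    (measurable_cumWeight hs t le_rfl).mul (((measurable_comp_of_continuousOn
      (hs t).continuousOn_flipDeriv (measurable_targetScore t) (targetScore_mem t)).sub
        (measurable_flipWeight hs t b)).mul (by
          rw [seqReg_eq_armMean]; exact (stronglyMeasurable_armMean b _).measurable))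
  have e : ∀ z, gradTerm a s C P t b z = g z * (armInd (treat t) b - prop P t b : Obs T d → ℝ) z :=
      fun z => by
    simp only [gradTerm, g, Pi.sub_apply]; ring
  have hi : Integrable (fun z => g z * (armInd (treat t) b - prop P t b : Obs T d → ℝ) z) P :=
    ((h.memLp_gradTerm hs hC t b).integrable (by norm_num)).congr (Eventually.of_forall e)
  simp only [e]
  rw [← integral_mul_condExp (histSigma_le t) hg.stronglyMeasurable.aestronglyMeasurable
    (hJ.sub hπ) hi]
  refine integral_eq_zero_of_ae ?_
  have c2 : P[prop P t b|histSigma T d t] = prop P t b :=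
    condExp_of_stronglyMeasurable (histSigma_le t) stronglyMeasurable_condExp hπ
  filter_upwards [condExp_sub hJ hπ (histSigma T d t)] with z hz
  rw [hz, Pi.sub_apply, c2, prop_eq_armProp]
  simp [armProp]

lemma InModel.integral_gradFun (h : InModel a s C P) (hs : ∀ t, IsSmoothWeight (s t))
    (hC : 1 ≤ C) : ∫ z, gradFun a s C P z ∂P = 0 := by
  have := h.isProb
  have hi0 : Integrable (fun z => cumWeight a s C P T z * outcome z) P :=
    (h.memLp_cumWeight_mul_outcome hs hC).integrable (by norm_num)
  have hi : ∀ t b, Integrable (gradTerm a s C P t b) P := fun t b =>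
    (h.memLp_gradTerm hs hC t b).integrable (by norm_num)
  have hi1 : Integrable (fun z => cumWeight a s C P T z * outcome z - identifiedMean a s P) P :=
    hi0.sub (integrable_const _)
  have hi2 : Integrable (fun z => ∑ t : Fin T, ∑ b : Bool, gradTerm a s C P t b z) P :=
    integrable_finsetSum _ fun t _ => integrable_finsetSum _ fun b _ => hi t b
  have e2 : ∫ z, ∑ t : Fin T, ∑ b : Bool, gradTerm a s C P t b z ∂P = 0 := by
    rw [integral_finsetSum _ fun t _ => integrable_finsetSum _ fun b _ => hi t b]
    refine Finset.sum_eq_zero fun t _ => ?_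
    rw [integral_finsetSum _ fun b _ => hi t b]
    exact Finset.sum_eq_zero fun b _ => h.integral_gradTerm hs hC t b
  unfold gradFun
  rw [integral_add hi1 hi2, e2, integral_sub hi0 (integrable_const _), h.identifiedMean_eq hs hC]
  simp

/-- The identified mean is differentiable along every regular submodel of the model. -/
theorem InModel.hasDerivAt_identifiedMean (hP : InModel a s C P) (hs : ∀ t, IsSmoothWeight (s t))
    (hC : 1 ≤ C) {γ : ℝ → Measure (Obs T d)} (hγ : ∀ᶠ ε in 𝓝 (0 : ℝ), InModel a s C (γ ε))
    (hS : IsRegularSubmodel P γ S) :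
    HasDerivAt (fun ε => identifiedMean a s (γ ε)) (∫ z, gradFun a s C P z * S z ∂P) 0 := by
  have := hP.isProb
  rw [hasDerivAt_iff_tendsto_slope_zero]
  refine tendsto_of_subseq_tendsto fun e he => ?_
  have he0 := (tendsto_nhdsWithin_iff.1 he).1
  have hgood : ∀ᶠ n in atTop, (InModel a s C (γ (e n)) ∧ γ (e n) ≪ P) ∧ e n ≠ 0 :=
    ((he0.eventually hγ).and (he0.eventually hS.dominated)).and (tendsto_nhdsWithin_iff.1 he).2
  -- a subsequence of summable parameters makes all conditional expectations converge
  have hsub : ∀ k : ℕ, ∃ n ≥ k, |e n| ≤ (1 / 2 : ℝ) ^ k ∧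
      (InModel a s C (γ (e n)) ∧ γ (e n) ≪ P) ∧ e n ≠ 0 := fun k => by
    have h1 : ∀ᶠ n in atTop, |e n| ≤ (1 / 2 : ℝ) ^ k := by
      have := he0.abs
      rw [abs_zero] at this
      exact this.eventually (Iic_mem_nhds (by positivity))
    obtain ⟨n, hn1, hn2, hn3⟩ := ((eventually_ge_atTop k).and (h1.and hgood)).exists
    exact ⟨n, hn1, hn2, hn3⟩
  choose φ hφk hφ hmod using hsub
  have hφlim : Tendsto φ atTop atTop := tendsto_atTop_mono hφk tendsto_id
  refine ⟨φ, ?_⟩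
  have hq : IsQMDSequence P (fun n => e (φ n)) (fun n => density (γ (e (φ n))) P) S :=
    { ne_zero := fun n => (hmod n).2
      summable := Summable.of_nonneg_of_le (fun _ => abs_nonneg _) hφ
        (summable_geometric_of_lt_one (by norm_num) (by norm_num))
      nonneg := fun n z => density_nonneg z
      integrable := fun n => by
        have := (hmod n).1.1.isProb
        exact integrable_density
      integral_eq_one := fun n => by
        have := (hmod n).1.1.isProb
        have := integral_density_mul (hmod n).1.2 fun _ => (1 : ℝ)
        simpa using this
      memLp_score := hS.score_memLp
      tendsto := hS.qmd.comp (he.comp hφlim) }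
  have key := tendsto_identifiedMean hs hP hC (fun n => (hmod n).1.1) (fun n => (hmod n).1.2) hq
  refine key.congr fun n => ?_
  rw [zero_add, hS.through, smul_eq_mul, div_eq_inv_mul]

end GradientProperties

/-! ### The tangent space -/

section Tangent

variable {Ω : Type*} {m0 : MeasurableSpace Ω} {μ : Measure Ω}

/-- The submodel with density `1 + ε S`. -/
noncomputable def tilt (μ : Measure Ω) (S : Ω → ℝ) (ε : ℝ) : Measure Ω :=
  μ.withDensity fun z => ENNReal.ofReal (1 + ε * S z)

variable {S : Ω → ℝ} {K ε : ℝ}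

lemma one_add_mul_mem (hK : ∀ z, |S z| ≤ K) (hε : |ε| * K ≤ 1 / 2) (z : Ω) :
    1 + ε * S z ∈ Set.Icc (1 / 2 : ℝ) (3 / 2) := by
  have h1 : |ε * S z| ≤ 1 / 2 := by
    rw [abs_mul]
    exact (mul_le_mul_of_nonneg_left (hK z) (abs_nonneg _)).trans hε
  constructor <;> linarith [(abs_le.1 h1).1, (abs_le.1 h1).2]

lemma eventually_abs_mul_le (K : ℝ) : ∀ᶠ ε in 𝓝 (0 : ℝ), |ε| * K ≤ 1 / 2 := by
  have h : Tendsto (fun ε : ℝ => |ε| * K) (𝓝 0) (𝓝 0) := by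
    have : Continuous fun ε : ℝ => |ε| * K := by fun_prop
    simpa using this.tendsto 0
  exact h.eventually (Iic_mem_nhds (by norm_num))

lemma tilt_zero : tilt μ S 0 = μ := by
  have : (fun z => ENNReal.ofReal (1 + 0 * S z)) = 1 := by funext z; simp
  rw [tilt, this, withDensity_one]

lemma tilt_absolutelyContinuous : tilt μ S ε ≪ μ := withDensity_absolutelyContinuous _ _

lemma measurable_tiltDensity (hS : Measurable S) (ε : ℝ) :
    Measurable fun z => ENNReal.ofReal (1 + ε * S z) :=
  (measurable_const.add (hS.const_mul ε)).ennreal_ofReal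

lemma absolutelyContinuous_tilt (hS : Measurable S) (hK : ∀ z, |S z| ≤ K)
    (hε : |ε| * K ≤ 1 / 2) : μ ≪ tilt μ S ε :=
  withDensity_absolutelyContinuous' (measurable_tiltDensity hS ε).aemeasurable
    (Eventually.of_forall fun z => by
      have := (one_add_mul_mem hK hε z).1
      rw [Ne, ENNReal.ofReal_eq_zero, not_le]
      linarith)

variable [IsProbabilityMeasure μ]

lemma isProbabilityMeasure_tilt (hS : Measurable S) (hK : ∀ z, |S z| ≤ K) (h0 : ∫ z, S z ∂μ = 0)
    (hε : |ε| * K ≤ 1 / 2) : IsProbabilityMeasure (tilt μ S ε) := by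
  refine ⟨?_⟩
  have hi : Integrable S μ :=
    Integrable.of_bound hS.aestronglyMeasurable K (Eventually.of_forall hK)
  have hi' : Integrable (fun z => 1 + ε * S z) μ := (integrable_const 1).add (hi.const_mul ε)
  rw [tilt, withDensity_apply _ MeasurableSet.univ, Measure.restrict_univ,
    ← ofReal_integral_eq_lintegral_ofReal hi' (Eventually.of_forall fun z => by
      have := (one_add_mul_mem hK hε z).1
      simp only [Pi.zero_apply]; linarith),
    integral_add (integrable_const 1) (hi.const_mul ε), integral_const_mul, h0]
  simp

lemma density_tilt (hS : Measurable S) (hK : ∀ z, |S z| ≤ K) (hε : |ε| * K ≤ 1 / 2) :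
    density (tilt μ S ε) μ =ᵐ[μ] fun z => 1 + ε * S z := by
  filter_upwards [Measure.rnDeriv_withDensity μ (measurable_tiltDensity hS ε)] with z hz
  have := (one_add_mul_mem hK hε z).1
  rw [density, tilt, hz, ENNReal.toReal_ofReal (by linarith)]

omit [IsProbabilityMeasure μ] in
lemma tilt_le (hK : ∀ z, |S z| ≤ K) (hε : |ε| * K ≤ 1 / 2) :
    tilt μ S ε ≤ ENNReal.ofReal 2 • μ := by
  rw [← withDensity_const]
  refine withDensity_mono (Eventually.of_forall fun z => ENNReal.ofReal_le_ofReal ?_)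
  linarith [(one_add_mul_mem hK hε z).2]

lemma isRegularSubmodel_tilt (hS : Measurable S) (hK : ∀ z, |S z| ≤ K) (h0 : ∫ z, S z ∂μ = 0) :
    IsRegularSubmodel μ (tilt μ S) S where
  through := tilt_zero
  isProb := (eventually_abs_mul_le K).mono fun _ hε => isProbabilityMeasure_tilt hS hK h0 hε
  dominated := Eventually.of_forall fun _ => tilt_absolutelyContinuous
  score_memLp := MemLp.of_bound hS.aestronglyMeasurable K (Eventually.of_forall hK)
  qmd := by
    have hlim : Tendsto (fun ε : ℝ => (ε * K ^ 2 / 2) ^ 2) (𝓝[≠] 0) (𝓝 0) := by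
      have : Continuous fun ε : ℝ => (ε * K ^ 2 / 2) ^ 2 := by fun_prop
      have h1 := this.tendsto 0
      simp only [zero_mul, zero_div, ne_eq, OfNat.ofNat_ne_zero, not_false_eq_true, zero_pow] at h1
      exact h1.mono_left nhdsWithin_le_nhds
    refine tendsto_of_tendsto_of_tendsto_of_le_of_le' tendsto_const_nhds hlim
      (Eventually.of_forall fun ε => integral_nonneg fun z => sq_nonneg _) ?_
    filter_upwards [nhdsWithin_le_nhds (eventually_abs_mul_le K), self_mem_nhdsWithin] with ε hε hne
    have hne' : ε ≠ 0 := hne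
    have hae : ∀ᵐ z ∂μ, ((√((tilt μ S ε).rnDeriv μ z).toReal - 1) / ε - S z / 2) ^ 2 ≤
        (ε * K ^ 2 / 2) ^ 2 := by
      filter_upwards [density_tilt (μ := μ) hS hK hε] with z hz
      have hz' : ((tilt μ S ε).rnDeriv μ z).toReal = 1 + ε * S z := hz
      have hpos : 0 ≤ 1 + ε * S z := by linarith [(one_add_mul_mem hK hε z).1]
      rw [hz']
      set r := √(1 + ε * S z) with hr
      have hr0 : 0 ≤ r := Real.sqrt_nonneg _
      have hr2 : r ^ 2 = 1 + ε * S z := Real.sq_sqrt hpos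
      -- the remainder of the first-order expansion of the square root
      have e1 : (r - 1) / ε - S z / 2 = -((r - 1) ^ 2 / (2 * ε)) := by
        field_simp
        linear_combination hr2
      have e2 : (r - 1) ^ 2 ≤ (ε * S z) ^ 2 := by
        have : ε * S z = (r - 1) * (r + 1) := by linear_combination -hr2
        rw [this, mul_pow]
        nlinarith [sq_nonneg (r - 1)]
      have e3 : S z ^ 2 ≤ K ^ 2 := sq_le_sq' (abs_le.1 (hK z)).1 (abs_le.1 (hK z)).2
      have e4 : |(r - 1) ^ 2 / (2 * ε)| ≤ |ε * K ^ 2 / 2| := by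
        rw [abs_div, abs_mul, abs_div, abs_mul, abs_of_nonneg (sq_nonneg (r - 1)),
          abs_of_nonneg (sq_nonneg K), abs_two, div_le_iff₀ (by positivity)]
        calc (r - 1) ^ 2 ≤ ε ^ 2 * S z ^ 2 := by rw [← mul_pow]; exact e2
          _ ≤ ε ^ 2 * K ^ 2 := by gcongr
          _ = _ := by rw [← sq_abs ε]; ring
      rw [e1, neg_sq]
      exact sq_le_sq.2 e4
    calc _ ≤ ∫ _, (ε * K ^ 2 / 2) ^ 2 ∂μ :=
          integral_mono_of_nonneg (Eventually.of_forall fun z => sq_nonneg _)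
            (integrable_const _) hae
      _ = _ := by simp

/-- Any square integrable function of mean zero lies in the tangent space, as soon as all bounded
tilts are admissible submodels. -/
theorem mem_tangentSpace_of_forall_tilt {𝒮 : Set (ℝ → Measure Ω)}
    (h : ∀ S : Ω → ℝ, Measurable S → (∃ K, ∀ z, |S z| ≤ K) → ∫ z, S z ∂μ = 0 → tilt μ S ∈ 𝒮)
    {φ : Ω → ℝ} (hφ : MemLp φ 2 μ) (h0 : ∫ z, φ z ∂μ = 0) :
    hφ.toLp φ ∈ tangentSpace 𝒮 μ := by
  rw [tangentSpace, ← SetLike.mem_coe, Submodule.topologicalClosure_coe, EMetric.mem_closure_iff]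
  intro η hη
  obtain ⟨g, hg, hgL⟩ := hφ.exists_simpleFunc_eLpNorm_sub_lt (by norm_num)
    (ENNReal.half_pos hη.ne').ne'
  set c := ∫ z, g z ∂μ with hc
  have hgi : Integrable g μ := hgL.integrable (by norm_num)
  have hφi : Integrable φ μ := hφ.integrable (by norm_num)
  obtain ⟨K, hK⟩ := g.exists_forall_norm_le
  have hSm : Measurable fun z => g z - c := g.measurable.sub measurable_const
  have hSL : MemLp (fun z => g z - c) 2 μ := hgL.sub (memLp_const c)
  have hS0 : ∫ z, (g z - c) ∂μ = 0 := by
    rw [integral_sub hgi (integrable_const c)]; simp [hc]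
  have hSK : ∀ z, |g z - c| ≤ K + |c| := fun z =>
    (abs_sub _ _).trans (add_le_add (hK z) le_rfl)
  refine ⟨hSL.toLp _, Submodule.subset_span ⟨tilt μ fun z => g z - c,
    h _ hSm ⟨_, hSK⟩ hS0, ?_⟩, ?_⟩
  · have hr := isRegularSubmodel_tilt hSm hSK hS0
    have hae := hSL.coeFn_toLp
    refine ⟨hr.through, hr.isProb, hr.dominated, Lp.memLp _, hr.qmd.congr fun ε => ?_⟩
    refine integral_congr_ae ?_
    filter_upwards [hae] with z hz
    rw [hz]
  · rw [Lp.edist_toLp_toLp]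
    have e : φ - (fun z => g z - c) = (φ - ⇑g) + fun _ => c := by
      funext z; simp only [Pi.sub_apply, Pi.add_apply]; ring
    have hc' : ‖c‖ₑ ≤ eLpNorm (φ - ⇑g) 2 μ := by
      have : -c = ∫ z, (φ - ⇑g) z ∂μ := by
        simp only [Pi.sub_apply]
        rw [integral_sub hφi hgi, h0, hc]; ring
      rw [← enorm_neg, this]
      refine (enorm_integral_le_lintegral_enorm _).trans ?_
      rw [← eLpNorm_one_eq_lintegral_enorm]
      exact eLpNorm_le_eLpNorm_of_exponent_le (by norm_num) (hφ.sub hgL).1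
    rw [e]
    calc _ ≤ eLpNorm (φ - ⇑g) 2 μ + eLpNorm (fun _ => c) 2 μ :=
          eLpNorm_add_le (hφ.sub hgL).1 aestronglyMeasurable_const (by norm_num)
      _ ≤ eLpNorm (φ - ⇑g) 2 μ + eLpNorm (φ - ⇑g) 2 μ := by
          gcongr
          rw [eLpNorm_const _ (by norm_num) (NeZero.ne μ)]
          simpa using hc'
      _ < η / 2 + η / 2 := ENNReal.add_lt_add hg hg
      _ = η := ENNReal.add_halves η

end Tangent

/-! ### Bounded tilts stay in the model -/

section TiltArm

variable {Ω : Type*} {m m0 : MeasurableSpace Ω} {μ : Measure Ω} [IsProbabilityMeasure μ]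
  {A : Ω → Bool} {S : Ω → ℝ} {K ε : ℝ}

/-- A bounded tilt changes the conditional probability of an arm by a bounded factor, by Bayes'
formula. -/
lemma ae_armProp_tilt_mem (hm : m ≤ m0) (hA : Measurable A) (b : Bool) (hS : Measurable S)
    (hK : ∀ z, |S z| ≤ K) (h0 : ∫ z, S z ∂μ = 0) (hε : |ε| * K ≤ 1 / 2) :
    ∀ᵐ z ∂μ, armProp m μ A b z ≤ 3 * armProp m (tilt μ S ε) A b z ∧
      armProp m (tilt μ S ε) A b z ≤ 3 * armProp m μ A b z := by
  have hprob := isProbabilityMeasure_tilt (μ := μ) hS hK h0 hε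
  have hac : tilt μ S ε ≪ μ := tilt_absolutelyContinuous
  have hd := density_tilt (μ := μ) hS hK hε
  have hdi : Integrable (density (tilt μ S ε) μ) μ := integrable_density
  have hJ := integrable_armInd (μ := μ) hA b
  have k1 : (fun _ => (1 / 2 : ℝ)) ≤ᵐ[μ] μ[density (tilt μ S ε) μ|m] := by
    rw [← condExp_const (μ := μ) hm (1 / 2 : ℝ)]
    refine condExp_mono (integrable_const _) hdi ?_
    filter_upwards [hd] with z hz
    rw [hz]; exact (one_add_mul_mem hK hε z).1
  have k2 : μ[density (tilt μ S ε) μ|m] ≤ᵐ[μ] fun _ => (3 / 2 : ℝ) := by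
    rw [← condExp_const (μ := μ) hm (3 / 2 : ℝ)]
    refine condExp_mono hdi (integrable_const _) ?_
    filter_upwards [hd] with z hz
    rw [hz]; exact (one_add_mul_mem hK hε z).2
  have hq := integrable_armInd_mul (μ := μ) hA b hdi
  have q1 : μ[fun z => (1 / 2 : ℝ) • armInd A b z|m] ≤ᵐ[μ]
      μ[fun z => armInd A b z * density (tilt μ S ε) μ z|m] := by
    refine condExp_mono (hJ.smul (1 / 2 : ℝ)) hq ?_
    filter_upwards [hd] with z hz
    rw [hz, smul_eq_mul, mul_comm]
    exact mul_le_mul_of_nonneg_left (one_add_mul_mem hK hε z).1 (armInd_nonneg _ _ _)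
  have q2 : μ[fun z => armInd A b z * density (tilt μ S ε) μ z|m] ≤ᵐ[μ]
      μ[fun z => (3 / 2 : ℝ) • armInd A b z|m] := by
    refine condExp_mono hq (hJ.smul (3 / 2 : ℝ)) ?_
    filter_upwards [hd] with z hz
    rw [hz, smul_eq_mul, mul_comm (3 / 2 : ℝ)]
    exact mul_le_mul_of_nonneg_left (one_add_mul_mem hK hε z).2 (armInd_nonneg _ _ _)
  filter_upwards [k1, k2, q1, q2, condExp_smul (μ := μ) (1 / 2 : ℝ) (armInd A b) m,
    condExp_smul (μ := μ) (3 / 2 : ℝ) (armInd A b) m,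
    ae_armProp_mul_condExp_density (μ := μ) hm hA b hac,
    (absolutelyContinuous_tilt (μ := μ) hS hK hε).ae_le
      (ae_armProp_nonneg (m := m) (μ := tilt μ S ε) (A := A) b)]
    with z k1 k2 q1 q2 e1 e2 hB hp
  have e1' : (μ[fun z => (1 / 2 : ℝ) • armInd A b z|m]) z = 1 / 2 * armProp m μ A b z := e1
  have e2' : (μ[fun z => (3 / 2 : ℝ) • armInd A b z|m]) z = 3 / 2 * armProp m μ A b z := e2
  rw [e1', ← hB] at q1
  rw [e2', ← hB] at q2
  constructor
  · nlinarith
  · nlinarith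

end TiltArm

section TiltModel

variable {T d : ℕ} {a : Fin T → Bool} {s : Fin T → ℝ → ℝ} {C : ℝ} {P : Measure (Obs T d)}
  {S : Obs T d → ℝ} {K ε : ℝ}

/-- The ratios under a bounded tilt are bounded: the intervention propensity score is a Lipschitz
function of the propensity score, and the latter changes by a bounded factor only. -/
lemma InModel.ae_ratio_tilt_le (h : InModel a s C P) {L : ℝ} (t : Fin T) (hL0 : 0 ≤ L)
    (hL : ∀ x ∈ Set.Icc (0 : ℝ) 1, ∀ y ∈ Set.Icc (0 : ℝ) 1, |flipSlope (s t) x y| ≤ L)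
    (hS : Measurable S) (hK : ∀ z, |S z| ≤ K) (h0 : ∫ z, S z ∂P = 0) (hε : |ε| * K ≤ 1 / 2) :
    ∀ᵐ z ∂tilt P S ε, |ratio a s (tilt P S ε) t z| ≤ 3 * C + 4 * L := by
  have := h.isProb
  have hprob := isProbabilityMeasure_tilt (μ := P) hS hK h0 hε
  have hac : tilt P S ε ≪ P := tilt_absolutelyContinuous
  have harm : ∀ᵐ z ∂tilt P S ε, ∀ b, (treat t z = b → 0 < prop P t b z) ∧
      armScore a P t b z = prop P t b z ∧
      armScore a (tilt P S ε) t b z = prop (tilt P S ε) t b z ∧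
      prop P t b z ≤ 3 * prop (tilt P S ε) t b z ∧
      prop (tilt P S ε) t b z ≤ 3 * prop P t b z := by
    rw [ae_all_iff]
    intro b
    filter_upwards [hac.ae_le (ae_armProp_pos (μ := P) (histSigma_le t) (measurable_treat t) b),
      hac.ae_le (ae_armScore_eq (a := a) (P := P) t b),
      ae_armScore_eq (a := a) (P := tilt P S ε) t b,
      hac.ae_le (ae_armProp_tilt_mem (μ := P) (histSigma_le t) (measurable_treat t) b hS hK h0 hε)]
      with z h1 h2 h3 h4
    exact ⟨h1, h2, h3, h4⟩
  filter_upwards [harm, hac.ae_le (h.ratio_le t),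
    hac.ae_le (ae_ratio_eq (a := a) (s := s) (P := P) t),
    ae_ratio_eq (a := a) (s := s) (P := tilt P S ε) t] with z h1 h2 h3 h4
  obtain ⟨hpos, e1, e2, l1, l2⟩ := h1 (treat t z)
  have hpos := hpos rfl
  have hsl := armFlip_sub_armFlip (a := a) (s := s) (P := P) (tilt P S ε) t (treat t z) z
  have hLz := hL _ (targetScore_mem (a := a) (P := P) t z) _
    (targetScore_mem (a := a) (P := tilt P S ε) t z)
  rw [h3, e1, abs_div, abs_of_pos hpos, div_le_iff₀ hpos] at h2
  rw [h4]
  rw [e1, e2] at hsl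
  rw [e2]
  set p := prop (tilt P S ε) t (treat t z) z
  set π := prop P t (treat t z) z
  set x := armFlip a s P t (treat t z) z
  have hC : 0 ≤ C := by
    by_contra hcon
    have := abs_nonneg x
    nlinarith
  have hp : 0 < p := by linarith
  rw [abs_div, abs_of_pos hp, div_le_iff₀ hp, sub_eq_iff_eq_add.1 hsl]
  have hd : |p - π| ≤ p + π := by rw [abs_le]; constructor <;> linarith
  calc _ ≤ |flipSlope (s t) (targetScore a P t z) (targetScore a (tilt P S ε) t z)| * |p - π|
        + |x| := by rw [← abs_mul]; exact abs_add_le _ _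
    _ ≤ L * (p + π) + C * π := by gcongr
    _ ≤ L * (p + 3 * p) + C * (3 * p) := by gcongr
    _ = _ := by ring

/-- Either identification condition passes to a bounded tilt, since propensity scores under the tilt
vanish only where they vanish under `P`. -/
lemma InModel.identification_tilt (h : InModel a s C P)
    (hS : Measurable S) (hK : ∀ z, |S z| ≤ K) (h0 : ∫ z, S z ∂P = 0) (hε : |ε| * K ≤ 1 / 2) :
    (∀ t, ∀ᵐ z ∂tilt P S ε, prop (tilt P S ε) t (a t) z = 0 →
      s t (prop (tilt P S ε) t (a t) z) = 0) ∨
    (∀ t, (tilt P S ε) {z | prop (tilt P S ε) t (a t) z = 0} = 0) := by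
  have := h.isProb
  have hac : tilt P S ε ≪ P := tilt_absolutelyContinuous
  have hz : ∀ t, ∀ᵐ z ∂tilt P S ε, 0 ≤ prop P t (a t) z ∧
      prop P t (a t) z ≤ 3 * prop (tilt P S ε) t (a t) z := fun t => by
    filter_upwards [hac.ae_le (ae_armProp_tilt_mem (μ := P) (histSigma_le t)
      (measurable_treat t) (a t) hS hK h0 hε),
      hac.ae_le (ae_armProp_nonneg (m := histSigma T d t) (μ := P) (A := treat t) (a t))]
      with z h1 h2
    exact ⟨h2, h1.1⟩
  rcases h.identification with h1 | h1
  · refine .inl fun t => ?_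
    filter_upwards [hz t, hac.ae_le (h1 t)] with z hz h2 hQ
    have hP : prop P t (a t) z = 0 := by linarith [hz.1, hz.2]
    rw [hQ]
    rw [hP] at h2
    exact h2 rfl
  · refine .inr fun t => ?_
    have h2 : ∀ᵐ z ∂P, prop P t (a t) z ≠ 0 := by rw [ae_iff]; simpa using h1 t
    have h3 : ∀ᵐ z ∂tilt P S ε, prop (tilt P S ε) t (a t) z ≠ 0 := by
      filter_upwards [hz t, hac.ae_le h2] with z hz h2 hQ
      exact h2 (by linarith [hz.1, hz.2])
    rw [ae_iff] at h3
    simpa using h3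

/-- The bounded tilts of a law in the model form a submodel of the nonparametric model. -/
theorem InModel.tilt_mem_nonparametricSubmodels (h : InModel a s C P)
    (hs : ∀ t, IsSmoothWeight (s t)) (hS : Measurable S) (hK : ∃ K, ∀ z, |S z| ≤ K)
    (h0 : ∫ z, S z ∂P = 0) : tilt P S ∈ nonparametricSubmodels d a s := by
  have := h.isProb
  obtain ⟨K, hK⟩ := hK
  choose L hL0 hL using fun t => (hs t).exists_abs_flipSlope_le
  refine ⟨max (2 * ∫ z, outcome z ^ 2 ∂P) (3 * C + 4 * ∑ t, L t), ?_⟩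
  filter_upwards [eventually_abs_mul_le K] with ε hε
  have hprob := isProbabilityMeasure_tilt (μ := P) hS hK h0 hε
  have hle := tilt_le (μ := P) hK hε
  have hL2 : MemLp outcome 2 (tilt P S ε) := h.memLp.of_measure_le_smul ENNReal.ofReal_ne_top hle
  refine ⟨hprob, hL2, ?_, fun t => ?_, h.identification_tilt hS hK h0 hε⟩
  · refine (variance_le_expectation_sq hL2.1).trans (le_trans ?_ (le_max_left _ _))
    have hi : Integrable (fun z => outcome z ^ 2) (ENNReal.ofReal 2 • P) :=
      ((memLp_two_iff_integrable_sq h.memLp.1).1 h.memLp).smul_measure ENNReal.ofReal_ne_top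
    calc _ = ∫ z, outcome z ^ 2 ∂tilt P S ε := rfl
      _ ≤ ∫ z, outcome z ^ 2 ∂(ENNReal.ofReal 2 • P) :=
          integral_mono_measure hle (Eventually.of_forall fun z => sq_nonneg _) hi
      _ = _ := by rw [integral_smul_measure]; norm_num
  · filter_upwards [h.ae_ratio_tilt_le t (hL0 t) (hL t) hS hK h0 hε] with z hz
    refine hz.trans (le_trans ?_ (le_max_right _ _))
    have := Finset.single_le_sum (f := L) (fun i _ => hL0 i) (Finset.mem_univ t)
    linarith

/-- The canonical gradient of the identified mean. -/
theorem InModel.isEfficientInfluenceFunction (h : InModel a s C P)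
    (hs : ∀ t, IsSmoothWeight (s t)) :
    IsEfficientInfluenceFunction (nonparametricSubmodels d a s) (identifiedMean a s) P
      (fun z => phiM a s P z + phiQ a s P z) := by
  have := h.isProb
  have hP1 := h.mono (le_max_left C 1)
  have hae := hP1.ae_phi_eq hs
  have hL2 : MemLp (fun z => phiM a s P z + phiQ a s P z) 2 P :=
    (memLp_congr_ae hae).2 (hP1.memLp_gradFun hs (le_max_right C 1))
  have hmean : ∫ z, (phiM a s P z + phiQ a s P z) ∂P = 0 :=
    (integral_congr_ae hae).trans (hP1.integral_gradFun hs (le_max_right C 1))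
  refine ⟨hL2, hmean, fun γ hγ S hS => ?_,
    mem_tangentSpace_of_forall_tilt (fun S hS hK h0 =>
      h.tilt_mem_nonparametricSubmodels hs hS hK h0) hL2 hmean⟩
  obtain ⟨C', hγ⟩ := hγ
  -- a bound that serves both the law and the submodel
  have hP2 := h.mono ((le_max_left C 1).trans (le_max_left _ C'))
  have hC2 : 1 ≤ max (max C 1) C' := (le_max_right C 1).trans (le_max_left _ C')
  have hd := hP2.hasDerivAt_identifiedMean hs hC2
    (hγ.mono fun ε hε => hε.mono (le_max_right (max C 1) C')) hS
  refine hd.congr_deriv (integral_congr_ae ?_)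
  filter_upwards [hP2.ae_phi_eq hs] with z hz
  rw [hz]

end TiltModel

/-! ### Conditional independence and randomization -/

section Randomization

/-- Conditional expectations given a function of `Z` may be computed under the law of `Z`. -/
lemma condExp_map_comp_ae_eq {Ω 𝒵 ℋ : Type*} [MeasurableSpace Ω] [MeasurableSpace 𝒵]
    [mℋ : MeasurableSpace ℋ] {μ : Measure Ω} [IsProbabilityMeasure μ] {Z : Ω → 𝒵}
    (hZ : Measurable Z) {η : 𝒵 → ℋ} (hη : Measurable η) {f : 𝒵 → ℝ} (hf : Integrable f (μ.map Z)) :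
    (fun ω => ((μ.map Z)[f|mℋ.comap η]) (Z ω)) =ᵐ[μ]
      μ[fun ω => f (Z ω)|mℋ.comap fun ω => η (Z ω)] := by
  have : IsProbabilityMeasure (μ.map Z) := Measure.isProbabilityMeasure_map hZ.aemeasurable
  have hm : mℋ.comap (fun ω => η (Z ω)) ≤ ‹MeasurableSpace Ω› := (hη.comp hZ).comap_le
  have hc : Integrable ((μ.map Z)[f|mℋ.comap η]) (μ.map Z) := integrable_condExp
  refine ae_eq_condExp_of_forall_setIntegral_eq hm (hf.comp_measurable hZ)
    (fun _ _ _ => (hc.comp_measurable hZ).integrableOn) ?_ ?_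
  · rintro _ ⟨B, hB, rfl⟩ -
    have hS : MeasurableSet (η ⁻¹' B) := hη hB
    have e1 := setIntegral_map (μ := μ) hS hc.aestronglyMeasurable hZ.aemeasurable
    have e2 := setIntegral_map (μ := μ) hS hf.aestronglyMeasurable hZ.aemeasurable
    have e3 := setIntegral_condExp (μ := μ.map Z) hη.comap_le hf (s := η ⁻¹' B) ⟨B, hB, rfl⟩
    rw [e1, e2] at e3
    exact e3
  · have h1 : Measurable[mℋ.comap fun ω => η (Z ω), mℋ.comap η] Z := by
      rw [measurable_iff_comap_le, MeasurableSpace.comap_comp]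
      exact le_rfl
    exact (stronglyMeasurable_condExp.measurable.comp h1).stronglyMeasurable.aestronglyMeasurable

lemma lintegral_mul_condExp_indicator {Ω : Type*} {m mΩ : MeasurableSpace Ω} {μ : Measure Ω}
    [IsProbabilityMeasure μ] (hm : m ≤ mΩ) {F : Set Ω}
    (hF : MeasurableSet F) {g : Ω → ℝ≥0∞} (hg : Measurable[m] g) :
    ∫⁻ ω, g ω * ENNReal.ofReal ((μ⟦F|m⟧) ω) ∂μ = ∫⁻ ω in F, g ω ∂μ := by
  rw [lintegral_mul_ofReal_condExp hm ((integrable_const (1 : ℝ)).indicator hF)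
    (Eventually.of_forall fun ω => Set.indicator_nonneg (fun _ _ => zero_le_one) ω) hg,
    ← lintegral_indicator hF]
  refine lintegral_congr fun ω => ?_
  by_cases h : ω ∈ F <;> simp [h]

variable {Ω ℋ 𝒰 𝒳 : Type*} [mΩ : MeasurableSpace Ω] [StandardBorelSpace Ω]
  [mℋ : MeasurableSpace ℋ] [MeasurableSpace 𝒰] [MeasurableSpace 𝒳] {μ : Measure Ω}
  [IsProbabilityMeasure μ] {H : Ω → ℋ} {U : Ω → 𝒰} {X : Ω → 𝒳}

/-- If `U` and `X` are independent given `H`, then events of `(H, U)` and `X` are so as well. -/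
lemma measure_inter_eq_of_condIndepFun (hH : Measurable H) (hU : Measurable U) (hX : Measurable X)
    (h : CondIndepFun (mℋ.comap H) hH.comap_le U X μ) {E : Set 𝒳} (hE : MeasurableSet E)
    {B : Set (ℋ × 𝒰)} (hB : MeasurableSet B) :
    μ ((fun ω => (H ω, U ω)) ⁻¹' B ∩ X ⁻¹' E) =
      ∫⁻ ω in (fun ω => (H ω, U ω)) ⁻¹' B, ENNReal.ofReal ((μ⟦X ⁻¹' E|mℋ.comap H⟧) ω) ∂μ := by
  have hHU : Measurable fun ω => (H ω, U ω) := hH.prodMk hU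
  set q : Ω → ℝ := μ⟦X ⁻¹' E|mℋ.comap H⟧ with hq
  have hqm : Measurable[mℋ.comap H] q := stronglyMeasurable_condExp.measurable
  have key : (μ.restrict (X ⁻¹' E)).map (fun ω => (H ω, U ω)) =
      (μ.withDensity fun ω => ENNReal.ofReal (q ω)).map (fun ω => (H ω, U ω)) := by
    refine Measure.ext_prod fun {A F} hA hF => ?_
    have hAF := hHU (hA.prod hF)
    have hHA : MeasurableSet[mℋ.comap H] (H ⁻¹' A) := ⟨A, hA, rfl⟩
    rw [Measure.map_apply hHU (hA.prod hF), Measure.map_apply hHU (hA.prod hF),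
      Measure.restrict_apply hAF, withDensity_apply _ hAF]
    have e0 : (fun ω => (H ω, U ω)) ⁻¹' (A ×ˢ F) = H ⁻¹' A ∩ U ⁻¹' F := rfl
    rw [e0]
    have hone : Measurable[mℋ.comap H] ((H ⁻¹' A).indicator fun _ => (1 : ℝ≥0∞)) :=
      measurable_const.indicator hHA
    have e1 := lintegral_mul_condExp_indicator (μ := μ) hH.comap_le ((hU hF).inter (hX hE)) hone
    have e2 := lintegral_mul_condExp_indicator (μ := μ) hH.comap_le (hU hF)
      (hone.mul hqm.ennreal_ofReal)
    have e3 : ∫⁻ ω in U ⁻¹' F ∩ X ⁻¹' E, (H ⁻¹' A).indicator (fun _ => (1 : ℝ≥0∞)) ω ∂μ =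
        μ (H ⁻¹' A ∩ U ⁻¹' F ∩ X ⁻¹' E) := by
      rw [lintegral_indicator (hH hA), setLIntegral_one, Measure.restrict_apply (hH hA),
        Set.inter_assoc]
    have e4 : ∫⁻ ω in U ⁻¹' F, (H ⁻¹' A).indicator (fun _ => (1 : ℝ≥0∞)) ω *
        ENNReal.ofReal (q ω) ∂μ = ∫⁻ ω in H ⁻¹' A ∩ U ⁻¹' F, ENNReal.ofReal (q ω) ∂μ := by
      rw [← Measure.restrict_restrict (hH hA), ← lintegral_indicator (hH hA)]
      refine lintegral_congr fun ω => ?_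
      by_cases hω : ω ∈ H ⁻¹' A <;> simp [hω]
    rw [← e3, ← e1, ← e4]
    refine Eq.trans ?_ e2
    refine lintegral_congr_ae ?_
    filter_upwards [(condIndepFun_iff_condExp_inter_preimage_eq_mul hU hX).1 h F E hF hE,
      condExp_nonneg (μ := μ) (m := mℋ.comap H) (f := (U ⁻¹' F).indicator fun _ => (1 : ℝ))
        (Eventually.of_forall fun ω => Set.indicator_nonneg (fun _ _ => zero_le_one) ω)]
      with ω h1 h2
    have h2' : 0 ≤ (μ⟦U ⁻¹' F|mℋ.comap H⟧) ω := h2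
    rw [h1, ENNReal.ofReal_mul h2', mul_comm (ENNReal.ofReal _), ← mul_assoc]
    rfl
  have := congrArg (fun ν => ν B) key
  simp only [Measure.map_apply hHU hB] at this
  rwa [Measure.restrict_apply (hHU hB), withDensity_apply _ (hHU hB)] at this

/-- Under conditional independence given `H`, an event of `(H, U)` may be replaced by its
conditional probability in integrals of functions of `(H, X)`. -/
lemma setLIntegral_eq_of_condIndepFun (hH : Measurable H) (hU : Measurable U) (hX : Measurable X)
    (h : CondIndepFun (mℋ.comap H) hH.comap_le U X μ) {B : Set (ℋ × 𝒰)} (hB : MeasurableSet B)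
    {p : Ω → ℝ} (hp : p =ᵐ[μ] μ⟦(fun ω => (H ω, U ω)) ⁻¹' B|mℋ.comap H⟧)
    {φ : ℋ × 𝒳 → ℝ≥0∞} (hφ : Measurable φ) :
    ∫⁻ ω in (fun ω => (H ω, U ω)) ⁻¹' B, φ (H ω, X ω) ∂μ =
      ∫⁻ ω, ENNReal.ofReal (p ω) * φ (H ω, X ω) ∂μ := by
  have hHU : Measurable fun ω => (H ω, U ω) := hH.prodMk hU
  have hHX : Measurable fun ω => (H ω, X ω) := hH.prodMk hX
  set D := (fun ω => (H ω, U ω)) ⁻¹' B with hD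
  have hDm : MeasurableSet D := hHU hB
  set q : Ω → ℝ := μ⟦D|mℋ.comap H⟧ with hq
  have hqm : Measurable[mℋ.comap H] q := stronglyMeasurable_condExp.measurable
  have hqm' : Measurable q := hqm.mono hH.comap_le le_rfl
  have key : (μ.restrict D).map (fun ω => (H ω, X ω)) =
      (μ.withDensity fun ω => ENNReal.ofReal (q ω)).map (fun ω => (H ω, X ω)) := by
    refine Measure.ext_prod fun {A E} hA hE => ?_
    have hAE := hHX (hA.prod hE)
    have hHA : MeasurableSet[mℋ.comap H] (H ⁻¹' A) := ⟨A, hA, rfl⟩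
    rw [Measure.map_apply hHX (hA.prod hE), Measure.map_apply hHX (hA.prod hE),
      Measure.restrict_apply hAE, withDensity_apply _ hAE]
    have e0 : (fun ω => (H ω, X ω)) ⁻¹' (A ×ˢ E) = H ⁻¹' A ∩ X ⁻¹' E := rfl
    rw [e0]
    have hone : Measurable[mℋ.comap H] ((H ⁻¹' A).indicator fun _ => (1 : ℝ≥0∞)) :=
      measurable_const.indicator hHA
    set r : Ω → ℝ := μ⟦X ⁻¹' E|mℋ.comap H⟧ with hr
    have hrm : Measurable[mℋ.comap H] r := stronglyMeasurable_condExp.measurable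
    have e1 := measure_inter_eq_of_condIndepFun hH hU hX h hE
      (hB.inter (hA.prod MeasurableSet.univ))
    have e2 : (fun ω => (H ω, U ω)) ⁻¹' (B ∩ A ×ˢ Set.univ) = D ∩ H ⁻¹' A := by
      ext ω; simp [hD]
    have e3 := lintegral_mul_condExp_indicator (μ := μ) hH.comap_le hDm
      (hone.mul hrm.ennreal_ofReal)
    have e4 := lintegral_mul_condExp_indicator (μ := μ) hH.comap_le (hX hE)
      (hone.mul hqm.ennreal_ofReal)
    have e5 : ∀ (G : Set Ω) (f : Ω → ℝ≥0∞),
        ∫⁻ ω in G, (H ⁻¹' A).indicator (fun _ => (1 : ℝ≥0∞)) ω * f ω ∂μ =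
          ∫⁻ ω in H ⁻¹' A ∩ G, f ω ∂μ := fun G f => by
      rw [← Measure.restrict_restrict (hH hA), ← lintegral_indicator (hH hA)]
      refine lintegral_congr fun ω => ?_
      by_cases hω : ω ∈ H ⁻¹' A <;> simp [hω]
    rw [e2] at e1
    calc μ (H ⁻¹' A ∩ X ⁻¹' E ∩ D) = μ (D ∩ H ⁻¹' A ∩ X ⁻¹' E) := by
          congr 1; ext ω; simp only [Set.mem_inter_iff]; tauto
      _ = ∫⁻ ω in D ∩ H ⁻¹' A, ENNReal.ofReal (r ω) ∂μ := e1
      _ = ∫⁻ ω in H ⁻¹' A ∩ D, ENNReal.ofReal (r ω) ∂μ := by rw [Set.inter_comm]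
      _ = ∫⁻ ω in D, (H ⁻¹' A).indicator (fun _ => (1 : ℝ≥0∞)) ω * ENNReal.ofReal (r ω) ∂μ :=
          (e5 D _).symm
      _ = ∫⁻ ω, (H ⁻¹' A).indicator (fun _ => (1 : ℝ≥0∞)) ω * ENNReal.ofReal (r ω) *
            ENNReal.ofReal (q ω) ∂μ := e3.symm
      _ = ∫⁻ ω, (H ⁻¹' A).indicator (fun _ => (1 : ℝ≥0∞)) ω * ENNReal.ofReal (q ω) *
            ENNReal.ofReal (r ω) ∂μ := lintegral_congr fun ω => by ring
      _ = ∫⁻ ω in X ⁻¹' E, (H ⁻¹' A).indicator (fun _ => (1 : ℝ≥0∞)) ω *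
            ENNReal.ofReal (q ω) ∂μ := e4
      _ = _ := e5 _ _
  calc ∫⁻ ω in D, φ (H ω, X ω) ∂μ = ∫⁻ x, φ x ∂((μ.restrict D).map fun ω => (H ω, X ω)) :=
        (lintegral_map hφ hHX).symm
    _ = ∫⁻ ω, φ (H ω, X ω) ∂(μ.withDensity fun ω => ENNReal.ofReal (q ω)) := by
        rw [key, lintegral_map hφ hHX]
    _ = ∫⁻ ω, ENNReal.ofReal (q ω) * φ (H ω, X ω) ∂μ :=
        lintegral_withDensity_eq_lintegral_mul _ hqm'.ennreal_ofReal (hφ.comp hHX)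
    _ = _ := by
        refine lintegral_congr_ae ?_
        filter_upwards [hp] with ω hω
        rw [hω]

/-- A uniform variable falls below a level in `[0,1]` with that probability. -/
lemma lintegral_ite_le_uniform {c : ℝ} (hc : c ∈ Set.Icc (0 : ℝ) 1) (α β : ℝ≥0∞) :
    ∫⁻ x in Set.Icc (0 : ℝ) 1, (if x ≤ c then α else β) =
      ENNReal.ofReal c * α + ENNReal.ofReal (1 - c) * β := by
  have h1 : ∀ x : ℝ, (if x ≤ c then α else β) =
      (Set.Iic c).indicator (fun _ => α) x + (Set.Ioi c).indicator (fun _ => β) x := fun x => by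
    by_cases hx : x ≤ c
    · simp [hx]
    · simp [hx, not_le.1 hx]
  simp only [h1]
  rw [lintegral_add_left (measurable_const.indicator measurableSet_Iic),
    lintegral_indicator_const measurableSet_Iic, lintegral_indicator_const measurableSet_Ioi,
    Measure.restrict_apply measurableSet_Iic, Measure.restrict_apply measurableSet_Ioi]
  have e1 : Set.Iic c ∩ Set.Icc 0 1 = Set.Icc 0 c := by
    ext x; simp only [Set.mem_inter_iff, Set.mem_Iic, Set.mem_Icc]
    exact ⟨fun h => ⟨h.2.1, h.1⟩, fun h => ⟨h.2, h.1, h.2.trans hc.2⟩⟩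
  have e2 : Set.Ioi c ∩ Set.Icc 0 1 = Set.Ioc c 1 := by
    ext x; simp only [Set.mem_inter_iff, Set.mem_Ioi, Set.mem_Icc, Set.mem_Ioc]
    exact ⟨fun h => ⟨h.1, h.2.2⟩, fun h => ⟨h.1, hc.1.trans h.1.le, h.2⟩⟩
  rw [e1, e2, Real.volume_Icc, Real.volume_Ioc, sub_zero, mul_comm, mul_comm β]

end Randomization

/-! ### Trajectories under partial interventions -/

section Trajectories

variable {T d : ℕ} {UX UA : Fin T → Type v} {UY : Type v}
  [∀ t, MeasurableSpace (UX t)] [∀ t, MeasurableSpace (UA t)] [MeasurableSpace UY]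

/-- Values of the exogenous variables that act after the treatment at time `t`. -/
abbrev LaterExo (UX UA : Fin T → Type v) (UY : Type v) (t : Fin T) : Type v :=
  (∀ i : Set.Ioi t, UX i.1) × (∀ i : Set.Ioi t, UA i.1) × UY

/-- The exogenous variables that act after the treatment at time `t`. -/
def laterExo (t : Fin T) (w : Exo UX UA UY) : LaterExo UX UA UY t :=
  (fun i => w.1 i.1, fun i => w.2.1 i.1, w.2.2)

lemma measurable_laterExo (t : Fin T) : Measurable (laterExo (UX := UX) (UA := UA) (UY := UY) t) :=
  (measurable_pi_lambda _ fun i => (measurable_pi_apply i.1).comp measurable_fst).prodMk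
    ((measurable_pi_lambda _ fun i => (measurable_pi_apply i.1).comp
      (measurable_fst.comp measurable_snd)).prodMk (measurable_snd.comp measurable_snd))

/-- The interventions `δ` from time `k` on, and no intervention before. -/
def startAt (k : ℕ) (δ : ∀ t, Hist T d t → Bool → Bool) : ∀ t, Hist T d t → Bool → Bool :=
  fun t h n => if t.val < k then n else δ t h n

namespace NPSEM

variable (M : NPSEM T d UX UA UY)

lemma traj_fst (δ : ∀ t, Hist T d t → Bool → Bool) (w : Exo UX UA UY) (t : Fin T) :
    (M.traj δ w t).1 = M.fX t (fun i => M.traj δ w i.1, w.1 t) := by rw [traj]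

lemma traj_snd (δ : ∀ t, Hist T d t → Bool → Bool) (w : Exo UX UA UY) (t : Fin T) :
    (M.traj δ w t).2 = δ t (histOf t (M.traj δ w)) (M.fA t (histOf t (M.traj δ w), w.2.1 t)) := by
  rw [histOf, traj_fst, traj]

lemma traj_congr {δ δ' : ∀ t, Hist T d t → Bool → Bool} (w : Exo UX UA UY) (t : Fin T)
    (h : ∀ j ≤ t, δ j = δ' j) : M.traj δ w t = M.traj δ' w t := by
  induction t using WellFoundedLT.induction with
  | ind t ih =>
    have hp : (fun i : Set.Iio t => M.traj δ w i.1) = fun i : Set.Iio t => M.traj δ' w i.1 :=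
      funext fun i => ih i.1 i.2 fun j hj => h j (hj.trans (le_of_lt i.2))
    rw [traj, traj, hp, h t le_rfl]

lemma histOf_traj_congr {δ δ' : ∀ t, Hist T d t → Bool → Bool} (w : Exo UX UA UY) (t : Fin T)
    (h : ∀ j < t, δ j = δ' j) : histOf t (M.traj δ w) = histOf t (M.traj δ' w) := by
  have hp : (fun i : Set.Iio t => M.traj δ w i.1) = fun i : Set.Iio t => M.traj δ' w i.1 :=
    funext fun i => M.traj_congr w i.1 fun j hj => h j (hj.trans_lt i.2)
  rw [histOf, histOf, traj_fst, traj_fst, hp]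

/-- The trajectory that continues a given history `h` and treatment `b` at time `t`. -/
def resume (δ : ∀ t, Hist T d t → Bool → Bool) (t : Fin T) (h : Hist T d t) (b : Bool)
    (u : LaterExo UX UA UY t) (i : Fin T) : Cov d × Bool :=
  if h1 : i < t then h.1 ⟨i, h1⟩
  else if h2 : t < i then
    let past : Past T d i := fun j => resume δ t h b u j.1
    let h' : Hist T d i := (past, M.fX i (past, u.1 ⟨i, h2⟩))
    (h'.2, δ i h' (M.fA i (h', u.2.1 ⟨i, h2⟩)))
  else (h.2, b)
termination_by i
decreasing_by exact j.2

lemma traj_eq_resume (δ : ∀ t, Hist T d t → Bool → Bool) (w : Exo UX UA UY) (t : Fin T) :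
    M.traj δ w = M.resume δ t (histOf t (M.traj δ w)) (M.traj δ w t).2 (laterExo t w) := by
  funext i
  induction i using WellFoundedLT.induction with
  | ind i ih =>
    rw [resume]
    split_ifs with h1 h2
    · rfl
    · have hp : (fun j : Set.Iio i => M.resume δ t (histOf t (M.traj δ w)) (M.traj δ w t).2
          (laterExo t w) j.1) = fun j : Set.Iio i => M.traj δ w j.1 :=
        funext fun j => (ih j.1 j.2).symm
      rw [hp, traj]
      rfl
    · obtain rfl : i = t := le_antisymm (not_lt.1 h2) (not_lt.1 h1)
      rfl

lemma resume_congr {δ δ' : ∀ t, Hist T d t → Bool → Bool} (t : Fin T) (h : Hist T d t) (b : Bool)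
    (u : LaterExo UX UA UY t) (hδ : ∀ j, t < j → δ j = δ' j) :
    M.resume δ t h b u = M.resume δ' t h b u := by
  funext i
  induction i using WellFoundedLT.induction with
  | ind i ih =>
    rw [resume, resume]
    split_ifs with h1 h2
    · rfl
    · have hp : (fun j : Set.Iio i => M.resume δ t h b u j.1) =
          fun j : Set.Iio i => M.resume δ' t h b u j.1 := funext fun j => ih j.1 j.2
      rw [hp, hδ i h2]
    · rfl

section Measurability

variable {Θ : Type*} [MeasurableSpace Θ] {δ : Θ → ∀ t, Hist T d t → Bool → Bool}

lemma measurable_traj_param (hδ : ∀ t, Measurable fun x : Θ × Hist T d t × Bool =>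
      δ x.1 t x.2.1 x.2.2) (t : Fin T) :
    Measurable fun x : Θ × Exo UX UA UY => M.traj (δ x.1) x.2 t := by
  induction t using WellFoundedLT.induction with
  | ind t ih =>
    have hp : Measurable fun x : Θ × Exo UX UA UY =>
        (fun i => M.traj (δ x.1) x.2 i.1 : Past T d t) :=
      measurable_pi_lambda _ fun (i : Set.Iio t) => ih i.1 i.2
    have hx := (M.measurable_fX t).comp
      (hp.prodMk ((measurable_pi_apply t).comp (measurable_fst.comp measurable_snd)))
    have hA := (M.measurable_fA t).comp ((hp.prodMk hx).prodMk
      ((measurable_pi_apply t).comp (measurable_fst.comp (measurable_snd.comp measurable_snd))))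
    have := hx.prodMk ((hδ t).comp (measurable_fst.prodMk ((hp.prodMk hx).prodMk hA)))
    convert this using 2 with x
    rw [traj]
    rfl

lemma measurable_resume_param (hδ : ∀ t, Measurable fun x : Θ × Hist T d t × Bool =>
      δ x.1 t x.2.1 x.2.2) (t : Fin T) (b : Bool) (i : Fin T) :
    Measurable fun x : Θ × Hist T d t × LaterExo UX UA UY t =>
      M.resume (δ x.1) t x.2.1 b x.2.2 i := by
  induction i using WellFoundedLT.induction with
  | ind i ih =>
    have hH : Measurable fun x : Θ × Hist T d t × LaterExo UX UA UY t => x.2.1 :=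
      measurable_fst.comp measurable_snd
    by_cases h1 : i < t
    · have : (fun x : Θ × Hist T d t × LaterExo UX UA UY t =>
          M.resume (δ x.1) t x.2.1 b x.2.2 i) = fun x => x.2.1.1 ⟨i, h1⟩ := by
        funext x; rw [resume, dif_pos h1]
      rw [this]
      exact (measurable_pi_apply _).comp (measurable_fst.comp hH)
    by_cases h2 : t < i
    · have hp : Measurable fun x : Θ × Hist T d t × LaterExo UX UA UY t =>
          (fun j => M.resume (δ x.1) t x.2.1 b x.2.2 j.1 : Past T d i) :=
        measurable_pi_lambda _ fun (j : Set.Iio i) => ih j.1 j.2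
      have hx := (M.measurable_fX i).comp (hp.prodMk
        ((measurable_pi_apply (⟨i, h2⟩ : Set.Ioi t)).comp
          (measurable_fst.comp (measurable_snd.comp measurable_snd))))
      have hA := (M.measurable_fA i).comp ((hp.prodMk hx).prodMk
        ((measurable_pi_apply (⟨i, h2⟩ : Set.Ioi t)).comp
          (measurable_fst.comp (measurable_snd.comp (measurable_snd.comp measurable_snd)))))
      have := hx.prodMk ((hδ i).comp (measurable_fst.prodMk ((hp.prodMk hx).prodMk hA)))
      convert this using 2 with x
      rw [resume, dif_neg h1, dif_pos h2]
      rfl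
    · have : (fun x : Θ × Hist T d t × LaterExo UX UA UY t =>
          M.resume (δ x.1) t x.2.1 b x.2.2 i) = fun x => (x.2.1.2, b) := by
        funext x; rw [resume, dif_neg h1, dif_neg h2]
      rw [this]
      exact (measurable_snd.comp hH).prodMk measurable_const

end Measurability

lemma measurable_flip {a : Fin T → Bool} {f : ∀ t, Hist T d t → ℝ} (hf : ∀ t, Measurable (f t))
    (t : Fin T) : Measurable fun x : (Fin T → ℝ) × Hist T d t × Bool =>
      flip a f x.1 t x.2.1 x.2.2 := by
  have hn : Measurable fun x : (Fin T → ℝ) × Hist T d t × Bool => x.2.2 :=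
    measurable_snd.comp measurable_snd
  refine Measurable.ite (hn (measurableSet_singleton (a t))) hn (Measurable.ite
    (measurableSet_le ((measurable_pi_apply t).comp measurable_fst)
      ((hf t).comp (measurable_fst.comp measurable_snd))) measurable_const hn)

/-- The outcome when the history at time `t` is `h`, the treatment at time `t` is `b`, and the
interventions `δ` are made after time `t`. -/
def resumeOutcome (δ : ∀ t, Hist T d t → Bool → Bool) (t : Fin T) (h : Hist T d t) (b : Bool)
    (u : LaterExo UX UA UY t) : ℝ := M.fY (M.resume δ t h b u, u.2.2)

lemma measurable_resumeOutcome {Θ : Type*} [MeasurableSpace Θ]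
    {δ : Θ → ∀ t, Hist T d t → Bool → Bool}
    (hδ : ∀ t, Measurable fun x : Θ × Hist T d t × Bool => δ x.1 t x.2.1 x.2.2) (t : Fin T)
    (b : Bool) : Measurable fun x : Θ × Hist T d t × LaterExo UX UA UY t =>
      M.resumeOutcome (δ x.1) t x.2.1 b x.2.2 :=
  M.measurable_fY.comp ((measurable_pi_lambda _ fun i => M.measurable_resume_param hδ t b i).prodMk
    (measurable_snd.comp (measurable_snd.comp (measurable_snd.comp measurable_snd))))

lemma measurable_outcomeUnder_param {Θ : Type*} [MeasurableSpace Θ]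
    {δ : Θ → ∀ t, Hist T d t → Bool → Bool}
    (hδ : ∀ t, Measurable fun x : Θ × Hist T d t × Bool => δ x.1 t x.2.1 x.2.2) :
    Measurable fun x : Θ × Exo UX UA UY => M.outcomeUnder (δ x.1) x.2 :=
  M.measurable_fY.comp ((measurable_pi_lambda _ fun i => M.measurable_traj_param hδ i).prodMk
    (measurable_snd.comp (measurable_snd.comp measurable_snd)))

lemma measurable_observed : Measurable M.observed :=
  (measurable_pi_lambda _ fun t => M.measurable_traj t).prodMk
    (M.measurable_fY.comp ((measurable_pi_lambda _ fun t => M.measurable_traj t).prodMk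
      (measurable_snd.comp measurable_snd)))

lemma outcomeUnder_startAt_succ (δ : ∀ t, Hist T d t → Bool → Bool) (t : Fin T)
    (w : Exo UX UA UY) : M.outcomeUnder (startAt (t + 1) δ) w =
      M.resumeOutcome δ t (hist t (M.observed w)) (treat t (M.observed w)) (laterExo t w) := by
  have h0 : ∀ j ≤ t, startAt (t + 1) δ j = noIntervention T d j := fun j hj => by
    funext h n
    exact if_pos (Nat.lt_succ_of_le (Fin.le_def.1 hj))
  have h1 : ∀ j, t < j → startAt (t + 1) δ j = δ j := fun j hj => by
    funext h n
    exact if_neg (not_lt.2 (Nat.succ_le_of_lt (Fin.lt_def.1 hj)))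
  have e : M.traj (startAt (t + 1) δ) w =
      M.resume δ t (hist t (M.observed w)) (treat t (M.observed w)) (laterExo t w) := by
    rw [M.traj_eq_resume _ w t, M.histOf_traj_congr w t fun j hj => h0 j hj.le,
      M.traj_congr w t h0, M.resume_congr t _ _ _ h1]
    rfl
  rw [outcomeUnder, e]
  rfl

lemma outcomeUnder_startAt (δ : ∀ t, Hist T d t → Bool → Bool) (t : Fin T)
    (w : Exo UX UA UY) : M.outcomeUnder (startAt t δ) w =
      M.resumeOutcome δ t (hist t (M.observed w))
        (δ t (hist t (M.observed w)) (treat t (M.observed w))) (laterExo t w) := by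
  have h0 : ∀ j < t, startAt t δ j = noIntervention T d j := fun j hj => by
    funext h n
    exact if_pos (Fin.lt_def.1 hj)
  have h1 : ∀ j, t ≤ j → startAt t δ j = δ j := fun j hj => by
    funext h n
    exact if_neg (not_lt.2 (Fin.le_def.1 hj))
  have hA : treat t (M.observed w) = M.fA t (hist t (M.observed w), w.2.1 t) :=
    M.traj_snd (noIntervention T d) w t
  have e : M.traj (startAt t δ) w = M.resume δ t (hist t (M.observed w))
      (δ t (hist t (M.observed w)) (treat t (M.observed w))) (laterExo t w) := by
    rw [M.traj_eq_resume _ w t, traj_snd, M.histOf_traj_congr w t h0,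
      M.resume_congr t _ _ _ fun j hj => h1 j hj.le, h1 t le_rfl, hA]
    rfl
  rw [outcomeUnder, e]
  rfl

lemma startAt_zero (δ : ∀ t, Hist T d t → Bool → Bool) : startAt 0 δ = δ := by
  funext t h n; simp [startAt]

lemma outcomeUnder_startAt_last (δ : ∀ t, Hist T d t → Bool → Bool) (w : Exo UX UA UY) :
    M.outcomeUnder (startAt T δ) w = outcome (M.observed w) := by
  have : startAt T δ = noIntervention T d := by
    funext t h n; simp [startAt, noIntervention]
  rw [this]; rfl

end NPSEM

end Trajectories

/-! ### The counterfactual mean -/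

section CounterfactualMean

variable {T d : ℕ} {a : Fin T → Bool} {s : Fin T → ℝ → ℝ} {C : ℝ} {P : Measure (Obs T d)}

lemma armScore_nonneg (t : Fin T) (b : Bool) (z : Obs T d) : 0 ≤ armScore a P t b z := by
  have h := targetScore_mem (a := a) (P := P) t z
  unfold armScore
  split_ifs
  · exact h.1
  · linarith [h.2]

lemma armFlip_nonneg (hs : ∀ t, IsSmoothWeight (s t)) (t : Fin T) (b : Bool) (z : Obs T d) :
    0 ≤ armFlip a s P t b z := by
  have h := targetScore_mem (a := a) (P := P) t z
  have h1 := (hs t).mapsTo h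
  unfold armFlip flipProb
  split_ifs
  · nlinarith [h.1, h.2, h1.1]
  · nlinarith [h.1, h.2, h1.2]

lemma flipWeight_nonneg (hs : ∀ t, IsSmoothWeight (s t)) (hC : 0 ≤ C) (t : Fin T) (b : Bool)
    (z : Obs T d) : 0 ≤ flipWeight a s C P t b z :=
  le_max_of_le_right (le_min hC (div_nonneg (armFlip_nonneg hs t b z) (armScore_nonneg t b z)))

lemma cumWeight_nonneg (hs : ∀ t, IsSmoothWeight (s t)) (hC : 0 ≤ C) (k : ℕ)
    (z : Obs T d) : 0 ≤ cumWeight a s C P k z :=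
  Finset.prod_nonneg fun j _ => flipWeight_nonneg hs hC j _ z

/-- The flip weights turn the propensity scores into the law of the flipped treatment: the target is
assigned when it is the natural value or when the switch occurs, the other treatment when it is the
natural value and no switch occurs. -/
lemma InModel.ae_prop_mul_flipWeight (h : InModel a s C P) (hs : ∀ t, IsSmoothWeight (s t))
    (t : Fin T) : ∀ᵐ z ∂P,
      prop P t (a t) z * flipWeight a s C P t (a t) z =
        prop P t (a t) z + prop P t (!(a t)) z * s t (prop P t (a t) z) ∧
      prop P t (!(a t)) z * flipWeight a s C P t (!(a t)) z =
        prop P t (!(a t)) z * (1 - s t (prop P t (a t) z)) ∧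
      0 ≤ prop P t (a t) z ∧ 0 ≤ prop P t (!(a t)) z := by
  have := h.isProb
  filter_upwards [h.ae_flipWeight_mul_prop hs t (a t), h.ae_flipWeight_mul_prop hs t (!(a t)),
    ae_armProp_not (μ := P) (histSigma_le t) (measurable_treat t) (a t),
    ae_armProp_nonneg (m := histSigma T d t) (μ := P) (A := treat t) (a t),
    ae_armProp_nonneg (m := histSigma T d t) (μ := P) (A := treat t) (!(a t))]
    with z h1 h2 h3 h4 h5
  have h3' : prop P t (!(a t)) z = 1 - prop P t (a t) z := h3
  refine ⟨?_, ?_, h4, h5⟩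
  · rw [mul_comm, h1, h3', intProp, if_pos rfl]; ring
  · rw [mul_comm, h2, h3', intProp, if_neg (by simp)]; ring

variable {UX UA : Fin T → Type v} {UY : Type v}
  [∀ t, MeasurableSpace (UX t)] [∀ t, MeasurableSpace (UA t)] [MeasurableSpace UY]
  {M : NPSEM T d UX UA UY} {f : ∀ t, Hist T d t → ℝ} {g : ℝ → ℝ≥0∞}

/-- Averaging over the auxiliary variable of time `t`: the later interventions do not depend on
it, so that it only randomizes the switch at time `t`. -/
lemma lintegral_resumeOutcome_flip (hf : ∀ t, Measurable (f t))
    (hf01 : ∀ t h, f t h ∈ Set.Icc (0 : ℝ) 1) (hg : Measurable g) (t : Fin T) (h : Hist T d t)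
    (n : Bool) (x : LaterExo UX UA UY t) :
    ∫⁻ v, g (M.resumeOutcome (NPSEM.flip a f v) t h (NPSEM.flip a f v t h n) x)
        ∂Measure.pi (fun _ => volume.restrict (Set.Icc (0 : ℝ) 1)) =
      ∫⁻ v, (if n = a t then g (M.resumeOutcome (NPSEM.flip a f v) t h (a t) x) else
        ENNReal.ofReal (f t h) * g (M.resumeOutcome (NPSEM.flip a f v) t h (a t) x) +
        ENNReal.ofReal (1 - f t h) * g (M.resumeOutcome (NPSEM.flip a f v) t h (!(a t)) x))
        ∂Measure.pi (fun _ => volume.restrict (Set.Icc (0 : ℝ) 1)) := by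
  have hG : ∀ b, Measurable fun v => g (M.resumeOutcome (NPSEM.flip a f v) t h b x) := fun b =>
    hg.comp ((M.measurable_resumeOutcome (NPSEM.measurable_flip (a := a) hf) t b).comp
      (measurable_id.prodMk (measurable_const : Measurable fun _ : Fin T → ℝ => (h, x))))
  by_cases hn : n = a t
  · refine lintegral_congr fun v => ?_
    simp only [NPSEM.flip, hn, if_true]
  have hn' : n = !(a t) := by cases n <;> cases h : a t <;> simp_all
  have e : ∀ v : Fin T → ℝ,
      g (M.resumeOutcome (NPSEM.flip a f v) t h (NPSEM.flip a f v t h n) x) =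
      if v t ≤ f t h then g (M.resumeOutcome (NPSEM.flip a f v) t h (a t) x)
      else g (M.resumeOutcome (NPSEM.flip a f v) t h (!(a t)) x) := fun v => by
    simp only [NPSEM.flip, if_neg hn]
    split_ifs
    · rfl
    · rw [hn']
  simp only [e, if_neg hn]
  refine lintegral_eq_of_lmarginal_eq {t} ?_ ?_ ?_
  · exact Measurable.ite (measurableSet_le (measurable_pi_apply t) measurable_const) (hG _) (hG _)
  · exact ((hG _).const_mul _).add ((hG _).const_mul _)
  · rw [lmarginal_singleton, lmarginal_singleton]
    funext v
    have hc : ∀ (y : ℝ) b, M.resumeOutcome (NPSEM.flip a f (Function.update v t y)) t h b x =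
        M.resumeOutcome (NPSEM.flip a f v) t h b x := fun y b => by
      unfold NPSEM.resumeOutcome
      rw [M.resume_congr t h b x fun j hj => ?_]
      funext h' n'
      simp only [NPSEM.flip, Function.update_of_ne (ne_of_gt hj)]
    simp only [hc, Function.update_self]
    rw [lintegral_ite_le_uniform (hf01 t h), lintegral_const]
    simp

variable {Ω : Type u} [MeasurableSpace Ω] [StandardBorelSpace Ω] {μ : Measure Ω}
  [IsProbabilityMeasure μ] {W : Ω → Exo UX UA UY}

/-- Given the history, the natural treatment is independent of what happens later. -/
lemma NPSEM.StrongSequentialRandomization.setLIntegral_treat_eq {hW : Measurable W}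
    (h : M.StrongSequentialRandomization μ hW) (hmap : μ.map (fun ω => M.observed (W ω)) = P)
    (t : Fin T) (b : Bool) {φ : Hist T d t × LaterExo UX UA UY t → ℝ≥0∞} (hφ : Measurable φ) :
    ∫⁻ ω in {ω | treat t (M.observed (W ω)) = b},
        φ (hist t (M.observed (W ω)), laterExo t (W ω)) ∂μ =
      ∫⁻ ω, ENNReal.ofReal (prop P t b (M.observed (W ω))) *
        φ (hist t (M.observed (W ω)), laterExo t (W ω)) ∂μ := by
  have hZ : Measurable fun ω => M.observed (W ω) := M.measurable_observed.comp hW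
  have hU : Measurable fun ω => (W ω).2.1 t :=
    (measurable_pi_apply t).comp (measurable_fst.comp (measurable_snd.comp hW))
  have hB : MeasurableSet (M.fA t ⁻¹' {b}) := M.measurable_fA t (measurableSet_singleton b)
  have hD : {ω | treat t (M.observed (W ω)) = b} =
      (fun ω => (histOf t (M.traj (NPSEM.noIntervention T d) (W ω)), (W ω).2.1 t)) ⁻¹'
        (M.fA t ⁻¹' {b}) := by
    ext ω
    have : treat t (M.observed (W ω)) = M.fA t (hist t (M.observed (W ω)), (W ω).2.1 t) :=
      M.traj_snd (NPSEM.noIntervention T d) (W ω) t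
    simp only [Set.mem_ofPred_eq, this]
    rfl
  have hprob : IsProbabilityMeasure (μ.map fun ω => M.observed (W ω)) :=
    Measure.isProbabilityMeasure_map hZ.aemeasurable
  have hp := condExp_map_comp_ae_eq (μ := μ) hZ (measurable_hist t)
    (integrable_armInd (measurable_treat (d := d) t) b)
  have hI : (fun ω => armInd (treat t) b (M.observed (W ω))) =
      {ω | treat t (M.observed (W ω)) = b}.indicator fun _ => (1 : ℝ) := by
    funext ω
    by_cases hω : treat t (M.observed (W ω)) = b <;> simp [armInd, hω]
  rw [hI, hD, hmap] at hp
  rw [hD]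
  exact setLIntegral_eq_of_condIndepFun ((M.measurable_histOf_traj t).comp hW) hU
    ((measurable_laterExo t).comp hW) (h t) hB hp hφ

/-- Replacing the intervention at time `t` by no intervention is compensated by the flip weight
at time `t`. -/
lemma lintegral_startAt_succ (hs : ∀ t, IsSmoothWeight (s t)) (hP : InModel a s C P) (hC : 1 ≤ C)
    {hW : Measurable W} (hM : M.StrongSequentialRandomization μ hW)
    (hmap : μ.map (fun ω => M.observed (W ω)) = P) (hf : ∀ t, Measurable (f t))
    (hf01 : ∀ t h, f t h ∈ Set.Icc (0 : ℝ) 1)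
    (hfs : ∀ t, ∀ᵐ z ∂P, f t (hist t z) = s t (prop P t (a t) z))
    (hg : Measurable g) (t : Fin T) :
    ∫⁻ ω, ∫⁻ v, ENNReal.ofReal (cumWeight a s C P t (M.observed (W ω))) *
        g (M.outcomeUnder (startAt t (NPSEM.flip a f v)) (W ω))
        ∂Measure.pi (fun _ => volume.restrict (Set.Icc (0 : ℝ) 1)) ∂μ =
      ∫⁻ ω, ∫⁻ v, ENNReal.ofReal (cumWeight a s C P (t + 1) (M.observed (W ω))) *
        g (M.outcomeUnder (startAt (t + 1) (NPSEM.flip a f v)) (W ω))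
        ∂Measure.pi (fun _ => volume.restrict (Set.Icc (0 : ℝ) 1)) ∂μ := by
  have hC0 : 0 ≤ C := zero_le_one.trans hC
  have hZ : Measurable fun ω => M.observed (W ω) := M.measurable_observed.comp hW
  have hH : Measurable fun ω => hist t (M.observed (W ω)) := (measurable_hist t).comp hZ
  have hX : Measurable fun ω => laterExo t (W ω) := (measurable_laterExo t).comp hW
  have hA : Measurable fun ω => treat t (M.observed (W ω)) := (measurable_treat t).comp hZ
  -- the weights as functions of the history
  obtain ⟨ρ, hρ, eρ⟩ := (measurable_cumWeight (C := C) (a := a) (P := P) hs t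
    le_rfl).exists_eq_measurable_comp
  choose r hr er using fun b =>
    (measurable_flipWeight (C := C) (a := a) (P := P) hs t b).exists_eq_measurable_comp
  set G : Bool → (Fin T → ℝ) → Hist T d t × LaterExo UX UA UY t → ℝ≥0∞ := fun b v x =>
    g (M.resumeOutcome (NPSEM.flip a f v) t x.1 b x.2) with hGdef
  have hG2 : ∀ b, Measurable fun x : (Fin T → ℝ) × Hist T d t × LaterExo UX UA UY t =>
      G b x.1 x.2 := fun b => hg.comp (M.measurable_resumeOutcome (NPSEM.measurable_flip hf) t b)
  have hG : ∀ b v, Measurable (G b v) := fun b v =>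
    (hG2 b).comp (measurable_const.prodMk measurable_id)
  have hGΩ : ∀ b, Measurable fun x : Ω × (Fin T → ℝ) =>
      G b x.2 (hist t (M.observed (W x.1)), laterExo t (W x.1)) := fun b =>
    (hG2 b).comp (measurable_snd.prodMk ((hH.comp measurable_fst).prodMk (hX.comp measurable_fst)))
  have hm1 : Measurable fun x : Ω × (Fin T → ℝ) =>
      ENNReal.ofReal (ρ (hist t (M.observed (W x.1)))) :=
    ((hρ.comp hH).comp measurable_fst).ennreal_ofReal
  have hmA : MeasurableSet {x : Ω × (Fin T → ℝ) | treat t (M.observed (W x.1)) = a t} :=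
    (hA.comp measurable_fst) (measurableSet_singleton (a t))
  have eL : ∀ ω, ∫⁻ v, ENNReal.ofReal (cumWeight a s C P t (M.observed (W ω))) *
        g (M.outcomeUnder (startAt t (NPSEM.flip a f v)) (W ω))
        ∂Measure.pi (fun _ => volume.restrict (Set.Icc (0 : ℝ) 1)) =
      ∫⁻ v, ENNReal.ofReal (ρ (hist t (M.observed (W ω)))) *
        (if treat t (M.observed (W ω)) = a t then
          G (a t) v (hist t (M.observed (W ω)), laterExo t (W ω)) else
        ENNReal.ofReal (f t (hist t (M.observed (W ω)))) *
          G (a t) v (hist t (M.observed (W ω)), laterExo t (W ω)) +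
        ENNReal.ofReal (1 - f t (hist t (M.observed (W ω)))) *
          G (!(a t)) v (hist t (M.observed (W ω)), laterExo t (W ω)))
        ∂Measure.pi (fun _ => volume.restrict (Set.Icc (0 : ℝ) 1)) := fun ω => by
    rw [lintegral_const_mul' _ _ ENNReal.ofReal_ne_top,
      lintegral_const_mul' _ _ ENNReal.ofReal_ne_top, eρ]
    simp only [NPSEM.outcomeUnder_startAt, Function.comp_apply]
    rw [lintegral_resumeOutcome_flip hf hf01 hg]
  have eR : ∀ ω v, ENNReal.ofReal (cumWeight a s C P (t + 1) (M.observed (W ω))) *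
        g (M.outcomeUnder (startAt (t + 1) (NPSEM.flip a f v)) (W ω)) =
      ENNReal.ofReal (ρ (hist t (M.observed (W ω)))) *
        (if treat t (M.observed (W ω)) = a t then
          ENNReal.ofReal (r (a t) (hist t (M.observed (W ω)))) *
            G (a t) v (hist t (M.observed (W ω)), laterExo t (W ω)) else
          ENNReal.ofReal (r (!(a t)) (hist t (M.observed (W ω)))) *
            G (!(a t)) v (hist t (M.observed (W ω)), laterExo t (W ω))) := fun ω v => by
    rw [NPSEM.outcomeUnder_startAt_succ, cumWeight_succ,
      ENNReal.ofReal_mul (cumWeight_nonneg hs hC0 _ _), eρ, er, mul_assoc]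
    by_cases hn : treat t (M.observed (W ω)) = a t
    · simp only [hn, if_true, hGdef, Function.comp_apply]
    · have hn' : treat t (M.observed (W ω)) = !(a t) := by
        cases h1 : treat t (M.observed (W ω)) <;> cases h : a t <;> simp_all
      rw [if_neg hn, hn']
      simp only [hGdef, Function.comp_apply]
  simp only [eL, eR]
  have hmf : Measurable fun x : Ω × (Fin T → ℝ) => f t (hist t (M.observed (W x.1))) :=
    ((hf t).comp hH).comp measurable_fst
  have hmr : ∀ b, Measurable fun x : Ω × (Fin T → ℝ) => r b (hist t (M.observed (W x.1))) :=
    fun b => ((hr b).comp hH).comp measurable_fst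
  refine (lintegral_lintegral_swap (hm1.mul (Measurable.ite hmA (hGΩ (a t))
    ((hmf.ennreal_ofReal.mul (hGΩ (a t))).add
      ((measurable_const.sub hmf).ennreal_ofReal.mul (hGΩ (!(a t))))))).aemeasurable).trans
    (Eq.trans (lintegral_congr fun v => ?_) (lintegral_lintegral_swap (hm1.mul (Measurable.ite hmA
      ((hmr (a t)).ennreal_ofReal.mul (hGΩ (a t)))
      ((hmr (!(a t))).ennreal_ofReal.mul (hGΩ (!(a t)))))).aemeasurable).symm)
  -- condition on the history, on each arm
  have harm : ∀ φ ψ : Hist T d t × LaterExo UX UA UY t → ℝ≥0∞, Measurable φ → Measurable ψ →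
      ∫⁻ ω, ENNReal.ofReal (ρ (hist t (M.observed (W ω)))) *
        (if treat t (M.observed (W ω)) = a t then
          φ (hist t (M.observed (W ω)), laterExo t (W ω)) else
          ψ (hist t (M.observed (W ω)), laterExo t (W ω))) ∂μ =
      ∫⁻ ω, ENNReal.ofReal (ρ (hist t (M.observed (W ω)))) *
        (ENNReal.ofReal (prop P t (a t) (M.observed (W ω))) *
          φ (hist t (M.observed (W ω)), laterExo t (W ω)) +
        ENNReal.ofReal (prop P t (!(a t)) (M.observed (W ω))) *
          ψ (hist t (M.observed (W ω)), laterExo t (W ω))) ∂μ := fun φ ψ hφ hψ => by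
    have hρ' : Measurable fun x : Hist T d t × LaterExo UX UA UY t => ENNReal.ofReal (ρ x.1) :=
      (hρ.comp measurable_fst).ennreal_ofReal
    have hD : MeasurableSet {ω | treat t (M.observed (W ω)) = a t} :=
      hA (measurableSet_singleton (a t))
    have hDc : {ω | treat t (M.observed (W ω)) = a t}ᶜ =
        {ω | treat t (M.observed (W ω)) = !(a t)} := by
      ext ω
      simp only [Set.mem_compl_iff, Set.mem_ofPred_eq]
      cases treat t (M.observed (W ω)) <;> cases a t <;> simp
    have h1 := hM.setLIntegral_treat_eq hmap t (a t) (hρ'.mul hφ)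
    have h2 := hM.setLIntegral_treat_eq hmap t (!(a t)) (hρ'.mul hψ)
    have hmp : ∀ b, Measurable fun ω => ENNReal.ofReal (prop P t b (M.observed (W ω))) := fun b =>
      (((measurable_prop t b).mono (histSigma_le t) le_rfl).comp hZ).ennreal_ofReal
    rw [← lintegral_add_compl _ hD]
    calc _ = ∫⁻ ω in {ω | treat t (M.observed (W ω)) = a t},
            ENNReal.ofReal (ρ (hist t (M.observed (W ω)))) *
              φ (hist t (M.observed (W ω)), laterExo t (W ω)) ∂μ +
          ∫⁻ ω in {ω | treat t (M.observed (W ω)) = !(a t)},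
            ENNReal.ofReal (ρ (hist t (M.observed (W ω)))) *
              ψ (hist t (M.observed (W ω)), laterExo t (W ω)) ∂μ := by
          congr 1
          · refine setLIntegral_congr_fun hD fun ω hω => ?_
            have hω' : treat t (M.observed (W ω)) = a t := hω
            simp only [hω', if_true]
          · rw [hDc]
            refine setLIntegral_congr_fun (hDc ▸ hD.compl) fun ω hω => ?_
            have hω' : treat t (M.observed (W ω)) ≠ a t := by rw [← hDc] at hω; exact hω
            simp only [if_neg hω']
      _ = ∫⁻ ω, ENNReal.ofReal (prop P t (a t) (M.observed (W ω))) *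
            (ENNReal.ofReal (ρ (hist t (M.observed (W ω)))) *
              φ (hist t (M.observed (W ω)), laterExo t (W ω))) ∂μ +
          ∫⁻ ω, ENNReal.ofReal (prop P t (!(a t)) (M.observed (W ω))) *
            (ENNReal.ofReal (ρ (hist t (M.observed (W ω)))) *
              ψ (hist t (M.observed (W ω)), laterExo t (W ω))) ∂μ := congrArg₂ (· + ·) h1 h2
      _ = _ := by
          refine (lintegral_add_left ((hmp (a t)).mul
            ((hρ'.mul hφ).comp (hH.prodMk hX))) _).symm.trans (lintegral_congr fun ω => ?_)
          simp only [Pi.mul_apply, Function.comp_apply]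
          ring
  have hrm : ∀ b, Measurable fun x : Hist T d t × LaterExo UX UA UY t => ENNReal.ofReal (r b x.1) :=
    fun b => ((hr b).comp measurable_fst).ennreal_ofReal
  have hfm : Measurable fun x : Hist T d t × LaterExo UX UA UY t => f t x.1 :=
    (hf t).comp measurable_fst
  rw [harm (G (a t) v) (fun x => ENNReal.ofReal (f t x.1) * G (a t) v x +
      ENNReal.ofReal (1 - f t x.1) * G (!(a t)) v x) (hG _ _)
      ((hfm.ennreal_ofReal.mul (hG _ _)).add
        ((measurable_const.sub hfm).ennreal_ofReal.mul (hG _ _))),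
    harm (fun x => ENNReal.ofReal (r (a t) x.1) * G (a t) v x)
      (fun x => ENNReal.ofReal (r (!(a t)) x.1) * G (!(a t)) v x)
      ((hrm _).mul (hG _ _)) ((hrm _).mul (hG _ _))]
  have hae : ∀ {p : Obs T d → Prop}, (∀ᵐ z ∂P, p z) → ∀ᵐ ω ∂μ, p (M.observed (W ω)) :=
    fun hp => ae_of_ae_map hZ.aemeasurable (hmap.symm ▸ hp)
  refine lintegral_congr_ae ?_
  filter_upwards [hae (hP.ae_prop_mul_flipWeight hs t), hae (hfs t)] with ω h1 h2
  obtain ⟨e1, e2, p1, p2⟩ := h1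
  have f01 := hf01 t (hist t (M.observed (W ω)))
  rw [← h2, er (a t), Function.comp_apply] at e1
  rw [← h2, er (!(a t)), Function.comp_apply] at e2
  set π1 := prop P t (a t) (M.observed (W ω))
  set π2 := prop P t (!(a t)) (M.observed (W ω))
  set F := f t (hist t (M.observed (W ω)))
  congr 1
  rw [← mul_assoc, ← mul_assoc, ← ENNReal.ofReal_mul p1, ← ENNReal.ofReal_mul p2, e1, e2,
    ENNReal.ofReal_add p1 (mul_nonneg p2 f01.1), ENNReal.ofReal_mul p2, ENNReal.ofReal_mul p2]
  ring

/-- Inverse weighting: the law of the outcome under the flip intervention is the law of the observed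
outcome weighted by the product of the ratios. -/
theorem lintegral_outcomeUnder_flip (hs : ∀ t, IsSmoothWeight (s t)) (hP : InModel a s C P)
    (hC : 1 ≤ C) {hW : Measurable W} (hM : M.StrongSequentialRandomization μ hW)
    {V : Fin T → Ω → ℝ}
    (hmap : μ.map (fun ω => M.observed (W ω)) = P) (hV : ∀ t, Measurable (V t))
    (hVu : ∀ t, μ.map (V t) = volume.restrict (Set.Icc 0 1)) (hVi : iIndepFun V μ)
    (hVW : IndepFun (fun ω t => V t ω) W μ) (hf : ∀ t, Measurable (f t))
    (hf01 : ∀ t h, f t h ∈ Set.Icc (0 : ℝ) 1)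
    (hfs : ∀ t, ∀ᵐ z ∂P, f t (hist t z) = s t (prop P t (a t) z)) (hg : Measurable g) :
    ∫⁻ ω, g (M.outcomeUnder (NPSEM.flip a f fun t => V t ω) (W ω)) ∂μ =
      ∫⁻ z, ENNReal.ofReal (cumWeight a s C P T z) * g (outcome z) ∂P := by
  have hV' : Measurable fun ω t => V t ω := measurable_pi_lambda _ hV
  have hlaw : μ.map (fun ω t => V t ω) =
      Measure.pi fun _ => volume.restrict (Set.Icc (0 : ℝ) 1) := by
    rw [(iIndepFun_iff_map_fun_eq_pi_map fun t => (hV t).aemeasurable).1 hVi]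
    simp only [hVu]
  have hprob : IsProbabilityMeasure (volume.restrict (Set.Icc (0 : ℝ) 1)) := ⟨by simp⟩
  have hΦ : Measurable fun x : (Fin T → ℝ) × Exo UX UA UY =>
      g (M.outcomeUnder (NPSEM.flip a f x.1) x.2) :=
    hg.comp (M.measurable_outcomeUnder_param (NPSEM.measurable_flip hf))
  have hstep : ∀ k ≤ T, ∫⁻ ω, ∫⁻ v, ENNReal.ofReal (cumWeight a s C P k (M.observed (W ω))) *
        g (M.outcomeUnder (startAt k (NPSEM.flip a f v)) (W ω))
        ∂Measure.pi (fun _ => volume.restrict (Set.Icc (0 : ℝ) 1)) ∂μ =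
      ∫⁻ ω, g (M.outcomeUnder (NPSEM.flip a f fun t => V t ω) (W ω)) ∂μ := by
    intro k
    induction k with
    | zero =>
      intro _
      simp only [cumWeight_zero, NPSEM.startAt_zero, ENNReal.ofReal_one, one_mul]
      have hj := (indepFun_iff_map_prod_eq_prod_map_map hV'.aemeasurable hW.aemeasurable).1 hVW
      calc _ = ∫⁻ w, ∫⁻ v, g (M.outcomeUnder (NPSEM.flip a f v) w)
              ∂Measure.pi (fun _ => volume.restrict (Set.Icc (0 : ℝ) 1)) ∂μ.map W :=
            (lintegral_map hΦ.lintegral_prod_left' hW).symm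
        _ = ∫⁻ x, g (M.outcomeUnder (NPSEM.flip a f x.1) x.2)
              ∂μ.map fun ω => ((fun t => V t ω), W ω) := by
            rw [hj, hlaw, lintegral_prod_symm _ hΦ.aemeasurable]
        _ = _ := lintegral_map hΦ (hV'.prodMk hW)
    | succ k ih =>
      intro hk
      rw [← ih (Nat.le_of_succ_le hk)]
      exact (lintegral_startAt_succ hs hP hC hM hmap hf hf01 hfs hg ⟨k, hk⟩).symm
  rw [← hstep T le_rfl]
  simp only [NPSEM.outcomeUnder_startAt_last, lintegral_const, measure_univ, mul_one]
  have hZ : Measurable fun ω => M.observed (W ω) := M.measurable_observed.comp hW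
  have e := lintegral_map (μ := μ) ((measurable_cumWeight' (a := a) (C := C) (P := P) hs
    T).ennreal_ofReal.mul (hg.comp measurable_outcome)) hZ
  rw [hmap] at e
  exact e.symm

/-- The mean counterfactual outcome under the flip intervention is identified. -/
theorem integral_outcomeUnder_flip (hs : ∀ t, IsSmoothWeight (s t)) (hP : InModel a s C P)
    (hC : 1 ≤ C) {hW : Measurable W} (hM : M.StrongSequentialRandomization μ hW)
    {V : Fin T → Ω → ℝ}
    (hmap : μ.map (fun ω => M.observed (W ω)) = P) (hV : ∀ t, Measurable (V t))
    (hVu : ∀ t, μ.map (V t) = volume.restrict (Set.Icc 0 1)) (hVi : iIndepFun V μ)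
    (hVW : IndepFun (fun ω t => V t ω) W μ) (hf : ∀ t, Measurable (f t))
    (hf01 : ∀ t h, f t h ∈ Set.Icc (0 : ℝ) 1)
    (hfs : ∀ t, ∀ᵐ z ∂P, f t (hist t z) = s t (prop P t (a t) z)) :
    Integrable (fun ω => M.outcomeUnder (NPSEM.flip a f fun t => V t ω) (W ω)) μ ∧
      ∫ ω, M.outcomeUnder (NPSEM.flip a f fun t => V t ω) (W ω) ∂μ = identifiedMean a s P := by
  have := hP.isProb
  have key := fun {g : ℝ → ℝ≥0∞} (hg : Measurable g) =>
    lintegral_outcomeUnder_flip hs hP hC hM hmap hV hVu hVi hVW hf hf01 hfs hg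
  have hY : Measurable fun ω => M.outcomeUnder (NPSEM.flip a f fun t => V t ω) (W ω) :=
    (M.measurable_outcomeUnder_param (NPSEM.measurable_flip hf)).comp
      ((measurable_pi_lambda _ hV).prodMk hW)
  have hRY : Integrable (fun z => cumWeight a s C P T z * outcome z) P :=
    (hP.memLp_cumWeight_mul_outcome hs hC).integrable (by norm_num)
  have hR0 := fun z => cumWeight_nonneg (a := a) (P := P) hs (zero_le_one.trans hC) T z
  have hint : Integrable (fun ω => M.outcomeUnder (NPSEM.flip a f fun t => V t ω) (W ω)) μ := by
    refine ⟨hY.aestronglyMeasurable, ?_⟩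
    rw [HasFiniteIntegral, key measurable_enorm]
    refine lt_of_eq_of_lt (lintegral_congr fun z => ?_) hRY.2
    rw [enorm_mul, Real.enorm_of_nonneg (hR0 z)]
  refine ⟨hint, ?_⟩
  rw [hP.identifiedMean_eq hs hC, integral_eq_lintegral_pos_part_sub_lintegral_neg_part hint,
    integral_eq_lintegral_pos_part_sub_lintegral_neg_part hRY,
    key (g := fun y => ENNReal.ofReal y) measurable_id.ennreal_ofReal,
    key (g := fun y => ENNReal.ofReal (-y)) measurable_neg.ennreal_ofReal]
  simp only [← mul_neg, ENNReal.ofReal_mul (hR0 _)]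

end CounterfactualMean

end Flip

theorem mainTheorem5 {T d : ℕ} (a : Fin T → Bool) (s : Fin T → ℝ → ℝ)
    (hs : ∀ t, Flip.IsSmoothWeight (s t)) (P : Measure (Flip.Obs T d))
    (hP : ∃ C : ℝ, Flip.InModel a s C P) :
    -- the identified mean is the mean counterfactual outcome under the flip interventions
    (∀ (Ω : Type u) [MeasurableSpace Ω] [StandardBorelSpace Ω]
        (μ : Measure Ω) [IsProbabilityMeasure μ]
        (UX UA : Fin T → Type v) (UY : Type v)
        [∀ t, MeasurableSpace (UX t)] [∀ t, MeasurableSpace (UA t)] [MeasurableSpace UY]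
        (M : Flip.NPSEM T d UX UA UY)
        (W : Ω → Flip.Exo UX UA UY) (hW : Measurable W)
        (V : Fin T → Ω → ℝ) (f : ∀ t, Flip.Hist T d t → ℝ),
      -- the observation has law `P`, and strong sequential randomization holds
      μ.map (fun ω => M.observed (W ω)) = P →
      M.StrongSequentialRandomization μ hW →
      -- the auxiliary variables are iid uniform and independent of the exogenous variables
      (∀ t, Measurable (V t)) →
      (∀ t, μ.map (V t) = volume.restrict (Set.Icc 0 1)) →
      iIndepFun V μ →
      IndepFun (fun ω t => V t ω) W μ →
      -- the weights are functions of the history, equal to `s_t` of the target propensity score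
      (∀ t, Measurable (f t)) →
      (∀ t h, f t h ∈ Set.Icc (0 : ℝ) 1) →
      (∀ t, ∀ᵐ z ∂P, f t (Flip.hist t z) = s t (Flip.prop P t (a t) z)) →
      Integrable
          (fun ω => M.outcomeUnder (Flip.NPSEM.flip a f (fun t => V t ω)) (W ω)) μ ∧
        ∫ ω, M.outcomeUnder (Flip.NPSEM.flip a f (fun t => V t ω)) (W ω) ∂μ =
          Flip.identifiedMean a s P) ∧
    -- its efficient influence function in the nonparametric model
    Flip.IsEfficientInfluenceFunction (Flip.nonparametricSubmodels d a s)
      (Flip.identifiedMean a s) P (fun z => Flip.phiM a s P z + Flip.phiQ a s P z) := by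
  obtain ⟨C, hC⟩ := hP
  refine ⟨fun Ω _ _ μ _ UX UA UY _ _ _ M W hW V f hmap hM hV hVu hVi hVW hf hf01 hfs => ?_,
    hC.isEfficientInfluenceFunction hs⟩
  exact Flip.integral_outcomeUnder_flip hs (hC.mono (le_max_left C 1)) (le_max_right C 1) hM hmap
    hV hVu hVi hVW hf hf01 hfs
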